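/- Let $n\ge 1$, $L>0$, and write the points of $\mathbb R^{n+1}$ as $(x,z)$, $x\in\mathbb R^n$, $z\in\mathbb R$. Let $\Lambda\subset\mathbb R^{n+1}$ be an infinite $L$-periodic pipe: an open set with $\Lambda+L e_z=\Lambda$, with boundary of class $C^2$, whose cross sections $\Sigma_z=\{x:(x,z)\in\Lambda\}$ are nonempty and connected for every $z\in\mathbb R$, and whose cell $\Lambda_{0,L}=\{(x,z)\in\Lambda: 0<z<L\}$ is bounded. Let $L^2_*(\Lambda)$ be the space of functions in $L^2_{loc}(\overline\Lambda)$ that are $L$-periodic in $z$, and let $H^1_*(\Lambda)$ be the space of those $\phi\in L^2_*(\Lambda)$ with weak gradient $\nabla\phi\in L^2_*(\Lambda)$. Let $C^\infty_{0,*}(\Lambda)$ be the space of smooth fields, $L$-periodic in $z$, whose (closed) support is contained in $\Lambda$, let $H^1_{0,*}(\Lambda)$ be its closure in $H^1_*(\Lambda)$ (the fields in $H^1_*(\Lambda)$ with zero trace on $\partial\Lambda$), and $$\mathbb V=\{u\in H^1_{0,*}(\Lambda;\mathbb R^{n+1}):\ \nabla\cdot u=0\}.$$ Put $(f,\phi)=\int_{\Lambda_{0,L}}f\cdot\phi$,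 $((u,\phi))=\int_{\Lambda_{0,L}}\nabla u\cdot\nabla\phi$, and norm $H^1_{0,*}(\Lambda)$ and $\mathbb V$ by $\|u\|_1=((u,u))^{1/2}$; functions that agree almost everywhere in $\Lambda$ are identified. (a) For every $f\in L^2_*(\Lambda;\mathbb R^{n+1})$ there is a unique $v\in\mathbb V$ with $((v,\phi))=(f,\phi)$ for all $\phi\in\mathbb V$. This $v$ solves the stationary $z$-periodic Stokes problem: there is $p\in L^2_*(\Lambda)$ such that $$-\Delta v+\nabla p=f\ \text{ in }\Lambda,\qquad \nabla\cdot v=0\ \text{ in }\Lambda,\qquad v=0\ \text{ on }\partial\Lambda,$$ $$v(x,z+L)=v(x,z),\qquad p(x,z+L)=p(x,z),$$ where the equations hold in the sense of distributions in $\Lambda$ and the boundary condition in the sense of traces. (b) For every bounded linear functional $f\in\mathbb V'$ there is a unique $v\in\mathbb V$ with $((v,\phi))=\langle f,\phi\rangle$ for all $\phi\in\mathbb V$. Moreover, $f$ has an extension to a bounded linear functional on $H^1_{0,*}(\Lambda)$, and for every such extension $F$ the field $v$ solves the stationary $z$-periodic Stokes problem with force $F$: there is $p\in L^2_*(\Lambda)$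 such that $((v,\phi))-\int_{\Lambda_{0,L}}p\,\nabla\cdot\phi=\langle F,\phi\rangle$ for all $\phi\in C^\infty_{0,*}(\Lambda;\mathbb R^{n+1})$ (that is, $-\Delta v+\nabla p=F$ as $z$-periodic distributions), $\nabla\cdot v=0$ in $\Lambda$, $v=0$ on $\partial\Lambda$ in the sense of traces, and $v,p$ are $L$-periodic in $z$. -/

import Mathlib

open MeasureTheory Filter Topology
open scoped ContDiff ENNReal

set_option linter.unusedSectionVars false

noncomputable section

/-- The space `ℝ^{n+1}` of points `(x, z)`, `x ∈ ℝ^n`, `z ∈ ℝ` being the last coordinate. -/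
abbrev PSpace (n : ℕ) : Type := EuclideanSpace ℝ (Fin (n + 1))

namespace Pipe

variable {n : ℕ}

/-- The axial coordinate `z` of a point. -/
def zc (x : PSpace n) : ℝ := x (Fin.last n)

/-- The `j`-th vector of the canonical basis. -/
def bvec (j : Fin (n + 1)) : PSpace n := EuclideanSpace.single j 1

/-- The unit vector in the axial direction. -/
def ez : PSpace n := bvec (Fin.last n)

/-- The cell `Λ_{0,L}`, the part of the pipe with `0 < z < L`. -/
def cell (L : ℝ) (Λ : Set (PSpace n)) : Set (PSpace n) := {x | x ∈ Λ ∧ 0 < zc x ∧ zc x < L}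

/-- One period of the lateral boundary `S = ∂Λ`. -/
def lateral (L : ℝ) (Λ : Set (PSpace n)) : Set (PSpace n) :=
  {x | x ∈ frontier Λ ∧ 0 ≤ zc x ∧ zc x < L}

/-- The boundary of `Λ` is of class `C²`: near each boundary point, `Λ` is the set of points lying
below the graph of a `C²` function, in the direction of some unit vector `e`
(the function is evaluated at the projection of the point to the hyperplane orthogonal to `e`). -/
def HasC2Boundary (Λ : Set (PSpace n)) : Prop :=
  ∀ x₀ ∈ frontier Λ, ∃ (e : PSpace n) (γ : PSpace n → ℝ) (r : ℝ),
    ‖e‖ = 1 ∧ ContDiff ℝ 2 γ ∧ 0 < r ∧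
      ∀ x ∈ Metric.ball x₀ r, (x ∈ Λ ↔ inner ℝ x e < γ (x - (inner ℝ x e : ℝ) • e))

/-- An infinite pipe, `L`-periodic in the axial direction, with `C²` boundary,
nonempty connected cross sections and a bounded cell. -/
structure IsPipe (L : ℝ) (Λ : Set (PSpace n)) : Prop where
  isOpen : IsOpen Λ
  periodic : ∀ x, x + L • ez ∈ Λ ↔ x ∈ Λ
  section_connected : ∀ z : ℝ, IsConnected {x | x ∈ Λ ∧ zc x = z}
  cell_bounded : Bornology.IsBounded (cell L Λ)
  boundary : HasC2Boundary Λ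

section Spaces

variable {F : Type*} [NormedAddCommGroup F] [NormedSpace ℝ F]

/-- Smooth functions with compact support contained in `Λ`. -/
structure IsTest (Λ : Set (PSpace n)) (ψ : PSpace n → F) : Prop where
  smooth : ContDiff ℝ ∞ ψ
  compact : HasCompactSupport ψ
  supp : tsupport ψ ⊆ Λ

/-- `C^∞_{0,*}(Λ)`: smooth `z`-periodic functions whose (closed) support is contained in `Λ`,
extended by zero outside `Λ`. -/
structure IsPerTest (L : ℝ) (Λ : Set (PSpace n)) (φ : PSpace n → F) : Prop where
  smooth : ContDiff ℝ ∞ φ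
  periodic : ∀ x, φ (x + L • ez) = φ x
  supp : tsupport φ ⊆ Λ

/-- `L²_*(Λ)`: `z`-periodic functions on `Λ` in `L²_loc` of the closure of `Λ`
(values outside `Λ` are irrelevant). -/
structure IsL2Per (L : ℝ) (Λ : Set (PSpace n)) (u : PSpace n → F) : Prop where
  periodic : ∀ x ∈ Λ, u (x + L • ez) = u x
  memLp : ∀ K, IsCompact K → MemLp u 2 (volume.restrict (Λ ∩ K))

/-- The partial derivative `∂_j φ` of a differentiable function. -/
def pd (j : Fin (n + 1)) (φ : PSpace n → F) (x : PSpace n) : F := fderiv ℝ φ x (bvec j)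

/-- `G` is the weak gradient of `u` in `Λ`: `G j` is the partial derivative `∂_j u` in the sense
of distributions. -/
structure HasWeakGrad (Λ : Set (PSpace n)) (u : PSpace n → F)
    (G : Fin (n + 1) → PSpace n → F) : Prop where
  locInt : LocallyIntegrableOn u Λ
  locInt_grad : ∀ j, LocallyIntegrableOn (G j) Λ
  parts : ∀ j, ∀ ψ : PSpace n → ℝ, IsTest Λ ψ →
    ∫ x in Λ, pd j ψ x • u x = - ∫ x in Λ, ψ x • G j x

open Classical in
/-- The weak gradient in `Λ` (determined almost everywhere in `Λ`; zero if there is none). -/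
def weakGrad (Λ : Set (PSpace n)) (u : PSpace n → F) : Fin (n + 1) → PSpace n → F :=
  if h : ∃ G, HasWeakGrad Λ u G then h.choose else 0

end Spaces

/-- `∇·ψ` for a differentiable field `ψ`. -/
def div (ψ : PSpace n → PSpace n) (x : PSpace n) : ℝ := ∑ j, pd j ψ x j

/-- `∇·u = 0` in `Λ`, in the sense of distributions. -/
def WeakDivFree (Λ : Set (PSpace n)) (u : PSpace n → PSpace n) : Prop :=
  ∀ ψ : PSpace n → ℝ, IsTest Λ ψ → ∫ x in Λ, fderiv ℝ ψ x (u x) = 0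

/-- `(f, φ) = ∫_{Λ_{0,L}} f · φ`. -/
def l2Inner (L : ℝ) (Λ : Set (PSpace n)) (f φ : PSpace n → PSpace n) : ℝ :=
  ∫ x in cell L Λ, inner ℝ (f x) (φ x)

/-- `((u, φ)) = ∫_{Λ_{0,L}} ∇u · ∇φ`. -/
def gradInner (L : ℝ) (Λ : Set (PSpace n)) (u φ : PSpace n → PSpace n) : ℝ :=
  ∫ x in cell L Λ, ∑ j, inner ℝ (weakGrad Λ u j x) (weakGrad Λ φ j x)

/-- `‖u‖_1 = ((u, u))^{1/2}`. -/
def gradNorm (L : ℝ) (Λ : Set (PSpace n)) (u : PSpace n → PSpace n) : ℝ :=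
  Real.sqrt (gradInner L Λ u u)

/-- `u ∈ H^1_*(Λ)`: `u` and its weak gradient are in `L²_*(Λ)`. -/
def IsH1Per (L : ℝ) (Λ : Set (PSpace n)) (u : PSpace n → PSpace n) : Prop :=
  IsL2Per L Λ u ∧ ∃ G, (∀ j, IsL2Per L Λ (G j)) ∧ HasWeakGrad Λ u G

/-- `u ∈ H^1_*(Λ)` has trace `g` on `S = ∂Λ`: `u` is the limit in `H^1(Λ_{0,L})` of smooth
`z`-periodic fields (smooth up to the boundary) whose restrictions to the boundary converge to `g`
in `L²` of (one period of) `S` with respect to the surface measure. -/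
def HasTrace (L : ℝ) (Λ : Set (PSpace n)) (u g : PSpace n → PSpace n) : Prop :=
  ∃ w : ℕ → PSpace n → PSpace n,
    (∀ k, ContDiff ℝ ∞ (w k) ∧ ∀ x, w k (x + L • ez) = w k x) ∧
    Tendsto (fun k => eLpNorm (fun x => u x - w k x) 2 (volume.restrict (cell L Λ)))
      atTop (𝓝 0) ∧
    (∀ j, Tendsto (fun k => eLpNorm (fun x => weakGrad Λ u j x - pd j (w k) x) 2
      (volume.restrict (cell L Λ))) atTop (𝓝 0)) ∧
    Tendsto (fun k => eLpNorm (fun x => w k x - g x) 2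
      ((Measure.hausdorffMeasure (n : ℝ)).restrict (lateral L Λ))) atTop (𝓝 0)

/-- Membership in `H^1_{0,*}(Λ)`, the closure of `C^∞_{0,*}(Λ)` in `H^1_*(Λ)`. -/
def IsH10Per (L : ℝ) (Λ : Set (PSpace n)) (u : PSpace n → PSpace n) : Prop :=
  IsL2Per L Λ u ∧ ∃ G, (∀ j, IsL2Per L Λ (G j)) ∧ HasWeakGrad Λ u G ∧
    ∀ ε : ℝ≥0∞, 0 < ε → ∃ φ : PSpace n → PSpace n, IsPerTest L Λ φ ∧
      eLpNorm (fun x => u x - φ x) 2 (volume.restrict (cell L Λ)) ≤ ε ∧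
      ∀ j, eLpNorm (fun x => G j x - pd j φ x) 2 (volume.restrict (cell L Λ)) ≤ ε

section Linear

variable {F : Type*} [NormedAddCommGroup F] [NormedSpace ℝ F] {L : ℝ} {Λ : Set (PSpace n)}

theorem IsL2Per.add {u v : PSpace n → F} (hu : IsL2Per L Λ u) (hv : IsL2Per L Λ v) :
    IsL2Per L Λ (u + v) :=
  ⟨fun x hx => by simp [hu.periodic x hx, hv.periodic x hx],
    fun K hK => (hu.memLp K hK).add (hv.memLp K hK)⟩

theorem IsL2Per.smul (c : ℝ) {u : PSpace n → F} (hu : IsL2Per L Λ u) : IsL2Per L Λ (c • u) :=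
  ⟨fun x hx => by simp [hu.periodic x hx], fun K hK => (hu.memLp K hK).const_smul c⟩

theorem IsL2Per.zero : IsL2Per L Λ (0 : PSpace n → F) :=
  ⟨fun _ _ => rfl, fun _ _ => MemLp.zero⟩

theorem IsL2Per.aesm {u : PSpace n → F} (hu : IsL2Per L Λ u) :
    AEStronglyMeasurable u (volume.restrict (cell L Λ)) := by
  have h : AEStronglyMeasurable u
      (volume.restrict (⋃ k : ℕ, Λ ∩ Metric.closedBall (0 : PSpace n) k)) :=
    aestronglyMeasurable_iUnion_iff.2 fun k =>
      (hu.memLp _ (isCompact_closedBall _ _)).aestronglyMeasurable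
  refine h.mono_measure (Measure.restrict_mono ?_ le_rfl)
  intro x hx
  obtain ⟨k, hk⟩ := exists_nat_ge ‖x‖
  exact Set.mem_iUnion.2 ⟨k, hx.1, by simpa using hk⟩

theorem IsL2Per.locInt {u : PSpace n → F} (hu : IsL2Per L Λ u) : LocallyIntegrableOn u Λ := by
  intro x _
  refine ⟨Λ ∩ Metric.closedBall x 1, ?_, ?_⟩
  · exact inter_mem self_mem_nhdsWithin
      (mem_nhdsWithin_of_mem_nhds (Metric.closedBall_mem_nhds x one_pos))
  · have hm := hu.memLp _ (isCompact_closedBall x 1)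
    have : IsFiniteMeasure (volume.restrict (Λ ∩ Metric.closedBall x 1)) :=
      ⟨by
        rw [Measure.restrict_apply_univ]
        exact (measure_mono Set.inter_subset_right).trans_lt
          (isCompact_closedBall x 1).measure_lt_top⟩
    exact hm.integrable (by norm_num)

/-- A pairing of a locally integrable function with a compactly supported one is integrable. -/
theorem integrable_pairing {G H : Type*} [NormedAddCommGroup G] [NormedSpace ℝ G]
    [NormedAddCommGroup H] [NormedSpace ℝ H] (B : G →L[ℝ] F →L[ℝ] H) {u : PSpace n → F}
    (hu : LocallyIntegrableOn u Λ) {g : PSpace n → G} (hg : Continuous g)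
    (hc : HasCompactSupport g) (hs : tsupport g ⊆ Λ) :
    Integrable (fun x => B (g x) (u x)) (volume.restrict Λ) := by
  have hK : IntegrableOn u (tsupport g) := hu.integrableOn_compact_subset hs hc
  obtain ⟨C, hC⟩ := hg.bounded_above_of_compact_support hc
  have h1 : IntegrableOn (fun x => B (g x) (u x)) (tsupport g) := by
    refine Integrable.mono' (hK.norm.const_mul (‖B‖ * C)) ?_ (Eventually.of_forall fun x => ?_)
    · exact B.aestronglyMeasurable_comp₂ hg.aestronglyMeasurable hK.aestronglyMeasurable
    · refine (B.le_opNorm₂ _ _).trans ?_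
      gcongr
      exact hC x
  have h2 : Integrable (fun x => B (g x) (u x)) := by
    refine (integrableOn_iff_integrable_of_support_subset ?_).1 h1
    intro x hx
    refine subset_tsupport g fun h0 => hx ?_
    simp [h0]
  exact h2.restrict

theorem IsTest.integrable_smul {ψ : PSpace n → ℝ} (hψ : IsTest Λ ψ) {u : PSpace n → F}
    (hu : LocallyIntegrableOn u Λ) : Integrable (fun x => ψ x • u x) (volume.restrict Λ) :=
  integrable_pairing (ContinuousLinearMap.lsmul ℝ ℝ) hu hψ.smooth.continuous hψ.compact hψ.supp

theorem IsTest.fderiv_tsupport {ψ : PSpace n → ℝ} (hψ : IsTest Λ ψ) :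
    tsupport (fderiv ℝ ψ) ⊆ Λ := (tsupport_fderiv_subset ℝ).trans hψ.supp

theorem IsTest.continuous_fderiv {ψ : PSpace n → ℝ} (hψ : IsTest Λ ψ) :
    Continuous (fderiv ℝ ψ) := hψ.smooth.continuous_fderiv (by simp)

theorem IsTest.integrable_pd_smul {ψ : PSpace n → ℝ} (hψ : IsTest Λ ψ) {u : PSpace n → F}
    (hu : LocallyIntegrableOn u Λ) (j : Fin (n + 1)) :
    Integrable (fun x => pd j ψ x • u x) (volume.restrict Λ) := by
  have := integrable_pairing
    ((ContinuousLinearMap.lsmul ℝ ℝ : ℝ →L[ℝ] F →L[ℝ] F).comp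
      (ContinuousLinearMap.apply ℝ ℝ (bvec j))) hu hψ.continuous_fderiv
    (hψ.compact.fderiv ℝ) hψ.fderiv_tsupport
  simpa [pd] using this

theorem IsTest.integrable_fderiv_apply {ψ : PSpace n → ℝ} (hψ : IsTest Λ ψ)
    {u : PSpace n → PSpace n} (hu : LocallyIntegrableOn u Λ) :
    Integrable (fun x => fderiv ℝ ψ x (u x)) (volume.restrict Λ) :=
  integrable_pairing (ContinuousLinearMap.id ℝ (PSpace n →L[ℝ] ℝ)) hu hψ.continuous_fderiv
    (hψ.compact.fderiv ℝ) hψ.fderiv_tsupport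

theorem HasWeakGrad.add {u v : PSpace n → F} {G H : Fin (n + 1) → PSpace n → F}
    (hu : HasWeakGrad Λ u G) (hv : HasWeakGrad Λ v H) : HasWeakGrad Λ (u + v) (G + H) where
  locInt := hu.locInt.add hv.locInt
  locInt_grad j := (hu.locInt_grad j).add (hv.locInt_grad j)
  parts j ψ hψ := by
    simp only [Pi.add_apply, smul_add]
    rw [integral_add (hψ.integrable_pd_smul hu.locInt j) (hψ.integrable_pd_smul hv.locInt j),
      integral_add (hψ.integrable_smul (hu.locInt_grad j))
      (hψ.integrable_smul (hv.locInt_grad j)), hu.parts j ψ hψ, hv.parts j ψ hψ]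
    abel

theorem HasWeakGrad.smul (c : ℝ) {u : PSpace n → F} {G : Fin (n + 1) → PSpace n → F}
    (hu : HasWeakGrad Λ u G) : HasWeakGrad Λ (c • u) (c • G) where
  locInt := hu.locInt.smul c
  locInt_grad j := (hu.locInt_grad j).smul c
  parts j ψ hψ := by
    simp only [Pi.smul_apply, smul_comm _ c, integral_smul, hu.parts j ψ hψ, smul_neg]

theorem HasWeakGrad.zero :
    HasWeakGrad Λ (0 : PSpace n → F) (0 : Fin (n + 1) → PSpace n → F) where
  locInt := (IsL2Per.zero (L := 0)).locInt
  locInt_grad _ := (IsL2Per.zero (L := 0)).locInt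
  parts j ψ hψ := by simp

theorem IsPerTest.aesm {φ : PSpace n → F} (hφ : IsPerTest L Λ φ) (μ : Measure (PSpace n)) :
    AEStronglyMeasurable φ μ :=
  hφ.smooth.continuous.aestronglyMeasurable

theorem IsPerTest.aesm_pd {φ : PSpace n → F} (hφ : IsPerTest L Λ φ) (μ : Measure (PSpace n))
    (j : Fin (n + 1)) : AEStronglyMeasurable (pd j φ) μ :=
  ((hφ.smooth.continuous_fderiv (by simp)).clm_apply continuous_const).aestronglyMeasurable

theorem IsPerTest.add {φ χ : PSpace n → F} (hφ : IsPerTest L Λ φ) (hχ : IsPerTest L Λ χ) :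
    IsPerTest L Λ (φ + χ) where
  smooth := hφ.smooth.add hχ.smooth
  periodic x := by simp [hφ.periodic x, hχ.periodic x]
  supp := (tsupport_add φ χ).trans (Set.union_subset hφ.supp hχ.supp)

theorem IsPerTest.smul (c : ℝ) {φ : PSpace n → F} (hφ : IsPerTest L Λ φ) :
    IsPerTest L Λ (c • φ) where
  smooth := contDiff_const.smul hφ.smooth
  periodic x := by simp [hφ.periodic x]
  supp := (closure_mono (Function.support_const_smul_subset c φ)).trans hφ.supp

end Linear

/-- The space `H^1_{0,*}(Λ)`, as a space of functions (two functions which agree almost everywhere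
in `Λ` represent the same element). -/
def H10 (L : ℝ) (Λ : Set (PSpace n)) : Submodule ℝ (PSpace n → PSpace n) where
  carrier := {u | IsH10Per L Λ u}
  zero_mem' :=
    ⟨.zero, 0, fun _ => .zero, .zero, fun ε _ =>
      ⟨0, ⟨contDiff_const, fun _ => rfl, by simp⟩, by simp, fun j => by simp [pd]⟩⟩
  add_mem' := by
    rintro u v ⟨hu, G, hG, huG, hua⟩ ⟨hv, H, hH, hvH, hva⟩
    refine ⟨hu.add hv, G + H, fun j => (hG j).add (hH j), huG.add hvH, fun ε hε => ?_⟩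
    have hε2 : 0 < ε / 2 := ENNReal.half_pos hε.ne'
    obtain ⟨φ, hφ, h1, h2⟩ := hua _ hε2
    obtain ⟨χ, hχ, h3, h4⟩ := hva _ hε2
    refine ⟨φ + χ, hφ.add hχ, ?_, fun j => ?_⟩
    · have e : (fun x => (u + v) x - (φ + χ) x) = (fun x => u x - φ x) + fun x => v x - χ x := by
        funext x; simp only [Pi.add_apply]; abel
      rw [e]
      exact (eLpNorm_add_le (hu.aesm.sub (hφ.aesm _)) (hv.aesm.sub (hχ.aesm _))
        (by norm_num)).trans ((add_le_add h1 h3).trans (ENNReal.add_halves ε).le)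
    · have e : (fun x => (G + H) j x - pd j (φ + χ) x) =
          (fun x => G j x - pd j φ x) + fun x => H j x - pd j χ x := by
        funext x
        simp only [pd, fderiv_add (hφ.smooth.differentiable (by simp) x)
          (hχ.smooth.differentiable (by simp) x), Pi.add_apply, add_apply]
        abel
      rw [e]
      exact (eLpNorm_add_le ((hG j).aesm.sub (hφ.aesm_pd _ j)) ((hH j).aesm.sub (hχ.aesm_pd _ j))
        (by norm_num)).trans ((add_le_add (h2 j) (h4 j)).trans (ENNReal.add_halves ε).le)
  smul_mem' := by
    rintro c u ⟨hu, G, hG, huG, hua⟩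
    refine ⟨hu.smul c, c • G, fun j => (hG j).smul c, huG.smul c, fun ε hε => ?_⟩
    obtain ⟨φ, hφ, h1, h2⟩ := hua (ε / ‖c‖ₑ) (ENNReal.div_pos hε.ne' enorm_ne_top)
    refine ⟨c • φ, hφ.smul c, ?_, fun j => ?_⟩
    · have e : (fun x => (c • u) x - (c • φ) x) = c • fun x => u x - φ x := by
        funext x; simp [smul_sub]
      rw [e, eLpNorm_const_smul]
      exact (mul_le_mul_right h1 _).trans ENNReal.mul_div_le
    · have e : (fun x => (c • G) j x - pd j (c • φ) x) = c • fun x => G j x - pd j φ x := by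
        funext x
        simp [pd, fderiv_const_smul (hφ.smooth.differentiable (by simp) x), smul_sub]
      rw [e, eLpNorm_const_smul]
      exact (mul_le_mul_right (h2 j) _).trans ENNReal.mul_div_le

/-- The space `𝕍(Λ) = {u ∈ H^1_{0,*}(Λ) : ∇·u = 0}`. -/
def V (L : ℝ) (Λ : Set (PSpace n)) : Submodule ℝ (PSpace n → PSpace n) where
  carrier := {u | u ∈ H10 L Λ ∧ WeakDivFree Λ u}
  zero_mem' := ⟨(H10 L Λ).zero_mem, fun ψ _ => by simp⟩
  add_mem' := by
    rintro u v ⟨hu, hu'⟩ ⟨hv, hv'⟩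
    refine ⟨(H10 L Λ).add_mem hu hv, fun ψ hψ => ?_⟩
    simp only [Pi.add_apply, map_add]
    rw [integral_add (hψ.integrable_fderiv_apply hu.1.locInt)
      (hψ.integrable_fderiv_apply hv.1.locInt), hu' ψ hψ, hv' ψ hψ, add_zero]
  smul_mem' := by
    rintro c u ⟨hu, hu'⟩
    refine ⟨(H10 L Λ).smul_mem c hu, fun ψ hψ => ?_⟩
    simp only [Pi.smul_apply, map_smul, integral_smul, hu' ψ hψ, smul_zero]

theorem V_le_H10 (L : ℝ) (Λ : Set (PSpace n)) : V L Λ ≤ H10 L Λ := fun _ h => h.1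

/-- A linear functional on a space of fields is bounded with respect to the norm `‖·‖_1`. -/
def IsBoundedFunctional (L : ℝ) (Λ : Set (PSpace n)) {W : Submodule ℝ (PSpace n → PSpace n)}
    (f : W →ₗ[ℝ] ℝ) : Prop :=
  ∃ C : ℝ, ∀ φ : W, |f φ| ≤ C * gradNorm L Λ φ

/-- `v` is the unique element of `𝕍` (up to equality almost everywhere in `Λ`) such that
`((v, φ)) = f φ` for all `φ ∈ 𝕍`. -/
def IsUniqueVariationalSolution (L : ℝ) (Λ : Set (PSpace n)) (f : V L Λ → ℝ)
    (v : PSpace n → PSpace n) : Prop :=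
  (v ∈ V L Λ ∧ ∀ φ : V L Λ, gradInner L Λ v φ = f φ) ∧
    ∀ w ∈ V L Λ, (∀ φ : V L Λ, gradInner L Λ w φ = f φ) → w =ᵐ[volume.restrict Λ] v

/-- All the conditions of the stationary `z`-periodic Stokes problem except for the momentum
equation: `v` is a `z`-periodic `H^1` field, `p` a `z`-periodic (locally square integrable)
pressure, `∇·v = 0` in `Λ`, and `v = 0` on `∂Λ` in the sense of traces. -/
structure IsPeriodicNoSlip (L : ℝ) (Λ : Set (PSpace n)) (v : PSpace n → PSpace n)
    (p : PSpace n → ℝ) : Prop where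
  velocity : IsH1Per L Λ v
  pressure : IsL2Per L Λ p
  divFree : WeakDivFree Λ v
  noSlip : HasTrace L Λ v 0

/-- `(v, p)` solves the stationary `z`-periodic Stokes problem with force `f ∈ L²_*(Λ)`; the
equation `-Δv + ∇p = f` holds in the sense of distributions in `Λ`. -/
structure SolvesStokes (L : ℝ) (Λ : Set (PSpace n)) (f v : PSpace n → PSpace n)
    (p : PSpace n → ℝ) : Prop extends IsPeriodicNoSlip L Λ v p where
  momentum : ∀ ψ : PSpace n → PSpace n, IsTest Λ ψ →
    (∫ x in Λ, ∑ j, inner ℝ (weakGrad Λ v j x) (pd j ψ x)) - ∫ x in Λ, p x * div ψ x =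
      ∫ x in Λ, inner ℝ (f x) (ψ x)

/-- `(v, p)` solves the stationary `z`-periodic Stokes problem with force `F` in the dual of
`H^1_{0,*}(Λ)`; the equation `-Δv + ∇p = F` holds in the sense of `z`-periodic distributions
in `Λ`, that is, tested with `C^∞_{0,*}(Λ)`. -/
structure SolvesStokesDual (L : ℝ) (Λ : Set (PSpace n)) (F : H10 L Λ →ₗ[ℝ] ℝ)
    (v : PSpace n → PSpace n) (p : PSpace n → ℝ) : Prop extends IsPeriodicNoSlip L Λ v p where
  momentum : ∀ φ : H10 L Λ, IsPerTest L Λ (φ : PSpace n → PSpace n) →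
    (∫ x in cell L Λ, ∑ j, inner ℝ (weakGrad Λ v j x) (pd j (φ : PSpace n → PSpace n) x)) -
      ∫ x in cell L Λ, p x * div φ x = F φ

end Pipe

end

/-! The velocity comes from Riesz representation. Poincaré's inequality in a direction transverse to
the axis (`exists_poincare_const`, where n ≥ 1 enters) shows that the gradient maps H10 onto a
closed subspace of the L² tensor fields on the cell (`isClosed_range_gradMap`), with kernel the
fields that vanish almost everywhere; 𝕍 corresponds to the trace-free part, again closed
(`isClosed_range_gradMap_V`).

The pressure is the substance. The functional ((v, ·)) - F vanishes on 𝕍, the kernel of the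
divergence, and has to be written as (p, ∇· ·). This is possible as soon as the adjoint of the
divergence, a weak gradient, has closed range. By `exists_inner_eq_of_ker` it suffices that ‖g‖ ≤ C
(‖∇g‖₋₁ + Σ |(hᵢ, g)|) for finitely many fixed hᵢ. A finite-dimensional defect does not spoil
closedness, so neither a compact embedding nor a description of the kernel of the gradient is
needed.

That estimate is local: by compactness of the closure of the cell it is enough to prove it near each
point (`exists_controlled_nhds`, `exists_norm_le_of_dual_bound`). Near a point it is dual to
`Solvable`: in a small domain D, each g is within ε of div u + m h, with u compactly supported in D,
h fixed, and the size of u and m bounded by ‖g‖ independently of ε.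

On a cube (`solvable_box`) one solves the equation on the torus by Fourier series and then makes the
field vanish on the faces by combining it with two different reflections in each variable. The
combinations commute with the divergence in the sense of `cdiv_reflField`. Truncating small values
then produces compact support. A C² boundary is locally flattened by a rigid motion and a shear,
whose Jacobian is 1, so the Piola transform carries solutions from cubes to neighbourhoods of
boundary points (`Solvable.image`, `exists_solvable_nhds`).

Integrals over the pipe and over one cell are exchanged by summing a test function over its
translates (`integral_pairing_eq_cell`). -/

noncomputable section

namespace Pipe

open scoped NNReal

variable {n : ℕ}

/-! ### Composition with inverse-Lipschitz maps -/

/-- Lipschitz images enlarge the volume at most by a constant factor. -/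
theorem exists_volume_image_le (K : ℝ≥0) : ∃ C : ℝ≥0, ∀ (g : PSpace n → PSpace n)
    (s : Set (PSpace n)), LipschitzOnWith K g s → volume (g '' s) ≤ C * volume s := by
  set ν : Measure (PSpace n) := μH[((n + 1 : ℕ) : ℝ)] with hν
  have : ν.IsAddHaarMeasure := by
    simpa [hν] using isAddHaarMeasure_hausdorffMeasure (E := PSpace n)
  -- Volume and the (n+1)-dimensional Hausdorff measure are both translation invariant, hence
  -- proportional, and Hausdorff measure is the one that Lipschitz maps visibly control.
  have h := Measure.isAddLeftInvariant_eq_smul (volume : Measure (PSpace n)) ν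
  refine ⟨K ^ (n + 1), fun g s hg => ?_⟩
  have h1 := hg.hausdorffMeasure_image_le (d := ((n + 1 : ℕ) : ℝ)) (by positivity)
  rw [h]
  simp only [Measure.smul_apply]
  rw [mul_smul_comm]
  gcongr
  have h2 : ν (g '' s) ≤ (K : ℝ≥0∞) ^ ((n + 1 : ℕ) : ℝ) * ν s := h1
  rw [ENNReal.rpow_natCast] at h2
  simpa using h2

/-- Composition with a map whose inverse is Lipschitz is bounded in `L²`. -/
theorem exists_eLpNorm_comp_le (K : ℝ≥0) : ∃ C : ℝ≥0, ∀ {F : Type} [NormedAddCommGroup F]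
    (f : PSpace n → PSpace n) (A B : Set (PSpace n)), Measurable f → MeasurableSet A →
    MeasurableSet B → Set.MapsTo f A B → (∀ x ∈ A, ∀ y ∈ A, dist x y ≤ K * dist (f x) (f y)) →
    ∀ h : PSpace n → F, AEStronglyMeasurable h (volume.restrict B) →
      AEStronglyMeasurable (h ∘ f) (volume.restrict A) ∧
      eLpNorm (h ∘ f) 2 (volume.restrict A) ≤ C * eLpNorm h 2 (volume.restrict B) := by
  obtain ⟨C, hC⟩ := exists_volume_image_le (n := n) K
  refine ⟨C ^ (1 / 2 : ℝ), fun {F} _ f A B hf hA hB hAB hK h hh => ?_⟩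
  -- The inverse of `f` on `A` is Lipschitz, so preimages within `A` are at most `C` times as large:
  -- the pushforward of volume is dominated by `C` times volume. The L² norm sees the square root of
  -- `C`.
  have hle : Measure.map f (volume.restrict A) ≤ (C : ℝ≥0∞) • volume.restrict B := by
    refine Measure.le_iff.2 fun M hM => ?_
    rw [Measure.map_apply hf hM, Measure.restrict_apply (hf hM), Measure.smul_apply,
      Measure.restrict_apply hM]
    have hinj : Set.InjOn f A := fun x hx y hy hxy => by
      have := hK x hx y hy
      rw [hxy, dist_self, mul_zero] at this
      exact dist_le_zero.1 this
    have hne : Nonempty (PSpace n) := ⟨0⟩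
    set g := Function.invFunOn f A
    have hgf : ∀ x ∈ A, g (f x) = x := hinj.leftInvOn_invFunOn
    have hlip : LipschitzOnWith K g (f '' (f ⁻¹' M ∩ A)) := by
      refine LipschitzOnWith.of_dist_le_mul ?_
      rintro _ ⟨x, hx, rfl⟩ _ ⟨y, hy, rfl⟩
      rw [hgf x hx.2, hgf y hy.2]
      exact hK x hx.2 y hy.2
    have h1 : f ⁻¹' M ∩ A ⊆ g '' (f '' (f ⁻¹' M ∩ A)) := fun x hx =>
      ⟨f x, ⟨x, hx, rfl⟩, hgf x hx.2⟩
    calc volume (f ⁻¹' M ∩ A) ≤ volume (g '' (f '' (f ⁻¹' M ∩ A))) := measure_mono h1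
      _ ≤ C * volume (f '' (f ⁻¹' M ∩ A)) := hC _ _ hlip
      _ ≤ C * volume (M ∩ B) := by
        gcongr
        rintro _ ⟨x, hx, rfl⟩
        exact ⟨hx.1, hAB hx.2⟩
  have hh' : AEStronglyMeasurable h (Measure.map f (volume.restrict A)) :=
    hh.mono_ac ((Measure.absolutelyContinuous_of_le hle).trans
      (Measure.smul_absolutelyContinuous))
  refine ⟨hh'.comp_measurable hf, ?_⟩
  rw [← eLpNorm_map_measure hh' hf.aemeasurable]
  refine (eLpNorm_mono_measure _ hle).trans ?_
  rw [eLpNorm_smul_measure_of_ne_top (by norm_num)]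
  simp only [smul_eq_mul]
  gcongr
  rw [ENNReal.coe_rpow_of_nonneg _ (by norm_num)]
  simp

/-! ### Moving one coordinate -/

/-- The map replacing the coordinate `x i` by `σ (x i)`. -/
def move (i : Fin (n + 1)) (σ : ℝ → ℝ) (x : PSpace n) : PSpace n := x + (σ (x i) - x i) • bvec i

@[simp] theorem bvec_apply (i j : Fin (n + 1)) :
    (bvec i : PSpace n) j = if j = i then 1 else 0 := by
  simp [bvec]

theorem move_apply (i j : Fin (n + 1)) (σ : ℝ → ℝ) (x : PSpace n) :
    move i σ x j = if j = i then σ (x i) else x j := by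
  by_cases h : j = i
  · subst h; simp [move]
  · simp [move, h]

theorem contDiff_coord (i : Fin (n + 1)) {m : WithTop ℕ∞} :
    ContDiff ℝ m (fun x : PSpace n => x i) :=
  (EuclideanSpace.proj (𝕜 := ℝ) i).contDiff

theorem contDiff_move (i : Fin (n + 1)) {σ : ℝ → ℝ} (hσ : ContDiff ℝ ∞ σ) :
    ContDiff ℝ ∞ (move (n := n) i σ) :=
  contDiff_id.add (((hσ.comp (contDiff_coord i)).sub (contDiff_coord i)).smul contDiff_const)

theorem pd_comp_move {F : Type*} [NormedAddCommGroup F] [NormedSpace ℝ F] (i l : Fin (n + 1))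
    {σ : ℝ → ℝ} {s : ℝ} {x : PSpace n} (hσ : HasDerivAt σ s (x i)) {f : PSpace n → F}
    (hf : DifferentiableAt ℝ f (move i σ x)) :
    pd l (fun y => f (move i σ y)) x = (if l = i then s else 1) • pd l f (move i σ x) := by
  have hp : HasFDerivAt (fun y : PSpace n => y i) (EuclideanSpace.proj (𝕜 := ℝ) i) x :=
    (EuclideanSpace.proj (𝕜 := ℝ) i).hasFDerivAt
  have h1 : HasFDerivAt (move (n := n) i σ)
      (ContinuousLinearMap.id ℝ (PSpace n) +
        (s • EuclideanSpace.proj (𝕜 := ℝ) i - EuclideanSpace.proj (𝕜 := ℝ) i).smulRight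
          (bvec i)) x :=
    (hasFDerivAt_id x).add (((hσ.comp_hasFDerivAt x hp).sub hp).smul_const (bvec i))
  have h2 := hf.hasFDerivAt.comp x h1
  change fderiv ℝ (f ∘ move i σ) x (bvec l) = _
  rw [h2.fderiv]
  by_cases h : l = i
  · subst h
    simp [pd, sub_smul]
  · have h' : i ≠ l := fun e => h e.symm
    simp [pd, h, h']

/-- The condition `1 ≤ K` serves the coordinates that do not move. -/
theorem dist_le_move (i : Fin (n + 1)) {σ : ℝ → ℝ} {K : ℝ≥0} (hK : 1 ≤ K)
    (hσ : ∀ s t, |s - t| ≤ K * |σ s - σ t|) (x y : PSpace n) :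
    dist x y ≤ K * dist (move i σ x) (move i σ y) := by
  have hK' : (1 : ℝ) ≤ K := by exact_mod_cast hK
  rw [EuclideanSpace.dist_eq, EuclideanSpace.dist_eq, ← Real.sqrt_sq K.coe_nonneg,
    ← Real.sqrt_mul (sq_nonneg _), Finset.mul_sum]
  refine Real.sqrt_le_sqrt (Finset.sum_le_sum fun j _ => ?_)
  rw [← mul_pow]
  refine pow_le_pow_left₀ dist_nonneg ?_ 2
  rw [move_apply, move_apply, Real.dist_eq, Real.dist_eq]
  by_cases h : j = i
  · subst h; simpa using hσ (x j) (y j)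
  · simpa [h] using le_mul_of_one_le_left (abs_nonneg (x j - y j)) hK'

/-! ### Reflection operators -/

/-- The affine reflection mapping `[0, 1/2]` onto `[1/2, 1]`. -/
def refl₁ (t : ℝ) : ℝ := 1 - t

/-- A reflection of `[0, 1/2]` onto `[1/2, 1]` with slope `-3/2` at both end points. -/
def refl₂ (t : ℝ) : ℝ := 1 - t - Real.sin (4 * Real.pi * t) / (8 * Real.pi)

/-- Minus four times the derivative of `refl₂`. -/
def weight (t : ℝ) : ℝ := 4 + 2 * Real.cos (4 * Real.pi * t)

theorem contDiff_refl₁ : ContDiff ℝ ∞ refl₁ := contDiff_const.sub contDiff_id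

theorem contDiff_refl₂ : ContDiff ℝ ∞ refl₂ :=
  (contDiff_const.sub contDiff_id).sub
    ((Real.contDiff_sin.comp (contDiff_const.mul contDiff_id)).div_const _)

theorem contDiff_weight : ContDiff ℝ ∞ weight :=
  contDiff_const.add (contDiff_const.mul (Real.contDiff_cos.comp (contDiff_const.mul contDiff_id)))

theorem hasDerivAt_refl₁ (t : ℝ) : HasDerivAt refl₁ (-1) t := by
  exact (hasDerivAt_id t).const_sub 1

theorem hasDerivAt_refl₂ (t : ℝ) : HasDerivAt refl₂ (-(weight t / 4)) t := by
  have h := ((hasDerivAt_id t).const_sub 1).sub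
    ((((hasDerivAt_id t).const_mul (4 * Real.pi)).sin).div_const (8 * Real.pi))
  convert! h using 1
  simp only [weight, id]
  field_simp
  ring

theorem abs_sub_le_refl₁ (s t : ℝ) : |s - t| ≤ (2 : ℝ≥0) * |refl₁ s - refl₁ t| := by
  have : refl₁ s - refl₁ t = -(s - t) := by simp [refl₁]
  rw [this, abs_neg]
  have := abs_nonneg (s - t)
  norm_num
  linarith

/-- The sine term has Lipschitz constant 4π / 8π = 1/2, so it can undo at most half of the affine
part. -/
theorem abs_sub_le_refl₂ (s t : ℝ) : |s - t| ≤ (2 : ℝ≥0) * |refl₂ s - refl₂ t| := by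
  have h := Real.lipschitzWith_sin.dist_le_mul (4 * Real.pi * s) (4 * Real.pi * t)
  rw [Real.dist_eq, Real.dist_eq, ← mul_sub, abs_mul,
    abs_of_pos (by positivity : 0 < 4 * Real.pi)] at h
  have e : refl₂ s - refl₂ t = -((s - t) +
      (Real.sin (4 * Real.pi * s) - Real.sin (4 * Real.pi * t)) / (8 * Real.pi)) := by
    simp only [refl₂]; ring
  have h2 : |(Real.sin (4 * Real.pi * s) - Real.sin (4 * Real.pi * t)) / (8 * Real.pi)| ≤
      |s - t| / 2 := by
    rw [abs_div, abs_of_pos (by positivity : 0 < 8 * Real.pi), div_le_iff₀ (by positivity)]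
    simp only [NNReal.coe_one, one_mul] at h
    linarith
  rw [e, abs_neg]
  have h3 := abs_sub_abs_le_abs_add (s - t)
    ((Real.sin (4 * Real.pi * s) - Real.sin (4 * Real.pi * t)) / (8 * Real.pi))
  push_cast
  linarith

theorem refl₁_mem {t : ℝ} (h0 : 0 < t) (h1 : t < 1 / 2) : 1 / 2 < refl₁ t ∧ refl₁ t < 1 := by
  simp only [refl₁]; constructor <;> linarith

theorem abs_weight_le (t : ℝ) : |weight t| ≤ 6 := by
  have h1 := Real.neg_one_le_cos (4 * Real.pi * t)
  have h2 := Real.cos_le_one (4 * Real.pi * t)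
  rw [abs_le]; simp only [weight]; constructor <;> linarith

theorem refl₂_strictAnti : StrictAnti refl₂ := by
  refine strictAnti_of_deriv_neg fun t => ?_
  rw [(hasDerivAt_refl₂ t).deriv]
  have h1 := Real.neg_one_le_cos (4 * Real.pi * t)
  simp only [weight]
  linarith

theorem refl₂_zero : refl₂ 0 = 1 := by simp [refl₂]

theorem refl₂_half : refl₂ (1 / 2) = 1 / 2 := by
  have : 4 * Real.pi * (1 / 2) = 2 * Real.pi := by ring
  rw [refl₂, this, Real.sin_two_pi]; norm_num

theorem weight_zero : weight 0 = 6 := by simp [weight]; norm_num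

theorem weight_half : weight (1 / 2) = 6 := by
  have : 4 * Real.pi * (1 / 2) = 2 * Real.pi := by ring
  rw [weight, this, Real.cos_two_pi]; norm_num

theorem refl₂_mem {t : ℝ} (h0 : 0 < t) (h1 : t < 1 / 2) : 1 / 2 < refl₂ t ∧ refl₂ t < 1 :=
  ⟨by simpa only [refl₂_half] using refl₂_strictAnti h1,
    by simpa only [refl₂_zero] using refl₂_strictAnti h0⟩

/-- The operator `T` in the `i`-th variable. -/
def opT (i : Fin (n + 1)) : (PSpace n → ℝ) →ₗ[ℝ] (PSpace n → ℝ) where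
  -- Origin of the coefficients: put N f = f + a f∘ρ₁ + b f∘ρ₂. Then ∂ᵢN = T∂ᵢ forces T f = f + a
  -- ρ₁' f∘ρ₁ + b ρ₂' f∘ρ₂. For 1-periodic f the three values of f agree at xᵢ = 0 and at xᵢ = 1/2,
  -- so N f and T f vanish there when 1 + a + b = 0 and 1 + a ρ₁' + b ρ₂' = 0. End slopes -1 and
  -- -3/2 give a = -5, b = 4. One reflection alone would need slope +1.
  toFun f x := f x + 5 * f (move i refl₁ x) - weight (x i) * f (move i refl₂ x)
  map_add' f g := by funext x; simp only [Pi.add_apply]; ring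
  map_smul' c f := by funext x; simp only [Pi.smul_apply, smul_eq_mul, RingHom.id_apply]; ring

/-- The operator `N` in the `i`-th variable, which satisfies `∂ᵢ N = T ∂ᵢ`. -/
def opN (i : Fin (n + 1)) : (PSpace n → ℝ) →ₗ[ℝ] (PSpace n → ℝ) where
  toFun f x := f x - 5 * f (move i refl₁ x) + 4 * f (move i refl₂ x)
  map_add' f g := by funext x; simp only [Pi.add_apply]; ring
  map_smul' c f := by funext x; simp only [Pi.smul_apply, smul_eq_mul, RingHom.id_apply]; ring

theorem opT_apply (i : Fin (n + 1)) (f : PSpace n → ℝ) (x : PSpace n) :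
    opT i f x = f x + 5 * f (move i refl₁ x) - weight (x i) * f (move i refl₂ x) := rfl

theorem opN_apply (i : Fin (n + 1)) (f : PSpace n → ℝ) (x : PSpace n) :
    opN i f x = f x - 5 * f (move i refl₁ x) + 4 * f (move i refl₂ x) := rfl

theorem contDiff_opT (i : Fin (n + 1)) {f : PSpace n → ℝ} (hf : ContDiff ℝ ∞ f) :
    ContDiff ℝ ∞ (opT i f) :=
  (hf.add (contDiff_const.mul (hf.comp (contDiff_move i contDiff_refl₁)))).sub
    ((contDiff_weight.comp (contDiff_coord i)).mul (hf.comp (contDiff_move i contDiff_refl₂)))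

theorem contDiff_opN (i : Fin (n + 1)) {f : PSpace n → ℝ} (hf : ContDiff ℝ ∞ f) :
    ContDiff ℝ ∞ (opN i f) :=
  (hf.sub (contDiff_const.mul (hf.comp (contDiff_move i contDiff_refl₁)))).add
    (contDiff_const.mul (hf.comp (contDiff_move i contDiff_refl₂)))

/-- The part of `∂ᵢ T f` which involves the first derivatives of `f`. -/
def opD (i : Fin (n + 1)) (f : PSpace n → ℝ) (x : PSpace n) : ℝ :=
  f x - 5 * f (move i refl₁ x) + weight (x i) ^ 2 / 4 * f (move i refl₂ x)

/-! ### Partial derivatives of reflected functions. -/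

section deriv

variable {i l : Fin (n + 1)} {f g : PSpace n → ℝ} {x : PSpace n}

theorem pd_add (hf : DifferentiableAt ℝ f x) (hg : DifferentiableAt ℝ g x) :
    pd l (fun y => f y + g y) x = pd l f x + pd l g x := by
  simp [pd, fderiv_fun_add hf hg]

theorem pd_sub (hf : DifferentiableAt ℝ f x) (hg : DifferentiableAt ℝ g x) :
    pd l (fun y => f y - g y) x = pd l f x - pd l g x := by
  simp [pd, fderiv_fun_sub hf hg]

theorem pd_mul (hf : DifferentiableAt ℝ f x) (hg : DifferentiableAt ℝ g x) :
    pd l (fun y => f y * g y) x = f x * pd l g x + pd l f x * g x := by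
  simp [pd, fderiv_fun_mul hf hg]; ring

theorem pd_const_mul (c : ℝ) (hf : DifferentiableAt ℝ f x) :
    pd l (fun y => c * f y) x = c * pd l f x := by
  simp [pd, fderiv_const_mul hf]

theorem pd_comp_coord {w : ℝ → ℝ} {w' : ℝ} (hw : HasDerivAt w w' (x i)) :
    pd l (fun y : PSpace n => w (y i)) x = if l = i then w' else 0 := by
  have hp : HasFDerivAt (fun y : PSpace n => y i) (EuclideanSpace.proj (𝕜 := ℝ) i) x :=
    (EuclideanSpace.proj (𝕜 := ℝ) i).hasFDerivAt
  have := (hw.comp_hasFDerivAt x hp).fderiv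
  change fderiv ℝ (w ∘ fun y : PSpace n => y i) x (bvec l) = _
  rw [this]
  simp [eq_comm]

theorem differentiable_comp_move {σ : ℝ → ℝ} (hσ : ContDiff ℝ ∞ σ) (hf : ContDiff ℝ ∞ f) :
    DifferentiableAt ℝ (fun y => f (move i σ y)) x :=
  (hf.comp (contDiff_move i hσ)).differentiable (by simp) x

/-- The coefficients -5 and 4 of N, multiplied by the slopes -1 and -weight/4, become the
coefficients of T; derivatives in the other variables do not see the reflection. -/
theorem pd_opN (hf : ContDiff ℝ ∞ f) :
    pd l (opN i f) x = if l = i then opT i (pd l f) x else opN i (pd l f) x := by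
  have hd : Differentiable ℝ f := hf.differentiable (by simp)
  have d1 := differentiable_comp_move (i := i) (x := x) contDiff_refl₁ hf
  have d2 := differentiable_comp_move (i := i) (x := x) contDiff_refl₂ hf
  have e1 := pd_comp_move i l (hasDerivAt_refl₁ (x i)) (hd (move i refl₁ x))
  have e2 := pd_comp_move i l (hasDerivAt_refl₂ (x i)) (hd (move i refl₂ x))
  change pd l (fun y => (f y - 5 * f (move i refl₁ y)) + 4 * f (move i refl₂ y)) x = _
  rw [pd_add ((hd x).fun_sub (d1.const_mul 5)) (d2.const_mul 4), pd_sub (hd x) (d1.const_mul 5),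
    pd_const_mul 5 d1, pd_const_mul 4 d2, e1, e2]
  split_ifs with h
  · rw [opT_apply]; simp only [smul_eq_mul]; ring
  · rw [opN_apply]; simp only [smul_eq_mul]; ring

theorem pd_opT_of_ne (hf : ContDiff ℝ ∞ f) (h : l ≠ i) : pd l (opT i f) x = opT i (pd l f) x := by
  have hd : Differentiable ℝ f := hf.differentiable (by simp)
  have d1 := differentiable_comp_move (i := i) (x := x) contDiff_refl₁ hf
  have d2 := differentiable_comp_move (i := i) (x := x) contDiff_refl₂ hf
  have e1 := pd_comp_move i l (hasDerivAt_refl₁ (x i)) (hd (move i refl₁ x))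
  have e2 := pd_comp_move i l (hasDerivAt_refl₂ (x i)) (hd (move i refl₂ x))
  have dw : DifferentiableAt ℝ (fun y : PSpace n => weight (y i)) x :=
    (contDiff_weight.comp (contDiff_coord i)).differentiable (by simp) x
  have ew := pd_comp_coord (l := l) (contDiff_weight.differentiable (by simp) (x i)).hasDerivAt
  change pd l (fun y => (f y + 5 * f (move i refl₁ y)) - weight (y i) * f (move i refl₂ y)) x = _
  rw [pd_sub ((hd x).fun_add (d1.const_mul 5)) (dw.fun_mul d2), pd_add (hd x) (d1.const_mul 5),
    pd_const_mul 5 d1, pd_mul dw d2, e1, e2, ew, opT_apply]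
  simp [h]

/-- T has a variable coefficient, so a term of order zero appears. It matters only for the H¹ bound:
T acts on the components with index other than `i`, whose `i`-th derivative does not enter the
divergence. -/
theorem pd_opT_self (hf : ContDiff ℝ ∞ f) :
    pd i (opT i f) x = opD i (pd i f) x - deriv weight (x i) * f (move i refl₂ x) := by
  have hd : Differentiable ℝ f := hf.differentiable (by simp)
  have d1 := differentiable_comp_move (i := i) (x := x) contDiff_refl₁ hf
  have d2 := differentiable_comp_move (i := i) (x := x) contDiff_refl₂ hf
  have e1 := pd_comp_move i i (hasDerivAt_refl₁ (x i)) (hd (move i refl₁ x))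
  have e2 := pd_comp_move i i (hasDerivAt_refl₂ (x i)) (hd (move i refl₂ x))
  have dw : DifferentiableAt ℝ (fun y : PSpace n => weight (y i)) x :=
    (contDiff_weight.comp (contDiff_coord i)).differentiable (by simp) x
  have ew := pd_comp_coord (l := i) (contDiff_weight.differentiable (by simp) (x i)).hasDerivAt
  change pd i (fun y => (f y + 5 * f (move i refl₁ y)) - weight (y i) * f (move i refl₂ y)) x = _
  rw [pd_sub ((hd x).fun_add (d1.const_mul 5)) (dw.fun_mul d2), pd_add (hd x) (d1.const_mul 5),
    pd_const_mul 5 d1, pd_mul dw d2, e1, e2, ew, opD]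
  simp only [if_true, smul_eq_mul]
  ring

end deriv

end Pipe

end

noncomputable section

namespace Pipe

open scoped NNReal

variable {n : ℕ}

/-! ### The reflection operators in `L²` -/

/-- The box of points whose coordinates are in `(0, 1/2)` for indices in `S`, and in `(0, 1)` for
the others. -/
def box (S : Finset (Fin (n + 1))) : Set (PSpace n) :=
  {x | ∀ i, 0 < x i ∧ x i < if i ∈ S then 1 / 2 else 1}

theorem isOpen_box (S : Finset (Fin (n + 1))) : IsOpen (box S) := by
  have : box S = ⋂ i : Fin (n + 1),
      {x : PSpace n | 0 < x i} ∩ {x : PSpace n | x i < if i ∈ S then 1 / 2 else 1} := by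
    ext x; simp [box]
  rw [this]
  refine isOpen_iInter_of_finite fun i => ?_
  exact (isOpen_lt continuous_const (contDiff_coord (m := 0) i).continuous).inter
    (isOpen_lt (contDiff_coord (m := 0) i).continuous continuous_const)

theorem box_insert_subset (i : Fin (n + 1)) (S : Finset (Fin (n + 1))) :
    box (insert i S) ⊆ box S := by
  intro x hx j
  refine ⟨(hx j).1, (hx j).2.trans_le ?_⟩
  simp only [Finset.mem_insert]
  split_ifs <;> first | (exfalso; tauto) | norm_num

/-- Reflected points stay in the larger box, which gives the norm bounds, and land in its far half,
where functions supported in the small box vanish. -/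
theorem move_mem_box {i : Fin (n + 1)} {S : Finset (Fin (n + 1))} (hi : i ∉ S) {σ : ℝ → ℝ}
    (hσ : ∀ t, 0 < t → t < 1 / 2 → 1 / 2 < σ t ∧ σ t < 1) {x : PSpace n}
    (hx : x ∈ box (insert i S)) : move i σ x ∈ box S ∧ 1 / 2 < move i σ x i := by
  have hxi := hx i
  simp only [Finset.mem_insert_self, if_true] at hxi
  have h := hσ _ hxi.1 hxi.2
  refine ⟨fun j => ?_, by simpa [move_apply] using h.1⟩
  rw [move_apply]
  by_cases hj : j = i
  · subst hj
    simp only [if_true, hi, if_false]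
    exact ⟨by linarith [h.1], h.2⟩
  · simpa [hj] using hx j

theorem eLpNorm_mul_le {α : Type*} [MeasurableSpace α] {μ : Measure α} {a f : α → ℝ} {A : ℝ≥0}
    (ha : ∀ x, |a x| ≤ A) : eLpNorm (fun x => a x * f x) 2 μ ≤ A * eLpNorm f 2 μ := by
  refine (eLpNorm_le_nnreal_smul_eLpNorm_of_ae_le_mul (c := A) (g := f)
    (Eventually.of_forall fun x => ?_) 2).trans (by simp [ENNReal.smul_def])
  rw [nnnorm_mul]
  gcongr
  exact_mod_cast ha x

theorem eLpNorm_comb_le {α : Type*} [MeasurableSpace α] {μ : Measure α} {a b f g k : α → ℝ}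
    {A B : ℝ≥0} (ha : ∀ x, |a x| ≤ A) (hb : ∀ x, |b x| ≤ B) (hma : AEStronglyMeasurable a μ)
    (hmb : AEStronglyMeasurable b μ) (hf : AEStronglyMeasurable f μ)
    (hg : AEStronglyMeasurable g μ) (hk : AEStronglyMeasurable k μ) :
    eLpNorm (fun x => f x + a x * g x + b x * k x) 2 μ ≤
      eLpNorm f 2 μ + A * eLpNorm g 2 μ + B * eLpNorm k 2 μ := by
  refine (eLpNorm_add_le (hf.add (hma.mul hg)) (hmb.mul hk) (by norm_num)).trans ?_
  refine add_le_add ((eLpNorm_add_le hf (hma.mul hg) (by norm_num)).trans ?_) (eLpNorm_mul_le hb)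
  exact add_le_add le_rfl (eLpNorm_mul_le ha)

theorem deriv_weight (t : ℝ) : deriv weight t = -(8 * Real.pi * Real.sin (4 * Real.pi * t)) := by
  have h := (((((hasDerivAt_id t).const_mul (4 * Real.pi)).cos).const_mul 2)).const_add 4
  refine (h.deriv).trans ?_
  simp only [id]; ring

theorem abs_deriv_weight_le (t : ℝ) : |deriv weight t| ≤ 32 := by
  rw [deriv_weight, abs_neg, abs_mul, abs_of_pos (by positivity)]
  have h1 := Real.abs_sin_le_one (4 * Real.pi * t)
  have h2 := Real.pi_le_four
  have h3 := Real.pi_pos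
  nlinarith [abs_nonneg (Real.sin (4 * Real.pi * t))]

theorem exists_eLpNorm_move_le : ∃ C : ℝ≥0, ∀ (i : Fin (n + 1)) (S : Finset (Fin (n + 1))),
    i ∉ S → ∀ h : PSpace n → ℝ, Measurable h →
      (eLpNorm (fun x => h (move i refl₁ x)) 2 (volume.restrict (box (insert i S))) ≤
        C * eLpNorm h 2 (volume.restrict (box S))) ∧
      eLpNorm (fun x => h (move i refl₂ x)) 2 (volume.restrict (box (insert i S))) ≤
        C * eLpNorm h 2 (volume.restrict (box S)) := by
  obtain ⟨C, hC⟩ := exists_eLpNorm_comp_le (n := n) 2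
  refine ⟨C, fun i S hi h hh => ⟨?_, ?_⟩⟩
  · exact (hC (move i refl₁) _ _ (contDiff_move i contDiff_refl₁).continuous.measurable
      (isOpen_box _).measurableSet (isOpen_box S).measurableSet
      (fun x hx => (move_mem_box hi (fun t => refl₁_mem) hx).1)
      (fun x _ y _ => dist_le_move i (by norm_num) abs_sub_le_refl₁ x y) h
      hh.aestronglyMeasurable).2
  · exact (hC (move i refl₂) _ _ (contDiff_move i contDiff_refl₂).continuous.measurable
      (isOpen_box _).measurableSet (isOpen_box S).measurableSet
      (fun x hx => (move_mem_box hi (fun t => refl₂_mem) hx).1)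
      (fun x _ y _ => dist_le_move i (by norm_num) abs_sub_le_refl₂ x y) h
      hh.aestronglyMeasurable).2

theorem measurable_move (i : Fin (n + 1)) {σ : ℝ → ℝ} (hσ : ContDiff ℝ ∞ σ) :
    Measurable (move (n := n) i σ) := (contDiff_move i hσ).continuous.measurable

theorem measurable_weight (i : Fin (n + 1)) : Measurable fun x : PSpace n => weight (x i) :=
  (contDiff_weight.comp (contDiff_coord i)).continuous.measurable

theorem measurable_opT (i : Fin (n + 1)) {h : PSpace n → ℝ} (hh : Measurable h) :
    Measurable (opT i h) :=
  (hh.add (measurable_const.mul (hh.comp (measurable_move i contDiff_refl₁)))).sub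
    ((measurable_weight i).mul (hh.comp (measurable_move i contDiff_refl₂)))

theorem exists_eLpNorm_op_le : ∃ C : ℝ≥0, ∀ (i : Fin (n + 1)) (S : Finset (Fin (n + 1))),
    i ∉ S → ∀ h : PSpace n → ℝ, Measurable h →
      (eLpNorm (opT i h) 2 (volume.restrict (box (insert i S))) ≤
        C * eLpNorm h 2 (volume.restrict (box S))) ∧
      (eLpNorm (opN i h) 2 (volume.restrict (box (insert i S))) ≤
        C * eLpNorm h 2 (volume.restrict (box S))) ∧
      (eLpNorm (opD i h) 2 (volume.restrict (box (insert i S))) ≤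
        C * eLpNorm h 2 (volume.restrict (box S))) ∧
      (eLpNorm (fun x => deriv weight (x i) * h (move i refl₂ x)) 2
        (volume.restrict (box (insert i S))) ≤ C * eLpNorm h 2 (volume.restrict (box S))) := by
  obtain ⟨C, hC⟩ := exists_eLpNorm_move_le (n := n)
  -- The coefficient of the first reflection is at most 5 in absolute value; those of the second are
  -- at most 6, 4, 36/4 and 8π, all below 32.
  refine ⟨1 + 5 * C + 32 * C, fun i S hi h hh => ?_⟩
  obtain ⟨h1, h2⟩ := hC i S hi h hh
  set μ := volume.restrict (box (insert i S)) with hμ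
  set N := eLpNorm h 2 (volume.restrict (box S)) with hN
  have h0 : eLpNorm h 2 μ ≤ N :=
    eLpNorm_mono_measure _ (Measure.restrict_mono (box_insert_subset i S) le_rfl)
  have m1 : AEStronglyMeasurable (fun x => h (move i refl₁ x)) μ :=
    (hh.comp (measurable_move i contDiff_refl₁)).aestronglyMeasurable
  have m2 : AEStronglyMeasurable (fun x => h (move i refl₂ x)) μ :=
    (hh.comp (measurable_move i contDiff_refl₂)).aestronglyMeasurable
  have key : ∀ (a b : PSpace n → ℝ), (∀ x, |a x| ≤ (5 : ℝ≥0)) → (∀ x, |b x| ≤ (32 : ℝ≥0)) →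
      Measurable a → Measurable b →
      eLpNorm (fun x => h x + a x * h (move i refl₁ x) + b x * h (move i refl₂ x)) 2 μ ≤
        ((1 + 5 * C + 32 * C : ℝ≥0) : ℝ≥0∞) * N := by
    intro a b ha hb hma hmb
    refine (eLpNorm_comb_le ha hb hma.aestronglyMeasurable hmb.aestronglyMeasurable
      hh.aestronglyMeasurable m1 m2).trans ?_
    calc _ ≤ N + (5 : ℝ≥0) * (C * N) + (32 : ℝ≥0) * (C * N) := by gcongr
      _ = _ := by push_cast; ring
  have hw := measurable_weight (n := n) i
  refine ⟨?_, ?_, ?_, ?_⟩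
  · have := key (fun _ => 5) (fun x => -weight (x i)) (fun x => by norm_num)
      (fun x => by rw [abs_neg]; exact (abs_weight_le _).trans (by norm_num))
      measurable_const hw.neg
    refine le_of_eq_of_le (congrArg (fun q => eLpNorm q 2 μ) ?_) this
    funext x; rw [opT_apply]; ring
  · have := key (fun _ => -5) (fun x => 4) (fun x => by norm_num)
      (fun x => by norm_num) measurable_const measurable_const
    refine le_of_eq_of_le (congrArg (fun q => eLpNorm q 2 μ) ?_) this
    funext x; rw [opN_apply]; ring
  · have := key (fun _ => -5) (fun x => weight (x i) ^ 2 / 4) (fun x => by norm_num)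
      (fun x => by
        have := abs_weight_le (x i)
        rw [abs_div, abs_pow]
        have h5 : |weight (x i)| ^ 2 ≤ 6 ^ 2 := by gcongr
        rw [abs_of_pos (by norm_num : (0 : ℝ) < 4)]
        norm_num at h5 ⊢
        linarith) measurable_const ((hw.pow_const 2).div_const 4)
    refine le_of_eq_of_le (congrArg (fun q => eLpNorm q 2 μ) ?_) this
    funext x; rw [opD]; ring
  · calc _ ≤ (32 : ℝ≥0) * eLpNorm (fun x => h (move i refl₂ x)) 2 μ :=
          eLpNorm_mul_le fun x => abs_deriv_weight_le _
      _ ≤ (32 : ℝ≥0) * (C * N) := by gcongr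
      _ ≤ _ := by
        push_cast
        rw [add_mul, ← mul_assoc]
        exact le_add_self

/-! ### Reflecting vector fields -/

/-- The reflection of a vector field in the `i`-th variable. -/
def reflField (i : Fin (n + 1)) (U : Fin (n + 1) → PSpace n → ℝ) :
    Fin (n + 1) → PSpace n → ℝ :=
  fun j => if j = i then opN i (U j) else opT i (U j)

/-- The divergence of a field given by its components. -/
def cdiv (U : Fin (n + 1) → PSpace n → ℝ) (x : PSpace n) : ℝ := ∑ j, pd j (U j) x

/-- The `H¹` norm of a field given by its components. -/
def h1norm (μ : Measure (PSpace n)) (U : Fin (n + 1) → PSpace n → ℝ) : ℝ≥0∞ :=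
  ∑ j, (eLpNorm (U j) 2 μ + ∑ l, eLpNorm (pd l (U j)) 2 μ)

/-- The component normal to the mirror uses N and the tangential ones use T precisely so that every
∂ⱼ turns into T∂ⱼ. -/
theorem cdiv_reflField (i : Fin (n + 1)) {U : Fin (n + 1) → PSpace n → ℝ}
    (hU : ∀ j, ContDiff ℝ ∞ (U j)) : cdiv (reflField i U) = opT i (cdiv U) := by
  have : cdiv U = ∑ j, pd j (U j) := by funext x; simp [cdiv]
  funext x
  rw [this, map_sum, Finset.sum_apply, cdiv]
  refine Finset.sum_congr rfl fun j _ => ?_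
  by_cases hj : j = i
  · subst hj; simp [reflField, pd_opN (hU j)]
  · simp [reflField, hj, pd_opT_of_ne (hU j) hj]

theorem measurable_pd {f : PSpace n → ℝ} (hf : ContDiff ℝ ∞ f) (l : Fin (n + 1)) :
    Measurable (pd l f) :=
  ((hf.continuous_fderiv (by simp)).clm_apply continuous_const).measurable

theorem exists_h1norm_reflField_le : ∃ C : ℝ≥0, ∀ (i : Fin (n + 1)) (S : Finset (Fin (n + 1))),
    i ∉ S → ∀ U : Fin (n + 1) → PSpace n → ℝ, (∀ j, ContDiff ℝ ∞ (U j)) →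
      h1norm (volume.restrict (box (insert i S))) (reflField i U) ≤
        C * h1norm (volume.restrict (box S)) U := by
  obtain ⟨C, hC⟩ := exists_eLpNorm_op_le (n := n)
  have key : ∀ (i : Fin (n + 1)) (S : Finset (Fin (n + 1))), i ∉ S →
      ∀ U : Fin (n + 1) → PSpace n → ℝ, (∀ j, ContDiff ℝ ∞ (U j)) → ∀ j l,
      eLpNorm (reflField i U j) 2 (volume.restrict (box (insert i S))) ≤
        C * eLpNorm (U j) 2 (volume.restrict (box S)) ∧
      eLpNorm (pd l (reflField i U j)) 2 (volume.restrict (box (insert i S))) ≤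
        C * eLpNorm (U j) 2 (volume.restrict (box S)) +
        C * eLpNorm (pd l (U j)) 2 (volume.restrict (box S)) := by
    intro i S hi U hU j l
    obtain ⟨hT, hN, -, hW⟩ := hC i S hi (U j) (hU j).continuous.measurable
    obtain ⟨hT', hN', hD', -⟩ := hC i S hi (pd l (U j)) (measurable_pd (hU j) l)
    by_cases hj : j = i
    · subst hj
      have e : reflField j U j = opN j (U j) := by simp [reflField]
      rw [e]
      refine ⟨hN, ?_⟩
      have e' : pd l (opN j (U j)) =
          if l = j then opT j (pd l (U j)) else opN j (pd l (U j)) := by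
        funext x; rw [pd_opN (hU j)]; split_ifs <;> rfl
      rw [e']
      split_ifs
      · exact hT'.trans le_add_self
      · exact hN'.trans le_add_self
    · have e : reflField i U j = opT i (U j) := by simp [reflField, hj]
      rw [e]
      refine ⟨hT, ?_⟩
      by_cases hl : l = i
      · subst hl
        have e' : pd l (opT l (U j)) = fun x => opD l (pd l (U j)) x -
            deriv weight (x l) * U j (move l refl₂ x) := by
          funext x; rw [pd_opT_self (hU j)]
        rw [e']
        refine (eLpNorm_sub_le (f := opD l (pd l (U j))) ?_ ?_ (by norm_num)).trans ?_
        · have hm := measurable_pd (hU j) l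
          refine Measurable.aestronglyMeasurable ?_
          exact (hm.sub (measurable_const.mul (hm.comp (measurable_move l contDiff_refl₁)))).add
            ((((measurable_weight l).pow_const 2).div_const 4).mul
              (hm.comp (measurable_move l contDiff_refl₂)))
        · refine Measurable.aestronglyMeasurable ?_
          refine ((measurable_deriv weight).comp
            (contDiff_coord (m := 0) l).continuous.measurable).mul ?_
          exact (hU j).continuous.measurable.comp (measurable_move l contDiff_refl₂)
        · rw [add_comm]
          exact add_le_add hW hD'
      · have e' : pd l (opT i (U j)) = opT i (pd l (U j)) := by
          funext x; rw [pd_opT_of_ne (hU j) hl]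
        rw [e']
        exact hT'.trans le_add_self
  -- The order-zero norm of a component is counted once for itself and once for each of the n + 1
  -- derivatives.
  refine ⟨(n + 2 : ℕ) * C, fun i S hi U hU => ?_⟩
  unfold h1norm
  rw [Finset.mul_sum]
  refine Finset.sum_le_sum fun j _ => ?_
  set a := eLpNorm (U j) 2 (volume.restrict (box S))
  calc _ ≤ C * a + ∑ l, (C * a + C * eLpNorm (pd l (U j)) 2 (volume.restrict (box S))) :=
        add_le_add (key i S hi U hU j 0).1 (Finset.sum_le_sum fun l _ => (key i S hi U hU j l).2)
    _ = (n + 2 : ℕ) * C * a + C * ∑ l, eLpNorm (pd l (U j)) 2 (volume.restrict (box S)) := by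
        rw [Finset.sum_add_distrib, Finset.mul_sum]
        simp
        ring
    _ ≤ (n + 2 : ℕ) * C * a +
        (n + 2 : ℕ) * C * ∑ l, eLpNorm (pd l (U j)) 2 (volume.restrict (box S)) := by
        gcongr
        rw [← one_mul (C : ℝ≥0∞)]
        gcongr
        · push_cast; exact le_add_left (by norm_num)
        · simp
    _ = _ := by push_cast; ring

/-- The data obtained by reflecting in all variables with indices in `S`. -/
structure ReflData (S : Finset (Fin (n + 1))) where
  /-- the operator acting on functions -/
  T : (PSpace n → ℝ) →ₗ[ℝ] (PSpace n → ℝ)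
  /-- the operator acting on fields -/
  R : (Fin (n + 1) → PSpace n → ℝ) → Fin (n + 1) → PSpace n → ℝ
  /-- the bound of the operators -/
  C : ℝ≥0
  measurable_T : ∀ h, Measurable h → Measurable (T h)
  norm_T : ∀ h, Measurable h → eLpNorm (T h) 2 (volume.restrict (box S)) ≤
    C * eLpNorm h 2 (volume.restrict (box ∅))
  T_eq : ∀ h : PSpace n → ℝ, (∀ x, x ∉ box Finset.univ → h x = 0) → ∀ x ∈ box S, T h x = h x
  smooth_R : ∀ U, (∀ j, ContDiff ℝ ∞ (U j)) → ∀ j, ContDiff ℝ ∞ (R U j)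
  periodic_R : ∀ U : Fin (n + 1) → PSpace n → ℝ, (∀ j i x, U j (x + bvec i) = U j x) →
    ∀ j, ∀ i ∉ S, ∀ x, R U j (x + bvec i) = R U j x
  zero_R : ∀ U : Fin (n + 1) → PSpace n → ℝ, (∀ j i x, U j (x + bvec i) = U j x) →
    ∀ j, ∀ i ∈ S, ∀ x : PSpace n, x i = 0 ∨ x i = 1 / 2 → R U j x = 0
  div_R : ∀ U, (∀ j, ContDiff ℝ ∞ (U j)) → cdiv (R U) = T (cdiv U)
  norm_R : ∀ U, (∀ j, ContDiff ℝ ∞ (U j)) →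
    h1norm (volume.restrict (box S)) (R U) ≤ C * h1norm (volume.restrict (box ∅)) U

theorem move_add_bvec {i j : Fin (n + 1)} (h : j ≠ i) (σ : ℝ → ℝ) (x : PSpace n) :
    move i σ (x + bvec j) = move i σ x + bvec j := by
  have h' : i ≠ j := fun e => h e.symm
  simp [move, h']
  abel

theorem reflField_periodic {i j : Fin (n + 1)} (h : j ≠ i) {U : Fin (n + 1) → PSpace n → ℝ}
    (hU : ∀ k x, U k (x + bvec j) = U k x) (k : Fin (n + 1)) (x : PSpace n) :
    reflField i U k (x + bvec j) = reflField i U k x := by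
  have h' : i ≠ j := fun e => h e.symm
  unfold reflField
  split_ifs
  · simp only [opN_apply, move_add_bvec h, hU]
  · simp only [opT_apply, move_add_bvec h, hU]
    simp [h']

/-- Zeros on the faces of a variable already treated survive, since `move i` does not touch the
coordinate `j`. -/
theorem reflField_eq_zero_of_ne {i j : Fin (n + 1)} (h : j ≠ i)
    {U : Fin (n + 1) → PSpace n → ℝ} {k : Fin (n + 1)} {p : ℝ → Prop}
    (hU : ∀ x : PSpace n, p (x j) → U k x = 0) (x : PSpace n) (hx : p (x j)) :
    reflField i U k x = 0 := by
  have hm : ∀ σ, U k (move i σ x) = 0 := fun σ => hU _ (by simpa [move_apply, h] using hx)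
  unfold reflField
  split_ifs
  · simp [opN_apply, hm, hU x hx]
  · simp [opT_apply, hm, hU x hx]

/-- On `x i = 0` the reflected points are the point moved by one period; on `x i = 1 / 2` they are
the point itself. What remains is 1 - 5 + 4 = 0 and 1 + 5 - 6 = 0. -/
theorem reflField_eq_zero_self {i : Fin (n + 1)} {U : Fin (n + 1) → PSpace n → ℝ}
    (hU : ∀ k x, U k (x + bvec i) = U k x) (k : Fin (n + 1)) (x : PSpace n)
    (hx : x i = 0 ∨ x i = 1 / 2) : reflField i U k x = 0 := by
  have e : U k (move i refl₁ x) = U k x ∧ U k (move i refl₂ x) = U k x ∧ weight (x i) = 6 := by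
    rcases hx with hx | hx
    · have h1 : move i refl₁ x = x + bvec i := by simp [move, hx, refl₁]
      have h2 : move i refl₂ x = x + bvec i := by simp [move, hx, refl₂_zero]
      rw [h1, h2, hU, hx, weight_zero]; simp
    · have h1 : move i refl₁ x = x := by simp only [move, hx, refl₁]; norm_num
      have h2 : move i refl₂ x = x := by simp only [move, hx, refl₂_half]; norm_num
      rw [h1, h2, hx, weight_half]; simp
  obtain ⟨e1, e2, e3⟩ := e
  unfold reflField
  split_ifs
  · rw [opN_apply, e1, e2]; ring
  · rw [opT_apply, e1, e2, e3]; ring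

/-- One variable is reflected at a time. Periodicity survives in the variables not yet treated,
which is what the next reflection needs to produce its zeros, and the zeros already obtained
persist. -/
theorem nonempty_reflData (S : Finset (Fin (n + 1))) : Nonempty (ReflData (n := n) S) := by
  induction S using Finset.induction_on with
  | empty =>
    exact ⟨{
      T := LinearMap.id
      R := id
      C := 1
      measurable_T := fun h hh => hh
      norm_T := fun h _ => by simp
      T_eq := fun h _ x _ => rfl
      smooth_R := fun U hU => hU
      periodic_R := fun U hU j i _ x => hU j i x
      zero_R := fun U hU j i hi => by simp at hi
      div_R := fun U _ => rfl
      norm_R := fun U _ => by simp }⟩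
  | insert i S hi ih =>
    obtain ⟨D⟩ := ih
    obtain ⟨C₁, hC₁⟩ := exists_eLpNorm_op_le (n := n)
    obtain ⟨C₂, hC₂⟩ := exists_h1norm_reflField_le (n := n)
    exact ⟨{
      T := opT i ∘ₗ D.T
      R := fun U => reflField i (D.R U)
      C := C₁ * D.C + C₂ * D.C
      measurable_T := fun h hh => measurable_opT i (D.measurable_T h hh)
      norm_T := fun h hh => by
        refine ((hC₁ i S hi _ (D.measurable_T h hh)).1).trans ?_
        calc _ ≤ C₁ * (D.C * eLpNorm h 2 (volume.restrict (box ∅))) := by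
              gcongr; exact D.norm_T h hh
          _ ≤ _ := by
            push_cast
            rw [add_mul, ← mul_assoc]
            exact le_self_add
      T_eq := fun h hh x hx => by
        -- Both reflected points have `i`-th coordinate above 1/2, outside the support of `h`, so
        -- only the identity term of T contributes.
        have key : ∀ σ : ℝ → ℝ, (∀ t, 0 < t → t < 1 / 2 → 1 / 2 < σ t ∧ σ t < 1) →
            D.T h (move i σ x) = 0 := by
          intro σ hσ
          obtain ⟨h1, h2⟩ := move_mem_box hi hσ hx
          rw [D.T_eq h hh _ h1]
          refine hh _ fun hmem => ?_
          have := (hmem i).2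
          simp only [Finset.mem_univ, if_true] at this
          linarith
        rw [LinearMap.comp_apply, opT_apply, key _ (fun t => refl₁_mem), key _ (fun t => refl₂_mem),
          D.T_eq h hh x (box_insert_subset i S hx)]
        ring
      smooth_R := fun U hU j => by
        unfold reflField
        split_ifs
        · exact contDiff_opN i (D.smooth_R U hU j)
        · exact contDiff_opT i (D.smooth_R U hU j)
      periodic_R := fun U hU j k hk x => by
        simp only [Finset.mem_insert, not_or] at hk
        exact reflField_periodic hk.1 (fun l y => D.periodic_R U hU l k hk.2 y) j x
      zero_R := fun U hU j k hk x hx => by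
        by_cases hki : k = i
        · subst hki
          exact reflField_eq_zero_self (fun l y => D.periodic_R U hU l k hi y) j x hx
        · have hkS : k ∈ S := by simpa [hki] using hk
          exact reflField_eq_zero_of_ne (p := fun t => t = 0 ∨ t = 1 / 2) hki
            (fun y hy => D.zero_R U hU j k hkS y hy) x hx
      div_R := fun U hU => by
        rw [cdiv_reflField i (D.smooth_R U hU), D.div_R U hU]; rfl
      norm_R := fun U hU => by
        refine (hC₂ i S hi _ (D.smooth_R U hU)).trans ?_
        calc _ ≤ C₂ * (D.C * h1norm (volume.restrict (box ∅)) U) := by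
              gcongr; exact D.norm_R U hU
          _ ≤ _ := by
            push_cast
            rw [add_mul, ← mul_assoc]
            exact le_add_self }⟩

end Pipe

end

noncomputable section

namespace Pipe

open scoped NNReal

variable {n : ℕ}

/-! ### The divergence equation on the torus -/

section Torus

attribute [local instance] instMeasureSpaceUnitAddCircle

/-- The half-open unit cube. -/
def unitCube : Set (PSpace n) := {x | ∀ i, x i ∈ Set.Ioc (0 : ℝ) 1}

/-- The projection to the torus. -/
def toTorus (x : PSpace n) : UnitAddTorus (Fin (n + 1)) := fun i => (x i : UnitAddCircle)

local instance : IsProbabilityMeasure (volume : Measure UnitAddCircle) :=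
  inferInstanceAs (IsProbabilityMeasure AddCircle.haarAddCircle)

theorem measurePreserving_mk_haar : MeasurePreserving ((↑) : ℝ → UnitAddCircle)
    (volume.restrict (Set.Ioc 0 1)) volume := by
  have := AddCircle.measurePreserving_mk 1 0
  rw [AddCircle.volume_eq_smul_haarAddCircle, ENNReal.ofReal_one, one_smul, zero_add] at this
  exact this

theorem measurePreserving_toTorus : MeasurePreserving (toTorus (n := n))
    (volume.restrict unitCube) volume := by
  have h1 : MeasurePreserving (fun (y : Fin (n + 1) → ℝ) i => (y i : UnitAddCircle))
      (volume.restrict (Set.univ.pi fun _ => Set.Ioc (0 : ℝ) 1)) volume := by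
    have := measurePreserving_pi (ι := Fin (n + 1)) _ _ (fun i => measurePreserving_mk_haar)
    rw [volume_pi, Measure.restrict_pi_pi]
    exact this
  have h2 := (PiLp.volume_preserving_ofLp (Fin (n + 1))).restrict_preimage
    (s := Set.univ.pi fun _ => Set.Ioc (0 : ℝ) 1)
    (MeasurableSet.univ_pi fun _ => measurableSet_Ioc)
  have h3 := h1.comp h2
  have e : (WithLp.ofLp ⁻¹' (Set.univ.pi fun _ => Set.Ioc (0 : ℝ) 1)) =
      unitCube (n := n) := by
    ext x; simp [unitCube]
  rw [e] at h3
  exact h3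

/-- The exponential with frequency `k`. -/
def character (k : Fin (n + 1) → ℤ) (x : PSpace n) : ℂ :=
  Complex.exp (2 * Real.pi * Complex.I * ∑ j, (k j : ℂ) * (x j : ℂ))

theorem mFourier_toTorus (k : Fin (n + 1) → ℤ) (x : PSpace n) :
    UnitAddTorus.mFourier k (toTorus x) = character k x := by
  simp only [UnitAddTorus.mFourier, ContinuousMap.coe_mk, toTorus, fourier_coe_apply, character,
    Finset.mul_sum, Complex.exp_sum]
  refine Finset.prod_congr rfl fun i _ => ?_
  congr 1
  push_cast
  ring

/-- Real parts of trigonometric polynomials. -/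
def trig (s : Finset (Fin (n + 1) → ℤ)) (a : (Fin (n + 1) → ℤ) → ℂ) (x : PSpace n) : ℝ :=
  (∑ k ∈ s, a k * character k x).re

theorem character_add_bvec (k : Fin (n + 1) → ℤ) (i : Fin (n + 1)) (x : PSpace n) :
    character k (x + bvec i) = character k x := by
  rw [← mFourier_toTorus, ← mFourier_toTorus]
  congr 1
  funext j
  by_cases h : j = i
  · subst h; simp [toTorus]
  · simp [toTorus, h]

theorem trig_add_bvec (s : Finset (Fin (n + 1) → ℤ)) (a : (Fin (n + 1) → ℤ) → ℂ)
    (i : Fin (n + 1)) (x : PSpace n) : trig s a (x + bvec i) = trig s a x := by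
  simp [trig, character_add_bvec]

theorem hasFDerivAt_character (k : Fin (n + 1) → ℤ) (x : PSpace n) :
    HasFDerivAt (character k)
      (∑ j, (EuclideanSpace.proj (𝕜 := ℝ) j : PSpace n →L[ℝ] ℝ).smulRight
        (2 * Real.pi * Complex.I * k j * character k x)) x := by
  have h1 : ∀ j, HasFDerivAt (fun y : PSpace n => ((y j : ℝ) : ℂ))
      (Complex.ofRealCLM.comp (EuclideanSpace.proj (𝕜 := ℝ) j)) x := fun j =>
    (Complex.ofRealCLM.comp (EuclideanSpace.proj (𝕜 := ℝ) j)).hasFDerivAt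
  have h2 := ((HasFDerivAt.fun_sum fun j (_ : j ∈ Finset.univ) =>
    (h1 j).const_mul (k j : ℂ)).const_mul (2 * Real.pi * Complex.I)).cexp
  refine h2.congr_fderiv ?_
  ext v
  simp [character, Finset.mul_sum]
  refine Finset.sum_congr rfl fun j _ => ?_
  ring

theorem contDiff_character (k : Fin (n + 1) → ℤ) : ContDiff ℝ ∞ (character (n := n) k) := by
  refine ContDiff.cexp (contDiff_const.mul (ContDiff.sum fun j _ => contDiff_const.mul ?_))
  exact Complex.ofRealCLM.contDiff.comp (contDiff_coord j)

theorem contDiff_trig (s : Finset (Fin (n + 1) → ℤ)) (a : (Fin (n + 1) → ℤ) → ℂ) :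
    ContDiff ℝ ∞ (trig (n := n) s a) :=
  Complex.reCLM.contDiff.comp
    (ContDiff.sum fun k _ => contDiff_const.mul (contDiff_character k))

theorem pd_trig (s : Finset (Fin (n + 1) → ℤ)) (a : (Fin (n + 1) → ℤ) → ℂ) (l : Fin (n + 1)) :
    pd l (trig (n := n) s a) = trig s fun k => 2 * Real.pi * Complex.I * k l * a k := by
  funext x
  have h := (Complex.reCLM.hasFDerivAt.comp x (HasFDerivAt.fun_sum fun k (_ : k ∈ s) =>
    (hasFDerivAt_character k x).const_mul (a k))).fderiv
  change fderiv ℝ (Complex.reCLM ∘ fun y => ∑ k ∈ s, a k * character k y) x (bvec l) = _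
  rw [h]
  simp only [trig, ContinuousLinearMap.comp_apply, Complex.reCLM_apply]
  congr 1
  simp only [sum_apply, smul_apply, ContinuousLinearMap.smulRight_apply, PiLp.proj_apply,
    bvec_apply, ite_smul, one_smul, zero_smul, Finset.sum_ite_eq', Finset.mem_univ, if_true,
    smul_eq_mul]
  refine Finset.sum_congr rfl fun k _ => ?_
  ring

theorem norm_sum_mFourierLp (s : Finset (Fin (n + 1) → ℤ)) (a : (Fin (n + 1) → ℤ) → ℂ) :
    ‖∑ k ∈ s, a k • UnitAddTorus.mFourierLp 2 k‖ = Real.sqrt (∑ k ∈ s, ‖a k‖ ^ 2) := by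
  have h := UnitAddTorus.orthonormal_mFourier.inner_sum a a s
  rw [@norm_eq_sqrt_re_inner ℂ, h]
  congr 1
  simp [← Complex.normSq_eq_conj_mul_self, Complex.normSq_eq_norm_sq]
  norm_cast

theorem coeFn_sum_mFourierLp (s : Finset (Fin (n + 1) → ℤ)) (a : (Fin (n + 1) → ℤ) → ℂ) :
    ⇑(∑ k ∈ s, a k • UnitAddTorus.mFourierLp 2 k) =ᵐ[volume]
      fun t => ∑ k ∈ s, a k * UnitAddTorus.mFourier k t := by
  have h1 : ∑ k ∈ s, a k • UnitAddTorus.mFourierLp 2 k =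
      ContinuousMap.toLp (E := ℂ) 2 volume ℂ
        (∑ k ∈ s, a k • UnitAddTorus.mFourier (d := Fin (n + 1)) k) := by
    simp [map_sum]
  rw [h1]
  filter_upwards [ContinuousMap.coeFn_toLp (𝕜 := ℂ) (p := 2)
    (volume : Measure (UnitAddTorus (Fin (n + 1))))
    (∑ k ∈ s, a k • UnitAddTorus.mFourier (d := Fin (n + 1)) k)] with t ht
  rw [ht]
  simp

/-- Parseval's identity on the torus; passing to real parts only decreases the norm. -/
theorem eLpNorm_trig_le (s : Finset (Fin (n + 1) → ℤ)) (a : (Fin (n + 1) → ℤ) → ℂ) :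
    eLpNorm (trig (n := n) s a) 2 (volume.restrict unitCube) ≤
      ENNReal.ofReal (Real.sqrt (∑ k ∈ s, ‖a k‖ ^ 2)) := by
  set P : UnitAddTorus (Fin (n + 1)) → ℂ := fun t => ∑ k ∈ s, a k * UnitAddTorus.mFourier k t
  have hP : Continuous P := continuous_finsetSum _ fun k _ =>
    continuous_const.mul (UnitAddTorus.mFourier k).continuous
  calc eLpNorm (trig (n := n) s a) 2 (volume.restrict unitCube)
      ≤ eLpNorm (P ∘ toTorus) 2 (volume.restrict unitCube) := by
        refine eLpNorm_mono fun x => ?_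
        simp only [P, Function.comp, mFourier_toTorus]
        exact Complex.abs_re_le_norm _
    _ = eLpNorm P 2 volume :=
        eLpNorm_comp_measurePreserving hP.aestronglyMeasurable measurePreserving_toTorus
    _ = eLpNorm (∑ k ∈ s, a k • UnitAddTorus.mFourierLp 2 k : Lp ℂ 2 _) 2 volume :=
        (eLpNorm_congr_ae (coeFn_sum_mFourierLp s a)).symm
    _ = _ := by
        rw [← norm_sum_mFourierLp, Lp.norm_def, ENNReal.ofReal_toReal (Lp.eLpNorm_ne_top _)]

/-- The squared length of a frequency. -/
def freqSq (k : Fin (n + 1) → ℤ) : ℤ := ∑ i, k i ^ 2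

theorem sq_le_freqSq (k : Fin (n + 1) → ℤ) (j : Fin (n + 1)) : k j ^ 2 ≤ freqSq k :=
  Finset.single_le_sum (f := fun i => k i ^ 2) (fun _ _ => sq_nonneg _) (Finset.mem_univ j)

theorem freqSq_eq_zero {k : Fin (n + 1) → ℤ} : freqSq k = 0 ↔ k = 0 := by
  rw [freqSq, Finset.sum_eq_zero_iff_of_nonneg fun _ _ => sq_nonneg _]
  simp [funext_iff]

theorem abs_mul_div_freqSq_le (k : Fin (n + 1) → ℤ) (j l : Fin (n + 1)) :
    |(k l : ℝ)| * |(k j : ℝ)| / freqSq k ≤ 1 := by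
  have h1 : ((k j : ℝ)) ^ 2 ≤ freqSq k := by exact_mod_cast sq_le_freqSq k j
  have h2 : ((k l : ℝ)) ^ 2 ≤ freqSq k := by exact_mod_cast sq_le_freqSq k l
  refine div_le_one_of_le₀ ?_ ((sq_nonneg _).trans h1)
  nlinarith [sq_abs (k j : ℝ), sq_abs (k l : ℝ), sq_nonneg (|(k l : ℝ)| - |(k j : ℝ)|)]

theorem abs_div_freqSq_le (k : Fin (n + 1) → ℤ) (j : Fin (n + 1)) :
    |(k j : ℝ)| / freqSq k ≤ 1 := by
  have h1 : |k j| ≤ freqSq k := (by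
    rcases eq_or_ne (k j) 0 with h | h
    · rw [h, abs_zero]; exact (sq_nonneg _).trans (sq_le_freqSq k j)
    · refine le_trans ?_ (sq_le_freqSq k j)
      rw [← sq_abs]
      nlinarith [Int.one_le_abs h])
  have h2 : |(k j : ℝ)| ≤ freqSq k := by exact_mod_cast h1
  exact div_le_one_of_le₀ h2 ((abs_nonneg _).trans h2)

theorem trig_sum {ι : Type*} (t : Finset ι) (s : Finset (Fin (n + 1) → ℤ))
    (a : ι → (Fin (n + 1) → ℤ) → ℂ) (x : PSpace n) :
    ∑ j ∈ t, trig s (a j) x = trig s (fun k => ∑ j ∈ t, a j k) x := by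
  simp only [trig, ← Complex.re_sum, Finset.sum_mul]
  rw [Finset.sum_comm]

/-- The coefficients of the solution of the divergence equation. -/
def solCoeff (c : (Fin (n + 1) → ℤ) → ℂ) (j : Fin (n + 1)) (k : Fin (n + 1) → ℤ) : ℂ :=
  -- The field is the gradient of the inverse Laplacian of the datum. At `k = 0` the quotient takes
  -- the default value 0.
  c k * (k j / (2 * Real.pi * Complex.I * freqSq k))

theorem norm_solCoeff_le (c : (Fin (n + 1) → ℤ) → ℂ) (j : Fin (n + 1)) (k : Fin (n + 1) → ℤ) :
    ‖solCoeff c j k‖ ≤ ‖c k‖ := by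
  rw [solCoeff, norm_mul]
  refine mul_le_of_le_one_right (norm_nonneg _) ?_
  simp only [norm_div, norm_mul, Complex.norm_I, mul_one, Complex.norm_ofNat, Complex.norm_real,
    Complex.norm_intCast, Real.norm_eq_abs, abs_of_pos Real.pi_pos]
  have h := abs_div_freqSq_le k j
  have h3 : (0 : ℝ) ≤ freqSq k := by
    have := (sq_nonneg (k j)).trans (sq_le_freqSq k j); exact_mod_cast this
  rw [abs_of_nonneg h3, mul_comm, ← div_div]
  refine div_le_one_of_le₀ (h.trans ?_) (by positivity)
  nlinarith [Real.pi_gt_three]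

theorem norm_deriv_solCoeff_le (c : (Fin (n + 1) → ℤ) → ℂ) (j l : Fin (n + 1))
    (k : Fin (n + 1) → ℤ) :
    ‖2 * Real.pi * Complex.I * k l * solCoeff c j k‖ ≤ ‖c k‖ := by
  have e : 2 * Real.pi * Complex.I * k l * solCoeff c j k = c k * (k l * k j / freqSq k) := by
    have h1 : (2 * Real.pi * Complex.I : ℂ) ≠ 0 := Complex.two_pi_I_ne_zero
    rw [solCoeff]
    rcases eq_or_ne (freqSq k : ℂ) 0 with h | h
    · simp [h]
    · field_simp
  rw [e, norm_mul]
  refine mul_le_of_le_one_right (norm_nonneg _) ?_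
  have h3 : (0 : ℝ) ≤ freqSq k := by
    have := (sq_nonneg (k j)).trans (sq_le_freqSq k j); exact_mod_cast this
  simpa [abs_of_nonneg h3] using abs_mul_div_freqSq_le k j l

/-- The mean of a function is not reached by divergences of periodic fields; it is kept as the
separate constant. -/
theorem cdiv_sol (s : Finset (Fin (n + 1) → ℤ)) (c : (Fin (n + 1) → ℤ) → ℂ) (x : PSpace n) :
    cdiv (fun j => trig s (solCoeff c j)) x + (if 0 ∈ s then (c 0).re else 0) = trig s c x := by
  have e : ∀ k : Fin (n + 1) → ℤ, ∑ j, 2 * Real.pi * Complex.I * k j * solCoeff c j k =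
      if k = 0 then 0 else c k := by
    intro k
    have h1 : (2 * Real.pi * Complex.I : ℂ) ≠ 0 := Complex.two_pi_I_ne_zero
    split_ifs with h
    · simp [h]
    · have h2 : (freqSq k : ℂ) ≠ 0 := by
        have : freqSq k ≠ 0 := fun h' => h (freqSq_eq_zero.1 h')
        exact_mod_cast this
      have h3 : ∀ j, 2 * Real.pi * Complex.I * k j * solCoeff c j k =
          c k / freqSq k * (k j : ℂ) ^ 2 := by
        intro j; rw [solCoeff]; field_simp
      simp only [h3, ← Finset.mul_sum]
      have h4 : ∑ j, (k j : ℂ) ^ 2 = freqSq k := by simp [freqSq]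
      rw [h4, div_mul_cancel₀ _ h2]
  have hz : (if 0 ∈ s then (c 0).re else 0) =
      trig s (fun k => if k = 0 then c 0 else 0) x := by
    simp only [trig, ite_mul, zero_mul, Finset.sum_ite_eq']
    split_ifs <;> simp [character]
  simp only [cdiv, pd_trig]
  rw [trig_sum, hz]
  simp only [e, trig, ← Complex.add_re, ← Finset.sum_add_distrib, ← add_mul]
  congr 1
  refine Finset.sum_congr rfl fun k _ => ?_
  split_ifs with h
  · simp [h]
  · simp

/-- Every square integrable function on the torus is approximated by trigonometric polynomials. -/
theorem exists_trig_approx {g : PSpace n → ℝ} (hg : Measurable g)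
    (hg2 : MemLp g 2 (volume.restrict unitCube)) {δ : ℝ≥0∞} (hδ : 0 < δ) :
    ∃ (s : Finset (Fin (n + 1) → ℤ)) (c : (Fin (n + 1) → ℤ) → ℂ),
      eLpNorm (fun x => trig s c x - g x) 2 (volume.restrict unitCube) ≤ δ ∧
      ENNReal.ofReal (Real.sqrt (∑ k ∈ s, ‖c k‖ ^ 2)) ≤
        eLpNorm g 2 (volume.restrict unitCube) + δ := by
  -- A measurable section of the projection: it turns a function on the half-open cube into a
  -- function on the torus with the same norm.
  set sec : UnitAddTorus (Fin (n + 1)) → PSpace n := fun t =>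
    WithLp.toLp 2 fun i => (AddCircle.measurableEquivIoc 1 0 (t i) : ℝ) with hsec
  have hsecm : Measurable sec := by
    refine (WithLp.measurable_toLp 2 _).comp (measurable_pi_lambda _ fun i => ?_)
    exact measurable_subtype_coe.comp
      ((AddCircle.measurableEquivIoc 1 0).measurable.comp (measurable_pi_apply i))
  have hsecq : ∀ x ∈ unitCube (n := n), sec (toTorus x) = x := by
    intro x hx
    ext i
    have h0 : x i ∈ Set.Ioc (0 : ℝ) (0 + 1) := by simpa using hx i
    have := AddCircle.equivIoc_coe_of_mem (p := (1 : ℝ)) h0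
    exact this
  set G : UnitAddTorus (Fin (n + 1)) → ℂ := fun t => (g (sec t) : ℂ) with hG
  have hGm : Measurable G := Complex.measurable_ofReal.comp (hg.comp hsecm)
  have hmeas : MeasurableSet (unitCube (n := n)) := by
    have : unitCube (n := n) = ⋂ i, (fun x : PSpace n => x i) ⁻¹' Set.Ioc (0 : ℝ) 1 := by
      ext x; simp [unitCube]
    rw [this]
    exact MeasurableSet.iInter fun i =>
      (contDiff_coord (m := 0) i).continuous.measurable measurableSet_Ioc
  have hGnorm : eLpNorm G 2 volume = eLpNorm g 2 (volume.restrict unitCube) := by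
    rw [← eLpNorm_comp_measurePreserving hGm.aestronglyMeasurable measurePreserving_toTorus]
    refine eLpNorm_congr_norm_ae ?_
    filter_upwards [ae_restrict_mem hmeas] with x hx
    simp [hG, hsecq x hx]
  have hG2 : MemLp G 2 volume := ⟨hGm.aestronglyMeasurable, hGnorm ▸ hg2.2⟩
  have hdense : (hG2.toLp G : Lp ℂ 2 _) ∈ closure
      (Submodule.span ℂ (Set.range (UnitAddTorus.mFourierLp (d := Fin (n + 1)) 2)) : Set _) := by
    have := UnitAddTorus.span_mFourierLp_closure_eq_top (d := Fin (n + 1)) (p := 2) (by norm_num)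
    rw [← Submodule.topologicalClosure_coe, this]
    trivial
  obtain ⟨f, hf, hfd⟩ := EMetric.mem_closure_iff.1 hdense δ hδ
  obtain ⟨c, rfl⟩ := (Finsupp.mem_span_range_iff_exists_finsupp).1 hf
  rw [Finsupp.sum] at hfd
  refine ⟨c.support, c, ?_, ?_⟩
  · set P : UnitAddTorus (Fin (n + 1)) → ℂ := fun t =>
      ∑ k ∈ c.support, c k * UnitAddTorus.mFourier k t with hP
    have hPc : Continuous P := continuous_finsetSum _ fun k _ =>
      continuous_const.mul (UnitAddTorus.mFourier k).continuous
    calc eLpNorm (fun x => trig c.support c x - g x) 2 (volume.restrict unitCube)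
        ≤ eLpNorm ((G - P) ∘ toTorus) 2 (volume.restrict unitCube) := by
          refine eLpNorm_mono_ae ?_
          filter_upwards [ae_restrict_mem hmeas] with x hx
          have : trig c.support c x - g x = -((G - P) (toTorus x)).re := by
            simp [hG, hP, hsecq x hx, mFourier_toTorus, trig]
          rw [this, norm_neg]
          exact Complex.abs_re_le_norm _
      _ = eLpNorm (G - P) 2 volume :=
          eLpNorm_comp_measurePreserving (hGm.aestronglyMeasurable.sub
            hPc.aestronglyMeasurable) measurePreserving_toTorus
      _ = edist (hG2.toLp G) (∑ k ∈ c.support, c k • UnitAddTorus.mFourierLp 2 k) := by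
          rw [Lp.edist_def]
          refine eLpNorm_congr_ae ?_
          filter_upwards [hG2.coeFn_toLp, coeFn_sum_mFourierLp c.support c] with t h1 h2
          simp only [Pi.sub_apply]
          rw [h1, h2]
      _ ≤ δ := hfd.le
  · rw [← norm_sum_mFourierLp, ofReal_norm, ← hGnorm]
    have : eLpNorm G 2 volume = ‖hG2.toLp G‖ₑ := by
      rw [Lp.enorm_def]; exact (eLpNorm_congr_ae hG2.coeFn_toLp).symm
    rw [this, ← edist_zero_right, ← edist_zero_right]
    refine (edist_triangle_left _ _ (hG2.toLp G)).trans ((add_le_add hfd.le le_rfl).trans ?_)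
    exact (add_comm _ _).le

/-- Solving for a trigonometric approximation keeps the solution smooth. If the approximation error
is at most the norm N of the datum, the coefficients have ℓ² norm at most 2N, and the H¹ norm is a
sum of (n + 1)(n + 2) terms of that size. An error below N requires N > 0, hence the separate case N
= 0. -/
theorem exists_torus_solution {g : PSpace n → ℝ} (hg : Measurable g)
    (hg2 : MemLp g 2 (volume.restrict unitCube)) {ε : ℝ≥0∞} (hε : 0 < ε) :
    ∃ (U : Fin (n + 1) → PSpace n → ℝ) (m : ℝ), (∀ j, ContDiff ℝ ∞ (U j)) ∧
      (∀ j i x, U j (x + bvec i) = U j x) ∧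
      eLpNorm (fun x => cdiv U x + m - g x) 2 (volume.restrict unitCube) ≤ ε ∧
      h1norm (volume.restrict unitCube) U ≤
        (2 * (n + 1) * (n + 2) : ℝ≥0) * eLpNorm g 2 (volume.restrict unitCube) ∧
      ‖m‖ₑ ≤ (2 * (n + 1) * (n + 2) : ℝ≥0) * eLpNorm g 2 (volume.restrict unitCube) := by
  rcases eq_or_ne (eLpNorm g 2 (volume.restrict unitCube)) 0 with h0 | h0
  · refine ⟨fun _ _ => 0, 0, fun _ => contDiff_const, fun _ _ _ => rfl, ?_, ?_, ?_⟩
    · have : (fun x : PSpace n => cdiv (fun _ _ => (0 : ℝ)) x + 0 - g x) = -g := by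
        funext x; simp [cdiv, pd]
      rw [this, eLpNorm_neg, h0]; exact zero_le
    · have : ∀ l, pd (n := n) l (fun _ => (0 : ℝ)) = 0 := by intro l; funext x; simp [pd]
      simp [h1norm, this]
    · simp
  obtain ⟨s, c, h1, h2⟩ := exists_trig_approx hg hg2
    (δ := min ε (eLpNorm g 2 (volume.restrict unitCube))) (lt_min hε (pos_iff_ne_zero.2 h0))
  set N := eLpNorm g 2 (volume.restrict unitCube)
  have h3 : ENNReal.ofReal (Real.sqrt (∑ k ∈ s, ‖c k‖ ^ 2)) ≤ 2 * N := by
    rw [two_mul]; exact h2.trans (add_le_add le_rfl (min_le_right _ _))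
  have key : ∀ a : (Fin (n + 1) → ℤ) → ℂ, (∀ k, ‖a k‖ ≤ ‖c k‖) →
      eLpNorm (trig (n := n) s a) 2 (volume.restrict unitCube) ≤ 2 * N := fun a ha => by
    refine (eLpNorm_trig_le s a).trans (le_trans ?_ h3)
    gcongr
    exact ha _
  refine ⟨fun j => trig s (solCoeff c j), if 0 ∈ s then (c 0).re else 0,
    fun j => contDiff_trig _ _, fun j i x => trig_add_bvec _ _ _ _, ?_, ?_, ?_⟩
  · simp only [cdiv_sol]
    exact h1.trans (min_le_left _ _)
  · calc h1norm (volume.restrict unitCube) (fun j => trig s (solCoeff c j))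
        ≤ ∑ _j : Fin (n + 1), (2 * N + ∑ _l : Fin (n + 1), 2 * N) := by
          refine Finset.sum_le_sum fun j _ => add_le_add (key _ (norm_solCoeff_le c j))
            (Finset.sum_le_sum fun l _ => ?_)
          rw [pd_trig]
          exact key _ (norm_deriv_solCoeff_le c j l)
      _ = _ := by simp; ring
  · have : ‖(if 0 ∈ s then (c 0).re else 0)‖ₑ ≤ 2 * N := by
      refine le_trans ?_ h3
      rw [← ofReal_norm]
      refine ENNReal.ofReal_le_ofReal ?_
      split_ifs with h
      · refine (Complex.abs_re_le_norm _).trans (Real.le_sqrt_of_sq_le ?_)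
        exact Finset.single_le_sum (f := fun k => ‖c k‖ ^ 2) (fun _ _ => sq_nonneg _) h
      · simp
    refine this.trans ?_
    gcongr
    push_cast
    calc (2 : ℝ≥0∞) = 2 * 1 * 1 := by norm_num
      _ ≤ 2 * (n + 1) * (n + 2) := by
        gcongr
        · exact le_add_self
        · exact le_add_left (by norm_num)

end Torus

end Pipe

end

noncomputable section

namespace Pipe

open scoped NNReal

variable {n : ℕ}

/-! ### Truncation -/

theorem tendsto_eLpNorm_zero_of_bounded {α F : Type*} [MeasurableSpace α] [NormedAddCommGroup F]
    {μ : Measure α} [IsFiniteMeasure μ] {f : ℕ → α → F} {B : ℝ≥0}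
    (hm : ∀ k, AEStronglyMeasurable (f k) μ) (hB : ∀ k, ∀ᵐ x ∂μ, ‖f k x‖ ≤ B)
    (hf : ∀ᵐ x ∂μ, Tendsto (fun k => f k x) atTop (𝓝 0)) :
    Tendsto (fun k => eLpNorm (f k) 2 μ) atTop (𝓝 0) := by
  have h1 : Tendsto (fun k => ∫⁻ x, ‖f k x‖ₑ ^ (2 : ℝ) ∂μ) atTop (𝓝 (∫⁻ _x, 0 ∂μ)) := by
    refine tendsto_lintegral_of_dominated_convergence' (fun _ => (B : ℝ≥0∞) ^ (2 : ℝ))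
      (fun k => (hm k).enorm.pow_const _) (fun k => ?_) ?_ ?_
    · filter_upwards [hB k] with x hx
      gcongr
      exact_mod_cast (show ‖f k x‖₊ ≤ B from hx)
    · simp only [lintegral_const]
      exact ENNReal.mul_ne_top (by simp) (measure_ne_top _ _)
    · filter_upwards [hf] with x hx
      have h2 : Tendsto (fun k => ‖f k x‖ₑ) atTop (𝓝 0) := by
        have := (continuous_enorm.tendsto (0 : F)).comp hx
        rw [enorm_zero] at this
        exact this
      have h3 := (ENNReal.continuous_rpow_const (y := (2 : ℝ))).tendsto (0 : ℝ≥0∞)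
      have h4 := h3.comp h2
      rw [ENNReal.zero_rpow_of_pos (by norm_num)] at h4
      exact h4
  have h2 : Tendsto (fun k => (∫⁻ x, ‖f k x‖ₑ ^ (2 : ℝ) ∂μ) ^ (1 / 2 : ℝ)) atTop (𝓝 0) := by
    have h3 := ((ENNReal.continuous_rpow_const (y := (1 / 2 : ℝ))).tendsto _).comp h1
    rw [lintegral_zero, ENNReal.zero_rpow_of_pos (by norm_num)] at h3
    exact h3
  refine h2.congr fun k => ?_
  rw [eLpNorm_eq_lintegral_rpow_enorm_toReal (by norm_num) (by norm_num)]
  norm_num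

theorem exists_lipschitzOnWith_closedBall {F : Type*} [NormedAddCommGroup F] [NormedSpace ℝ F]
    {f : PSpace n → F} (hf : ContDiff ℝ 1 f) (R : ℝ) :
    ∃ K : ℝ≥0, LipschitzOnWith K f (Metric.closedBall 0 R) :=
  hf.locallyLipschitz.locallyLipschitzOn.exists_lipschitzOnWith_of_compact
    (isCompact_closedBall 0 R)

/-- The gradient of a function vanishes almost everywhere on its zero set. -/
theorem ae_fderiv_eq_zero_of_eq_zero {W : PSpace n → ℝ} (hW : ContDiff ℝ 1 W) :
    ∀ᵐ x, W x = 0 → fderiv ℝ W x = 0 := by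
  have key : ∀ R : ℕ, ∀ᵐ x, x ∈ Metric.ball (0 : PSpace n) R → W x = 0 → fderiv ℝ W x = 0 := by
    intro R
    obtain ⟨K, hK⟩ := exists_lipschitzOnWith_closedBall hW R
    -- By Rademacher's theorem |W| is differentiable almost everywhere. A zero of W is a minimum of
    -- |W|, so there the derivative of |W| vanishes, W is of lower order than the increment, and its
    -- own derivative is zero.
    have hK' : LipschitzOnWith K (fun x => |W x|) (Metric.ball 0 R) := by
      refine LipschitzOnWith.of_dist_le_mul fun x hx y hy => ?_
      refine le_trans ?_ (hK.dist_le_mul x (Metric.ball_subset_closedBall hx) y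
        (Metric.ball_subset_closedBall hy))
      rw [Real.dist_eq, Real.dist_eq]
      exact abs_abs_sub_abs_le_abs_sub _ _
    filter_upwards [hK'.ae_differentiableWithinAt_of_mem (μ := volume)] with x hx hxR h0
    have hd : DifferentiableAt ℝ (fun x => |W x|) x :=
      (hx hxR).differentiableAt (Metric.isOpen_ball.mem_nhds hxR)
    have hmin : IsLocalMin (fun x => |W x|) x :=
      Eventually.of_forall fun y => by simp [h0]
    have h1 := hd.hasFDerivAt
    rw [hmin.fderiv_eq_zero] at h1
    have h2 : HasFDerivAt W (0 : PSpace n →L[ℝ] ℝ) x := by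
      rw [hasFDerivAt_iff_isLittleO] at h1 ⊢
      simp only [h0, abs_zero, sub_zero, zero_apply] at h1 ⊢
      exact Asymptotics.isLittleO_abs_left.1 h1
    exact h2.fderiv
  filter_upwards [ae_all_iff.2 key] with x hx
  obtain ⟨R, hR⟩ := exists_nat_gt ‖x‖
  exact hx R (by simpa using hR)

/-- A smooth truncation function which vanishes near `0`. -/
def trunc (t : ℝ) : ℝ := t * (1 - (⟨1, 2, by norm_num, by norm_num⟩ : ContDiffBump (0 : ℝ)) t)

theorem contDiff_trunc : ContDiff ℝ ∞ trunc :=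
  contDiff_id.mul (contDiff_const.sub (ContDiffBump.contDiff _))

theorem trunc_of_abs_le {t : ℝ} (h : |t| ≤ 1) : trunc t = 0 := by
  rw [trunc, ContDiffBump.one_of_mem_closedBall _ (by simpa using h)]; simp

theorem trunc_of_le_abs {t : ℝ} (h : 2 ≤ |t|) : trunc t = t := by
  rw [trunc, ContDiffBump.zero_of_le_dist _ (by simpa using h)]; simp

theorem abs_trunc_le (t : ℝ) : |trunc t| ≤ |t| := by
  rw [trunc, abs_mul]
  refine mul_le_of_le_one_right (abs_nonneg _) ?_
  set b : ContDiffBump (0 : ℝ) := ⟨1, 2, by norm_num, by norm_num⟩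
  have h1 := b.nonneg (x := t)
  have h2 := b.le_one (x := t)
  rw [abs_le]; constructor <;> linarith

theorem deriv_trunc_of_lt_abs {t : ℝ} (h : 2 < |t|) : deriv trunc t = 1 := by
  have : trunc =ᶠ[𝓝 t] id := by
    filter_upwards [(isOpen_lt continuous_const continuous_abs).mem_nhds h] with s hs
    exact trunc_of_le_abs (le_of_lt hs)
  rw [this.deriv_eq]; simp

theorem exists_abs_deriv_trunc_le : ∃ B : ℝ≥0, ∀ t, |deriv trunc t| ≤ B := by
  have hc : Continuous (deriv trunc) := contDiff_trunc.continuous_deriv (by simp)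
  obtain ⟨B, hB⟩ := (isCompact_closedBall (0 : ℝ) 2).exists_bound_of_continuousOn hc.continuousOn
  refine ⟨(max B 1).toNNReal, fun t => ?_⟩
  rw [Real.coe_toNNReal _ (le_max_of_le_right zero_le_one)]
  rcases le_or_gt |t| 2 with h | h
  · exact (hB t (by simpa using h)).trans (le_max_left _ _)
  · rw [deriv_trunc_of_lt_abs h]; simp

/-- The truncation of a function at level `1 / (k + 1)`, extended by zero outside `Q`. -/
def truncate (Q : Set (PSpace n)) (W : PSpace n → ℝ) (k : ℕ) : PSpace n → ℝ :=
  Q.indicator fun x => trunc ((k + 1) * W x) / (k + 1)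

/-- The truncation vanishes where |W| ≤ 1/(k+1). The rest of the closure of `Q` lies in a compact
set that misses the frontier, where W = 0, and therefore stays inside `Q`. -/
theorem isTest_truncate {Q : Set (PSpace n)} (hQ : IsOpen Q) (hb : Bornology.IsBounded Q)
    {W : PSpace n → ℝ} (hW : ContDiff ℝ ∞ W) (h0 : ∀ x ∈ frontier Q, W x = 0) (k : ℕ) :
    IsTest Q (truncate Q W k) := by
  set K : Set (PSpace n) := closure Q ∩ {x | 1 ≤ |(k + 1) * W x|} with hKdef
  have hKc : IsClosed K := isClosed_closure.inter
    (isClosed_le continuous_const (continuous_const.mul hW.continuous).abs)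
  have hK : IsCompact K := Metric.isCompact_of_isClosed_isBounded hKc
    (hb.closure.subset Set.inter_subset_left)
  have hKQ : K ⊆ Q := by
    intro x hx
    by_contra hxQ
    have : x ∈ frontier Q := by rw [hQ.frontier_eq]; exact ⟨hx.1, hxQ⟩
    have h2 : (1 : ℝ) ≤ |(k + 1) * W x| := hx.2
    rw [h0 x this] at h2
    norm_num at h2
  have hzero : ∀ x ∉ K, truncate Q W k x = 0 := by
    intro x hx
    by_cases hxQ : x ∈ Q
    · have : |(k + 1) * W x| ≤ 1 := by
        by_contra h
        exact hx ⟨subset_closure hxQ, (not_le.1 h).le⟩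
      simp [truncate, hxQ, trunc_of_abs_le this]
    · simp [truncate, hxQ]
  have hsupp : tsupport (truncate Q W k) ⊆ K :=
    closure_minimal (fun x hx => by_contra fun h => hx (hzero x h)) hKc
  refine ⟨contDiff_iff_contDiffAt.2 fun x => ?_, hK.of_isClosed_subset (isClosed_tsupport _) hsupp,
    hsupp.trans hKQ⟩
  by_cases hx : x ∈ Q
  · have h1 : ContDiff ℝ ∞ fun x => trunc ((k + 1) * W x) / (k + 1) :=
      (contDiff_trunc.comp (contDiff_const.mul hW)).div_const _
    refine h1.contDiffAt.congr_of_eventuallyEq ?_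
    filter_upwards [hQ.mem_nhds hx] with y hy
    simp [truncate, hy]
  · have h1 : ContDiffAt ℝ ∞ (fun _ : PSpace n => (0 : ℝ)) x := contDiffAt_const
    refine h1.congr_of_eventuallyEq ?_
    filter_upwards [hKc.isOpen_compl.mem_nhds fun h => hx (hKQ h)] with y hy
    exact hzero y hy

theorem pd_truncate {Q : Set (PSpace n)} (hQ : IsOpen Q) {W : PSpace n → ℝ}
    (hW : ContDiff ℝ ∞ W) (k : ℕ) (l : Fin (n + 1)) {x : PSpace n} (hx : x ∈ Q) :
    pd l (truncate Q W k) x = deriv trunc ((k + 1) * W x) * pd l W x := by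
  have h1 : truncate Q W k =ᶠ[𝓝 x] fun y => trunc ((k + 1) * W y) / (k + 1) := by
    filter_upwards [hQ.mem_nhds hx] with y hy
    simp [truncate, hy]
  have h2 := ((contDiff_trunc.differentiable (by simp) ((k + 1) * W x)).hasDerivAt.comp_hasFDerivAt
    x ((hW.differentiable (by simp) x).hasFDerivAt.const_mul ((k : ℝ) + 1))).mul_const
      ((k : ℝ) + 1)⁻¹
  have h3 : HasFDerivAt (fun y => trunc ((k + 1) * W y) / (k + 1)) _ x := h2
  rw [pd, h1.fderiv_eq, h3.fderiv]
  have : (k : ℝ) + 1 ≠ 0 := by positivity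
  simp only [smul_apply, smul_eq_mul, pd]
  field_simp

theorem tendsto_trunc (t : ℝ) :
    Tendsto (fun k : ℕ => trunc ((k + 1) * t) / (k + 1)) atTop (𝓝 t) := by
  rcases eq_or_ne t 0 with rfl | ht
  · simp [trunc]
  · obtain ⟨N, hN⟩ := exists_nat_gt (2 / |t|)
    refine tendsto_const_nhds.congr' ?_
    filter_upwards [eventually_ge_atTop N] with k hk
    have hk' : (N : ℝ) ≤ k := by exact_mod_cast hk
    have ht' : 0 < |t| := abs_pos.2 ht
    rw [div_lt_iff₀ ht'] at hN
    rw [trunc_of_le_abs]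
    · field_simp
    · rw [abs_mul, abs_of_pos (by positivity)]; nlinarith

theorem tendsto_deriv_trunc {t : ℝ} (ht : t ≠ 0) :
    Tendsto (fun k : ℕ => deriv trunc ((k + 1) * t)) atTop (𝓝 1) := by
  obtain ⟨N, hN⟩ := exists_nat_gt (2 / |t|)
  refine tendsto_const_nhds.congr' ?_
  filter_upwards [eventually_ge_atTop N] with k hk
  have hk' : (N : ℝ) ≤ k := by exact_mod_cast hk
  have ht' : 0 < |t| := abs_pos.2 ht
  rw [div_lt_iff₀ ht'] at hN
  rw [deriv_trunc_of_lt_abs]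
  rw [abs_mul, abs_of_pos (by positivity)]; nlinarith

/-- A smooth function vanishing on the boundary of a bounded open set is approximated in `H¹` by
test functions. -/
theorem exists_isTest_approx {Q : Set (PSpace n)} (hQ : IsOpen Q) (hb : Bornology.IsBounded Q)
    {W : PSpace n → ℝ} (hW : ContDiff ℝ ∞ W) (h0 : ∀ x ∈ frontier Q, W x = 0) {ε : ℝ≥0∞}
    (hε : 0 < ε) : ∃ ψ : PSpace n → ℝ, IsTest Q ψ ∧
      eLpNorm (fun x => ψ x - W x) 2 (volume.restrict Q) ≤ ε ∧
      ∀ l, eLpNorm (fun x => pd l ψ x - pd l W x) 2 (volume.restrict Q) ≤ ε := by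
  have hfin : IsFiniteMeasure (volume.restrict Q) :=
    ⟨by rw [Measure.restrict_apply_univ]; exact hb.measure_lt_top⟩
  have hcpt : IsCompact (closure Q) := hb.isCompact_closure
  have ht : ∀ k, IsTest Q (truncate Q W k) := isTest_truncate hQ hb hW h0
  have hcpd : ∀ l, Continuous (pd l W) := fun l =>
    (hW.continuous_fderiv (by simp)).clm_apply continuous_const
  have h1 : Tendsto (fun k => eLpNorm (fun x => truncate Q W k x - W x) 2 (volume.restrict Q))
      atTop (𝓝 0) := by
    obtain ⟨B, hB⟩ := hcpt.exists_bound_of_continuousOn hW.continuous.continuousOn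
    refine tendsto_eLpNorm_zero_of_bounded (B := (2 * B).toNNReal)
      (fun k => ((ht k).smooth.continuous.sub hW.continuous).aestronglyMeasurable)
      (fun k => ?_) ?_
    · filter_upwards [ae_restrict_mem hQ.measurableSet] with x hx
      refine le_trans ?_ (Real.le_coe_toNNReal _)
      have hBx := hB x (subset_closure hx)
      have hk : (0 : ℝ) < (k : ℝ) + 1 := by positivity
      have : |truncate Q W k x| ≤ |W x| := by
        simp only [truncate, Set.indicator_of_mem hx]
        rw [abs_div, abs_of_pos hk, div_le_iff₀ hk]
        refine (abs_trunc_le _).trans ?_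
        rw [abs_mul, abs_of_pos hk, mul_comm]
      refine (norm_sub_le _ _).trans ?_
      rw [Real.norm_eq_abs] at hBx ⊢
      rw [Real.norm_eq_abs]
      linarith
    · filter_upwards [ae_restrict_mem hQ.measurableSet] with x hx
      simp only [truncate, Set.indicator_of_mem hx]
      simpa using (tendsto_trunc (W x)).sub_const (W x)
  -- Where W ≠ 0 the factor from the chain rule is eventually 1; where W = 0 the gradient of W
  -- vanishes almost everywhere. Dominated convergence does the rest.
  have h2 : ∀ l, Tendsto (fun k => eLpNorm (fun x => pd l (truncate Q W k) x - pd l W x) 2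
      (volume.restrict Q)) atTop (𝓝 0) := by
    intro l
    obtain ⟨B, hB⟩ := hcpt.exists_bound_of_continuousOn (hcpd l).continuousOn
    obtain ⟨M, hM⟩ := exists_abs_deriv_trunc_le
    refine tendsto_eLpNorm_zero_of_bounded (B := ((M + 1) * B).toNNReal)
      (fun k => (((((ht k).smooth.continuous_fderiv (by simp)).clm_apply
        continuous_const)).sub (hcpd l)).aestronglyMeasurable)
      (fun k => ?_) ?_
    · filter_upwards [ae_restrict_mem hQ.measurableSet] with x hx
      refine le_trans ?_ (Real.le_coe_toNNReal _)
      have hBx := hB x (subset_closure hx)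
      rw [pd_truncate hQ hW k l hx]
      calc ‖deriv trunc ((k + 1) * W x) * pd l W x - pd l W x‖
          ≤ ‖deriv trunc ((k + 1) * W x) * pd l W x‖ + ‖pd l W x‖ := norm_sub_le _ _
        _ ≤ M * B + B := by
            rw [norm_mul]
            gcongr
            exact hM _
        _ = _ := by ring
    · filter_upwards [ae_restrict_mem hQ.measurableSet,
        ae_restrict_of_ae (ae_fderiv_eq_zero_of_eq_zero (hW.of_le (by simp)))] with x hx hx0
      simp only [pd_truncate hQ hW _ l hx]
      rcases eq_or_ne (W x) 0 with hz | hz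
      · have : pd l W x = 0 := by simp [pd, hx0 hz]
        simp [this]
      · simpa using ((tendsto_deriv_trunc hz).mul_const (pd l W x)).sub_const (pd l W x)
  have h3 := (h1.eventually_le_const hε).and (eventually_all.2 fun l => (h2 l).eventually_le_const hε)
  obtain ⟨k, hk1, hk2⟩ := h3.exists
  exact ⟨truncate Q W k, ht k, hk1, hk2⟩

end Pipe

end

noncomputable section

namespace Pipe

open scoped NNReal

variable {n : ℕ}

/-! ### Local solvability of the divergence equation -/

/-- The divergence equation can be solved approximately in `D`, up to multiples of one function,
by `C¹` fields with compact support in `D`, with a bound for the solution. -/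
def Solvable (D : Set (PSpace n)) : Prop :=
  ∃ (C : ℝ≥0) (h : PSpace n → ℝ), Measurable h ∧ MemLp h 2 (volume.restrict D) ∧
    ∀ g : PSpace n → ℝ, Measurable g → MemLp g 2 (volume.restrict D) → ∀ ε : ℝ≥0∞, 0 < ε →
      ∃ (u : PSpace n → PSpace n) (m : ℝ), ContDiff ℝ 1 u ∧ HasCompactSupport u ∧
        tsupport u ⊆ D ∧
        eLpNorm (fun x => div u x + m * h x - g x) 2 (volume.restrict D) ≤ ε ∧
        eLpNorm u 2 (volume.restrict D) ≤ C * eLpNorm g 2 (volume.restrict D) ∧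
        (∀ j, eLpNorm (pd j u) 2 (volume.restrict D) ≤ C * eLpNorm g 2 (volume.restrict D)) ∧
        ‖m‖ₑ ≤ C * eLpNorm g 2 (volume.restrict D)

theorem eLpNorm_sum_le' {α ι : Type*} [MeasurableSpace α] {μ : Measure α} (s : Finset ι)
    {f : ι → α → ℝ} (hf : ∀ j, AEStronglyMeasurable (f j) μ) :
    eLpNorm (fun x => ∑ j ∈ s, f j x) 2 μ ≤ ∑ j ∈ s, eLpNorm (f j) 2 μ := by
  have := eLpNorm_sum_le (p := 2) (s := s) (fun j _ => hf j) (by norm_num)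
  convert this using 2
  funext x; simp

theorem norm_le_sum_abs (v : PSpace n) : ‖v‖ ≤ ∑ j, |v j| := by
  have h : v = ∑ j, v j • bvec j := by
    ext i; simp
  conv_lhs => rw [h]
  refine (norm_sum_le _ _).trans (Finset.sum_le_sum fun j _ => ?_)
  simp [norm_smul, bvec]

theorem eLpNorm_le_sum_coord {α : Type*} [MeasurableSpace α] {μ : Measure α} {f : α → PSpace n}
    (hf : ∀ j, AEStronglyMeasurable (fun x => f x j) μ) :
    eLpNorm f 2 μ ≤ ∑ j, eLpNorm (fun x => f x j) 2 μ := by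
  refine le_trans ?_ ((eLpNorm_sum_le' Finset.univ (f := fun j x => |f x j|)
    (fun j => (hf j).norm)).trans (Finset.sum_le_sum fun j _ =>
      (eLpNorm_norm (fun x => f x j)).le))
  refine eLpNorm_mono_real fun x => norm_le_sum_abs _

/-- The field with given components. -/
def ofCoords (ψ : Fin (n + 1) → PSpace n → ℝ) (x : PSpace n) : PSpace n :=
  WithLp.toLp 2 fun j => ψ j x

theorem contDiff_ofCoords {ψ : Fin (n + 1) → PSpace n → ℝ} {m : WithTop ℕ∞}
    (h : ∀ j, ContDiff ℝ m (ψ j)) : ContDiff ℝ m (ofCoords ψ) :=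
  contDiff_euclidean.2 h

theorem pd_apply {u : PSpace n → PSpace n} {x : PSpace n} (hu : DifferentiableAt ℝ u x)
    (l j : Fin (n + 1)) : pd l u x j = pd l (fun y => u y j) x := by
  have h := ((EuclideanSpace.proj j : PSpace n →L[ℝ] ℝ).hasFDerivAt.comp x hu.hasFDerivAt).fderiv
  change _ = fderiv ℝ ((EuclideanSpace.proj j : PSpace n →L[ℝ] ℝ) ∘ u) x (bvec l)
  rw [h]; rfl

theorem frontier_box_univ {x : PSpace n} (hx : x ∈ frontier (box (Finset.univ : Finset (Fin (n + 1))))) :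
    ∃ i, x i = 0 ∨ x i = 1 / 2 := by
  rw [(isOpen_box _).frontier_eq] at hx
  have hcl : ∀ i, 0 ≤ x i ∧ x i ≤ 1 / 2 := by
    have hsub : box (Finset.univ : Finset (Fin (n + 1))) ⊆
        {y : PSpace n | ∀ i, 0 ≤ y i ∧ y i ≤ 1 / 2} := fun y hy i => by
      have := hy i
      simp only [Finset.mem_univ, if_true] at this
      exact ⟨this.1.le, this.2.le⟩
    refine closure_minimal hsub ?_ hx.1
    simp only [Set.ofPred_forall, Set.ofPred_and]
    exact isClosed_iInter fun i => (isClosed_le continuous_const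
      (contDiff_coord (m := 0) i).continuous).inter (isClosed_le
      (contDiff_coord (m := 0) i).continuous continuous_const)
  by_contra hne
  push Not at hne
  refine hx.2 fun i => ?_
  simp only [Finset.mem_univ, if_true]
  exact ⟨lt_of_le_of_ne (hcl i).1 (hne i).1.symm, lt_of_le_of_ne (hcl i).2 (hne i).2⟩

theorem isBounded_box (S : Finset (Fin (n + 1))) : Bornology.IsBounded (box S) := by
  refine (Metric.isBounded_closedBall (x := (0 : PSpace n)) (r := n + 1)).subset fun x hx => ?_
  rw [mem_closedBall_zero_iff]
  refine (norm_le_sum_abs x).trans ?_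
  calc ∑ j, |x j| ≤ ∑ _j : Fin (n + 1), (1 : ℝ) := by
        refine Finset.sum_le_sum fun j _ => ?_
        have h := hx j
        rw [abs_of_pos h.1]
        refine h.2.le.trans ?_
        split_ifs <;> norm_num
    _ = n + 1 := by simp

theorem box_subset_unitCube (S : Finset (Fin (n + 1))) : box S ⊆ unitCube := fun x hx i => by
  refine ⟨(hx i).1, (hx i).2.le.trans ?_⟩
  split_ifs <;> norm_num

/-- Extend g by zero from the box to the unit cube and find a periodic U with div U + m close to it.
Applying T gives div (R U) + m T1 close to T g, and T g = g on the box because g vanishes outside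
it. So the exceptional function is T1. The field R U vanishes on the faces and can be truncated to
compact support at small cost in H¹. -/
theorem solvable_box : Solvable (box (Finset.univ : Finset (Fin (n + 1)))) := by
  obtain ⟨R⟩ := nonempty_reflData (Finset.univ : Finset (Fin (n + 1)))
  set Q := box (Finset.univ : Finset (Fin (n + 1))) with hQ
  have hQm : MeasurableSet Q := (isOpen_box _).measurableSet
  have hsub : volume.restrict (box (∅ : Finset (Fin (n + 1)))) ≤ volume.restrict unitCube :=
    Measure.restrict_mono (box_subset_unitCube _) le_rfl
  have hfin : IsFiniteMeasure (volume.restrict (box (∅ : Finset (Fin (n + 1))))) :=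
    ⟨by rw [Measure.restrict_apply_univ]; exact (isBounded_box _).measure_lt_top⟩
  have hone : Measurable (fun _ : PSpace n => (1 : ℝ)) := measurable_const
  have hT1 := R.measurable_T _ hone
  set A : ℝ≥0 := 2 * (n + 1) * (n + 2) with hA
  refine ⟨A + (n + 1) * (R.C * A + 1), R.T fun _ => 1, hT1, ⟨hT1.aestronglyMeasurable, ?_⟩,
    fun g hg hg2 ε hε => ?_⟩
  · exact (R.norm_T _ hone).trans_lt (ENNReal.mul_lt_top ENNReal.coe_lt_top
      (memLp_const (1 : ℝ)).2)
  set N := eLpNorm g 2 (volume.restrict Q) with hN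
  rcases eq_or_ne N 0 with h0 | h0
  · refine ⟨0, 0, contDiff_const, HasCompactSupport.zero, by simp, ?_, by simp, fun j => ?_, by simp⟩
    · have : (fun x : PSpace n => div 0 x + 0 * R.T (fun _ => 1) x - g x) = -g := by
        funext x; simp [div, pd]
      rw [this, eLpNorm_neg, ← hN, h0]; exact zero_le
    · have : pd j (0 : PSpace n → PSpace n) = 0 := by funext x; simp [pd]
      simp [this]
  set g' := Q.indicator g with hg'
  have hg'm : Measurable g' := hg.indicator hQm
  have hg'n : eLpNorm g' 2 (volume.restrict unitCube) = N := by
    rw [hg', eLpNorm_indicator_eq_eLpNorm_restrict hQm, Measure.restrict_restrict hQm,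
      Set.inter_eq_left.2 (box_subset_unitCube _)]
  obtain ⟨U, m, hUs, hUp, hU1, hU2, hU3⟩ := exists_torus_solution hg'm
    ⟨hg'm.aestronglyMeasurable, hg'n ▸ hg2.2⟩ (ε := ε / 2 / R.C)
    (ENNReal.div_pos (ENNReal.half_pos hε.ne').ne' ENNReal.coe_ne_top)
  rw [hg'n] at hU2 hU3
  -- The first bound keeps the n + 1 truncation errors in the divergence below ε/2 in total; the
  -- second absorbs the truncation errors into the norm estimate.
  set δ := min (ε / 2 / (n + 1 : ℕ)) N with hδ
  have hδ0 : 0 < δ := lt_min (ENNReal.div_pos (ENNReal.half_pos hε.ne').ne'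
    (ENNReal.natCast_ne_top _)) (pos_iff_ne_zero.2 h0)
  have hWs := R.smooth_R U hUs
  choose ψ hψt hψ1 hψ2 using fun j => exists_isTest_approx (isOpen_box _)
    (isBounded_box (Finset.univ : Finset (Fin (n + 1)))) (hWs j)
    (fun x hx => by
      obtain ⟨i, hi⟩ := frontier_box_univ hx
      exact R.zero_R U hUp j i (Finset.mem_univ i) x hi) hδ0
  have hWm : ∀ j l, Measurable (pd l (R.R U j)) := fun j l => measurable_pd (hWs j) l
  have hψm : ∀ j l, Measurable (pd l (ψ j)) := fun j l => measurable_pd (hψt j).smooth l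
  have hH : h1norm (volume.restrict Q) (R.R U) ≤ R.C * (A * N) := by
    refine (R.norm_R U hUs).trans ?_
    gcongr
    refine le_trans ?_ hU2
    unfold h1norm
    gcongr
  have hle1 : ∀ j, eLpNorm (R.R U j) 2 (volume.restrict Q) ≤ R.C * (A * N) := fun j => by
    refine le_trans ?_ hH
    refine le_trans le_self_add (Finset.single_le_sum (f := fun j =>
      eLpNorm (R.R U j) 2 (volume.restrict Q) + ∑ l, eLpNorm (pd l (R.R U j)) 2
        (volume.restrict Q)) (fun _ _ => zero_le) (Finset.mem_univ j))
  have hle2 : ∀ j l, eLpNorm (pd l (R.R U j)) 2 (volume.restrict Q) ≤ R.C * (A * N) :=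
    fun j l => by
    refine le_trans ?_ hH
    refine le_trans ?_ (Finset.single_le_sum (f := fun j =>
      eLpNorm (R.R U j) 2 (volume.restrict Q) + ∑ l, eLpNorm (pd l (R.R U j)) 2
        (volume.restrict Q)) (fun _ _ => zero_le) (Finset.mem_univ j))
    refine le_trans ?_ le_add_self
    exact Finset.single_le_sum (f := fun l => eLpNorm (pd l (R.R U j)) 2 (volume.restrict Q))
      (fun _ _ => zero_le) (Finset.mem_univ l)
  have hn1 : ∀ j, eLpNorm (ψ j) 2 (volume.restrict Q) ≤ (R.C * A + 1) * N := fun j => by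
    have e : ψ j = (fun x => ψ j x - R.R U j x) + R.R U j := by funext x; simp
    rw [e]
    refine (eLpNorm_add_le ((hψt j).smooth.continuous.sub (hWs j).continuous).aestronglyMeasurable
      (hWs j).continuous.aestronglyMeasurable (by norm_num)).trans ?_
    refine (add_le_add ((hψ1 j).trans (min_le_right _ _)) (hle1 j)).trans (le_of_eq ?_)
    ring
  have hn2 : ∀ j l, eLpNorm (pd l (ψ j)) 2 (volume.restrict Q) ≤ (R.C * A + 1) * N :=
    fun j l => by
    have e : pd l (ψ j) = (fun x => pd l (ψ j) x - pd l (R.R U j) x) + pd l (R.R U j) := by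
      funext x; simp
    rw [e]
    refine (eLpNorm_add_le ((hψm j l).sub (hWm j l)).aestronglyMeasurable
      (hWm j l).aestronglyMeasurable (by norm_num)).trans ?_
    refine (add_le_add ((hψ2 j l).trans (min_le_right _ _)) (hle2 j l)).trans (le_of_eq ?_)
    ring
  have hus : ContDiff ℝ ∞ (ofCoords ψ) := contDiff_ofCoords fun j => (hψt j).smooth
  have hud : ∀ x, DifferentiableAt ℝ (ofCoords ψ) x := hus.differentiable (by simp)
  have hsupp : tsupport (ofCoords ψ) ⊆ ⋃ j, tsupport (ψ j) := by
    refine closure_minimal (fun x hx => ?_)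
      (isClosed_iUnion_of_finite fun j => isClosed_tsupport _)
    by_contra h
    simp only [Set.mem_iUnion, not_exists] at h
    refine hx ?_
    ext j
    exact image_eq_zero_of_notMem_tsupport (f := ψ j) (h j)
  have hfinal : ((n + 1 : ℕ) : ℝ≥0∞) * ((R.C * A + 1) * N) ≤
      ((A + (n + 1) * (R.C * A + 1) : ℝ≥0) : ℝ≥0∞) * N := by
    push_cast
    rw [add_mul (A : ℝ≥0∞), mul_assoc]
    exact le_add_self
  refine ⟨ofCoords ψ, m, hus.of_le (by simp), ?_, ?_, ?_, ?_, fun l => ?_, ?_⟩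
  · exact (isCompact_iUnion fun j => (hψt j).compact).of_isClosed_subset (isClosed_tsupport _) hsupp
  · exact hsupp.trans (Set.iUnion_subset fun j => (hψt j).supp)
  · have e : (fun x => div (ofCoords ψ) x + m * R.T (fun _ => 1) x - g x) =
        (fun x => ∑ j, (pd j (ψ j) x - pd j (R.R U j) x)) +
          fun x => R.T (cdiv U) x + m * R.T (fun _ => 1) x - g x := by
      funext x
      have h1 : div (ofCoords ψ) x = ∑ j, pd j (ψ j) x :=
        Finset.sum_congr rfl fun j _ => by rw [pd_apply (hud x)]; rfl
      rw [Pi.add_apply, h1, ← R.div_R U hUs, Finset.sum_sub_distrib, cdiv]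
      ring
    have hTd : Measurable (R.T (cdiv U)) := R.measurable_T _ (by
      unfold cdiv
      exact Finset.measurable_sum _ fun j _ => measurable_pd (hUs j) j)
    rw [e]
    refine (eLpNorm_add_le ?_ ?_ (by norm_num)).trans ?_
    · exact (Finset.measurable_sum _ fun j _ => (hψm j j).sub (hWm j j)).aestronglyMeasurable
    · exact ((hTd.add (hT1.const_mul m)).sub hg).aestronglyMeasurable
    rw [← ENNReal.add_halves ε]
    refine add_le_add ?_ ?_
    · refine (eLpNorm_sum_le' _ fun j => ((hψm j j).sub (hWm j j)).aestronglyMeasurable).trans ?_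
      calc _ ≤ ∑ _j : Fin (n + 1), ε / 2 / (n + 1 : ℕ) :=
            Finset.sum_le_sum fun j _ => (hψ2 j j).trans (min_le_left _ _)
        _ = (n + 1 : ℕ) * (ε / 2 / (n + 1 : ℕ)) := by simp
        _ ≤ ε / 2 := ENNReal.mul_div_le
    · have hm : Measurable fun x => cdiv U x + m - g' x := by
        refine (Measurable.add_const ?_ m).sub hg'm
        unfold cdiv
        exact Finset.measurable_sum _ fun j _ => measurable_pd (hUs j) j
      have hTe : R.T (fun x => cdiv U x + m - g' x) =
          fun x => R.T (cdiv U) x + m * R.T (fun _ => 1) x - R.T g' x := by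
        have : (fun x => cdiv U x + m - g' x) = cdiv U + m • (fun _ => (1 : ℝ)) - g' := by
          funext x; simp
        rw [this, map_sub, map_add, map_smul]
        funext x; simp
      calc _ = eLpNorm (R.T (fun x => cdiv U x + m - g' x)) 2 (volume.restrict Q) := by
            refine eLpNorm_congr_ae ?_
            filter_upwards [ae_restrict_mem hQm] with x hx
            rw [hTe]
            have : R.T g' x = g x := by
              rw [R.T_eq g' (fun y hy => Set.indicator_of_notMem hy g) x hx, hg',
                Set.indicator_of_mem hx]
            simp only [this]
        _ ≤ R.C * eLpNorm (fun x => cdiv U x + m - g' x) 2 (volume.restrict (box ∅)) :=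
            R.norm_T _ hm
        _ ≤ R.C * (ε / 2 / R.C) := by
            gcongr
            exact (eLpNorm_mono_measure _ hsub).trans hU1
        _ ≤ ε / 2 := ENNReal.mul_div_le
  · refine (eLpNorm_le_sum_coord fun j => (hψt j).smooth.continuous.aestronglyMeasurable).trans ?_
    refine le_trans (Finset.sum_le_sum fun j _ => hn1 j) ?_
    simpa using hfinal
  · have e : ∀ j, (fun x => pd l (ofCoords ψ) x j) = pd l (ψ j) := fun j => by
      funext x; rw [pd_apply (hud x)]; rfl
    refine (eLpNorm_le_sum_coord fun j => by
      rw [e]; exact (hψm j l).aestronglyMeasurable).trans ?_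
    simp only [e]
    refine le_trans (Finset.sum_le_sum fun j _ => hn2 j l) ?_
    simpa using hfinal
  · refine hU3.trans ?_
    gcongr
    exact le_self_add

end Pipe

end

noncomputable section

namespace Pipe

open scoped NNReal

variable {n : ℕ}

/-! ### Transport of solvability by diffeomorphisms -/

/-- The trace of a continuous linear map. -/
def tr (A : PSpace n →L[ℝ] PSpace n) : ℝ := ∑ j, A (bvec j) j

theorem sum_coord_smul (v : PSpace n) : ∑ i, v i • bvec i = v := by
  ext i; simp

theorem apply_eq_sum {F : Type*} [NormedAddCommGroup F] [NormedSpace ℝ F]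
    (A : PSpace n →L[ℝ] F) (v : PSpace n) : A v = ∑ i, v i • A (bvec i) := by
  conv_lhs => rw [← sum_coord_smul v]
  simp

theorem tr_comp_comm (A B : PSpace n →L[ℝ] PSpace n) : tr (A.comp B) = tr (B.comp A) := by
  have key : ∀ A B : PSpace n →L[ℝ] PSpace n,
      tr (A.comp B) = ∑ j, ∑ i, B (bvec j) i * A (bvec i) j := by
    intro A B
    refine Finset.sum_congr rfl fun j _ => ?_
    rw [ContinuousLinearMap.comp_apply, apply_eq_sum A (B (bvec j))]
    simp
  rw [key, key, Finset.sum_comm]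
  refine Finset.sum_congr rfl fun i _ => Finset.sum_congr rfl fun j _ => mul_comm _ _

theorem div_eq_tr (u : PSpace n → PSpace n) (x : PSpace n) : div u x = tr (fderiv ℝ u x) := rfl

theorem norm_bvec (j : Fin (n + 1)) : ‖(bvec j : PSpace n)‖ = 1 := by simp [bvec]

theorem abs_coord_le (v : PSpace n) (j : Fin (n + 1)) : |v j| ≤ ‖v‖ := PiLp.norm_apply_le v j

theorem eLpNorm_le_nnreal_mul {α F G : Type*} [MeasurableSpace α] {μ : Measure α}
    [NormedAddCommGroup F] [NormedAddCommGroup G] {f : α → F} {g : α → G} {A : ℝ≥0}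
    (h : ∀ᵐ x ∂μ, ‖f x‖ ≤ A * ‖g x‖) : eLpNorm f 2 μ ≤ A * eLpNorm g 2 μ := by
  refine (eLpNorm_le_nnreal_smul_eLpNorm_of_ae_le_mul (c := A) (g := g) ?_ 2).trans
    (by simp [ENNReal.smul_def])
  filter_upwards [h] with x hx
  exact_mod_cast hx

/-- The Piola transform of a field. -/
def piola (Φ Ψ : PSpace n → PSpace n) (u : PSpace n → PSpace n) (x : PSpace n) : PSpace n :=
  fderiv ℝ Φ (Ψ x) (u (Ψ x))

section Piola

variable {Φ Ψ : PSpace n → PSpace n} {u : PSpace n → PSpace n}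

theorem contDiff_piola (hΦ : ContDiff ℝ 2 Φ) (hΨ : ContDiff ℝ 2 Ψ) (hu : ContDiff ℝ 1 u) :
    ContDiff ℝ 1 (piola Φ Ψ u) :=
  (((hΦ.fderiv_right (m := 1) (by norm_num)).comp (hΨ.of_le (by norm_num)))).clm_apply
    (hu.comp (hΨ.of_le (by norm_num)))

theorem fderiv_piola (hΦ : ContDiff ℝ 2 Φ) (hΨ : ContDiff ℝ 2 Ψ) (hu : ContDiff ℝ 1 u)
    (x v : PSpace n) : fderiv ℝ (piola Φ Ψ u) x v =
      fderiv ℝ (fderiv ℝ Φ) (Ψ x) (fderiv ℝ Ψ x v) (u (Ψ x)) +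
        fderiv ℝ Φ (Ψ x) (fderiv ℝ u (Ψ x) (fderiv ℝ Ψ x v)) := by
  have hΨd := (hΨ.differentiable (by norm_num) x).hasFDerivAt
  have h1 := ((hΦ.fderiv_right (m := 1) (by norm_num)).differentiable (by norm_num)
    (Ψ x)).hasFDerivAt.comp x hΨd
  have h2 := (hu.differentiable (by norm_num) (Ψ x)).hasFDerivAt.comp x hΨd
  have h3 : HasFDerivAt (piola Φ Ψ u) _ x := h1.clm_apply h2
  rw [h3.fderiv]
  simp [add_comm]

/-- The hypothesis `hjac` says that the logarithmic derivative of det DΦ vanishes in every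
direction, that is, the Jacobian is locally constant; it kills the terms with second derivatives of
Φ. The others form tr (DΦ Du DΨ), which is tr Du by cyclicity of the trace since DΨ DΦ = 1. -/
theorem div_piola (hΦ : ContDiff ℝ 2 Φ) (hΨ : ContDiff ℝ 2 Ψ) (hu : ContDiff ℝ 1 u)
    (hΨΦ : ∀ x, Ψ (Φ x) = x) (hΦΨ : ∀ x, Φ (Ψ x) = x)
    (hjac : ∀ y v, ∑ j, fderiv ℝ (fderiv ℝ Φ) y (fderiv ℝ Ψ (Φ y) (bvec j)) v j = 0)
    (x : PSpace n) : div (piola Φ Ψ u) x = div u (Ψ x) := by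
  have h1 : div (piola Φ Ψ u) x =
      tr ((fderiv ℝ Φ (Ψ x)).comp ((fderiv ℝ u (Ψ x)).comp (fderiv ℝ Ψ x))) := by
    have h2 := hjac (Ψ x) (u (Ψ x))
    rw [hΦΨ] at h2
    simp only [div, pd, fderiv_piola hΦ hΨ hu, PiLp.add_apply, Finset.sum_add_distrib, h2, zero_add]
    rfl
  have h3 : (fderiv ℝ Ψ x).comp (fderiv ℝ Φ (Ψ x)) = ContinuousLinearMap.id ℝ _ := by
    have a := (hΦ.differentiable (by norm_num) (Ψ x)).hasFDerivAt
    have b := (hΨ.differentiable (by norm_num) (Φ (Ψ x))).hasFDerivAt.comp (Ψ x) a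
    have c : Ψ ∘ Φ = id := funext hΨΦ
    rw [c] at b
    have := b.unique (hasFDerivAt_id _)
    rwa [hΦΨ] at this
  rw [h1, tr_comp_comm, ContinuousLinearMap.comp_assoc, h3, div_eq_tr]
  rfl

end Piola

/-- Pull g back by Φ, solve in `D`, and push the field forward by the Piola transform, which
composes the divergence with Ψ. As Φ is only C², the new field is only C¹, which is why `Solvable`
asks for no more. The constants `c₁` and `c₂` bound composition with Ψ and with Φ; the `Bᵢ` bound
their derivatives. -/
theorem Solvable.image {D : Set (PSpace n)} (h : Solvable D) (hDo : IsOpen D)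
    (hDb : Bornology.IsBounded D)
    {Φ Ψ : PSpace n → PSpace n} (hΦ : ContDiff ℝ 2 Φ) (hΨ : ContDiff ℝ 2 Ψ)
    (hΨΦ : ∀ x, Ψ (Φ x) = x) (hΦΨ : ∀ x, Φ (Ψ x) = x)
    (hjac : ∀ y v, ∑ j, fderiv ℝ (fderiv ℝ Φ) y (fderiv ℝ Ψ (Φ y) (bvec j)) v j = 0) :
    Solvable (Φ '' D) := by
  obtain ⟨C, q, hq, hq2, hsol⟩ := h
  have himg : Φ '' D = Ψ ⁻¹' D := by
    ext x
    constructor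
    · rintro ⟨y, hy, rfl⟩; simpa [hΨΦ] using hy
    · intro hx; exact ⟨Ψ x, hx, hΦΨ x⟩
  have hm : MeasurableSet (Φ '' D) := by
    rw [himg]; exact (hDo.preimage hΨ.continuous).measurableSet
  obtain ⟨R, hR⟩ := hDb.subset_closedBall 0
  have hb' : Bornology.IsBounded (Φ '' D) :=
    (((isCompact_closedBall (0 : PSpace n) R).image hΦ.continuous).isBounded).subset
      (Set.image_mono hR)
  obtain ⟨R', hR'⟩ := hb'.subset_closedBall 0
  obtain ⟨K₁, hK₁⟩ := exists_lipschitzOnWith_closedBall (hΦ.of_le (by norm_num)) R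
  obtain ⟨K₂, hK₂⟩ := exists_lipschitzOnWith_closedBall (hΨ.of_le (by norm_num)) R'
  obtain ⟨c₁, hc₁⟩ := exists_eLpNorm_comp_le (n := n) K₁
  obtain ⟨c₂, hc₂⟩ := exists_eLpNorm_comp_le (n := n) K₂
  have hcΨ : ∀ {F : Type} [NormedAddCommGroup F] (w : PSpace n → F),
      AEStronglyMeasurable w (volume.restrict D) →
      AEStronglyMeasurable (w ∘ Ψ) (volume.restrict (Φ '' D)) ∧
      eLpNorm (w ∘ Ψ) 2 (volume.restrict (Φ '' D)) ≤ c₁ * eLpNorm w 2 (volume.restrict D) := by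
    intro F _ w hw
    refine hc₁ Ψ _ _ hΨ.continuous.measurable hm hDo.measurableSet
      (fun x hx => by rwa [himg] at hx) (fun x hx y hy => ?_) w hw
    rw [himg] at hx hy
    have := hK₁.dist_le_mul _ (hR hx) _ (hR hy)
    rwa [hΦΨ, hΦΨ] at this
  have hcΦ : ∀ {F : Type} [NormedAddCommGroup F] (w : PSpace n → F),
      AEStronglyMeasurable w (volume.restrict (Φ '' D)) →
      AEStronglyMeasurable (w ∘ Φ) (volume.restrict D) ∧
      eLpNorm (w ∘ Φ) 2 (volume.restrict D) ≤ c₂ * eLpNorm w 2 (volume.restrict (Φ '' D)) := by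
    intro F _ w hw
    refine hc₂ Φ _ _ hΦ.continuous.measurable hDo.measurableSet hm
      (fun x hx => ⟨x, hx, rfl⟩) (fun x hx y hy => ?_) w hw
    have := hK₂.dist_le_mul _ (hR' ⟨x, hx, rfl⟩) _ (hR' ⟨y, hy, rfl⟩)
    rwa [hΨΦ, hΨΦ] at this
  have hΦ1 : ContDiff ℝ 1 (fderiv ℝ Φ) := hΦ.fderiv_right (by norm_num)
  obtain ⟨M₁, hM₁⟩ := (isCompact_closedBall (0 : PSpace n) R).exists_bound_of_continuousOn
    hΦ1.continuous.continuousOn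
  obtain ⟨M₂, hM₂⟩ := (isCompact_closedBall (0 : PSpace n) R).exists_bound_of_continuousOn
    (hΦ1.continuous_fderiv (by norm_num)).continuousOn
  obtain ⟨M₃, hM₃⟩ := (isCompact_closedBall (0 : PSpace n) R').exists_bound_of_continuousOn
    (hΨ.continuous_fderiv (by norm_num)).continuousOn
  set B₁ := M₁.toNNReal
  set B₂ := M₂.toNNReal
  set B₃ := M₃.toNNReal
  have hB₁ : ∀ x ∈ Φ '' D, ‖fderiv ℝ Φ (Ψ x)‖ ≤ B₁ := fun x hx =>
    (hM₁ _ (hR (by rwa [himg] at hx))).trans (Real.le_coe_toNNReal _)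
  have hB₂ : ∀ x ∈ Φ '' D, ‖fderiv ℝ (fderiv ℝ Φ) (Ψ x)‖ ≤ B₂ := fun x hx =>
    (hM₂ _ (hR (by rwa [himg] at hx))).trans (Real.le_coe_toNNReal _)
  have hB₃ : ∀ x ∈ Φ '' D, ‖fderiv ℝ Ψ x‖ ≤ B₃ := fun x hx =>
    (hM₃ _ (hR' hx)).trans (Real.le_coe_toNNReal _)
  refine ⟨C * c₂ + B₁ * (c₁ * (C * c₂)) + (B₂ * B₃ + B₁ * B₃ * (n + 1)) * (c₁ * (C * c₂)),
    q ∘ Ψ, hq.comp hΨ.continuous.measurable,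
    ⟨(hcΨ q hq2.1).1, (hcΨ q hq2.1).2.trans_lt (ENNReal.mul_lt_top ENNReal.coe_lt_top hq2.2)⟩,
    fun g hg hg2 ε hε => ?_⟩
  have hgΦ : Measurable (g ∘ Φ) := hg.comp hΦ.continuous.measurable
  obtain ⟨u, m, hu, huc, hus, hu1, hu2, hu3, hu4⟩ := hsol (g ∘ Φ) hgΦ
    ⟨(hcΦ g hg2.1).1, (hcΦ g hg2.1).2.trans_lt (ENNReal.mul_lt_top ENNReal.coe_lt_top hg2.2)⟩
    (ε / c₁) (ENNReal.div_pos hε.ne' ENNReal.coe_ne_top)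
  set N := eLpNorm g 2 (volume.restrict (Φ '' D)) with hN
  have hgN : C * eLpNorm (g ∘ Φ) 2 (volume.restrict D) ≤ ((C * c₂ : ℝ≥0) : ℝ≥0∞) * N := by
    push_cast
    rw [mul_assoc]
    gcongr
    exact (hcΦ g hg2.1).2
  replace hu2 := hu2.trans hgN
  replace hu3 := fun j => (hu3 j).trans hgN
  have hud : Continuous (fderiv ℝ u) := hu.continuous_fderiv (by norm_num)
  have hpdm : ∀ l, AEStronglyMeasurable (pd l u) (volume.restrict D) := fun l =>
    (hud.clm_apply continuous_const).aestronglyMeasurable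
  have hnu : eLpNorm (u ∘ Ψ) 2 (volume.restrict (Φ '' D)) ≤
      ((c₁ * (C * c₂) : ℝ≥0) : ℝ≥0∞) * N := by
    refine (hcΨ u hu.continuous.aestronglyMeasurable).2.trans ?_
    rw [ENNReal.coe_mul c₁, mul_assoc]
    gcongr
  have hnpd : ∀ l, eLpNorm (pd l u ∘ Ψ) 2 (volume.restrict (Φ '' D)) ≤
      ((c₁ * (C * c₂) : ℝ≥0) : ℝ≥0∞) * N := fun l => by
    refine (hcΨ (pd l u) (hpdm l)).2.trans ?_
    rw [ENNReal.coe_mul c₁, mul_assoc]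
    gcongr
    exact hu3 l
  have hsupp : tsupport (piola Φ Ψ u) ⊆ Φ '' tsupport u := by
    refine closure_minimal (fun x hx => ?_) (huc.image hΦ.continuous).isClosed
    refine ⟨Ψ x, ?_, hΦΨ x⟩
    by_contra h
    exact hx (by simp [piola, image_eq_zero_of_notMem_tsupport h])
  refine ⟨piola Φ Ψ u, m, contDiff_piola hΦ hΨ hu,
    (huc.image hΦ.continuous).of_isClosed_subset (isClosed_tsupport _) hsupp,
    hsupp.trans (Set.image_mono hus), ?_, ?_, fun j => ?_, ?_⟩
  · have e : (fun x => div (piola Φ Ψ u) x + m * (q ∘ Ψ) x - g x) =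
        (fun y => div u y + m * q y - (g ∘ Φ) y) ∘ Ψ := by
      funext x
      simp [div_piola hΦ hΨ hu hΨΦ hΦΨ hjac, hΦΨ]
    rw [e]
    refine (hcΨ _ ?_).2.trans ?_
    · refine AEStronglyMeasurable.sub (AEStronglyMeasurable.add ?_
        (hq2.1.const_mul m)) hgΦ.aestronglyMeasurable
      have : Continuous (div u) := continuous_finsetSum _ fun j _ =>
        (contDiff_coord (m := 0) j).continuous.comp (hud.clm_apply continuous_const)
      exact this.aestronglyMeasurable
    · calc _ ≤ c₁ * (ε / c₁) := by gcongr
        _ ≤ ε := ENNReal.mul_div_le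
  · have h1 : eLpNorm (piola Φ Ψ u) 2 (volume.restrict (Φ '' D)) ≤
        B₁ * eLpNorm (u ∘ Ψ) 2 (volume.restrict (Φ '' D)) := by
      refine eLpNorm_le_nnreal_mul ?_
      filter_upwards [ae_restrict_mem hm] with x hx
      exact ((fderiv ℝ Φ (Ψ x)).le_opNorm _).trans (by gcongr; exacts [hB₁ x hx, le_rfl])
    calc _ ≤ B₁ * (((c₁ * (C * c₂) : ℝ≥0) : ℝ≥0∞) * N) := h1.trans (by gcongr)
      _ = ((B₁ * (c₁ * (C * c₂)) : ℝ≥0) : ℝ≥0∞) * N := by push_cast; ring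
      _ ≤ _ := by gcongr; exact le_add_self.trans le_self_add
  · have h1 : eLpNorm (pd j (piola Φ Ψ u)) 2 (volume.restrict (Φ '' D)) ≤
        eLpNorm (fun x => (B₂ * B₃ : ℝ≥0) * ‖(u ∘ Ψ) x‖ +
          ∑ l, (B₁ * B₃ : ℝ≥0) * ‖(pd l u ∘ Ψ) x‖) 2 (volume.restrict (Φ '' D)) := by
      refine eLpNorm_mono_ae_real ?_
      filter_upwards [ae_restrict_mem hm] with x hx
      have hw : ‖fderiv ℝ Ψ x (bvec j)‖ ≤ B₃ := by
        refine ((fderiv ℝ Ψ x).le_opNorm _).trans ?_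
        rw [norm_bvec, mul_one]; exact hB₃ x hx
      rw [pd, fderiv_piola hΦ hΨ hu]
      refine (norm_add_le _ _).trans (add_le_add ?_ ?_)
      · refine ((fderiv ℝ (fderiv ℝ Φ) (Ψ x)).le_opNorm₂ _ _).trans ?_
        push_cast
        gcongr
        exacts [hB₂ x hx, le_rfl]
      · refine ((fderiv ℝ Φ (Ψ x)).le_opNorm _).trans ?_
        rw [apply_eq_sum (fderiv ℝ u (Ψ x)) (fderiv ℝ Ψ x (bvec j)), ← Finset.mul_sum]
        push_cast
        rw [mul_assoc]
        gcongr
        · exact hB₁ x hx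
        · rw [Finset.mul_sum]
          refine (norm_sum_le _ _).trans (Finset.sum_le_sum fun l _ => ?_)
          rw [norm_smul]
          gcongr
          · exact (abs_coord_le _ _).trans hw
          · exact le_rfl
    have mu : AEStronglyMeasurable (u ∘ Ψ) (volume.restrict (Φ '' D)) :=
      (hu.continuous.comp hΨ.continuous).aestronglyMeasurable
    have mpd : ∀ l, AEStronglyMeasurable (pd l u ∘ Ψ) (volume.restrict (Φ '' D)) := fun l =>
      (hcΨ _ (hpdm l)).1
    have h2 : ∀ {F : Type} [NormedAddCommGroup F] (A : ℝ≥0) (w : PSpace n → F),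
        eLpNorm (fun x => (A : ℝ) * ‖w x‖) 2 (volume.restrict (Φ '' D)) ≤
          A * eLpNorm w 2 (volume.restrict (Φ '' D)) := fun A w =>
      eLpNorm_le_nnreal_mul (Eventually.of_forall fun x => by simp)
    refine h1.trans ((eLpNorm_add_le (mu.norm.const_mul _)
      (Finset.aestronglyMeasurable_fun_sum _ fun l _ => (mpd l).norm.const_mul _)
      (by norm_num)).trans ?_)
    calc _ ≤ ((B₂ * B₃ : ℝ≥0) : ℝ≥0∞) * (((c₁ * (C * c₂) : ℝ≥0) : ℝ≥0∞) * N) +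
          ∑ _l : Fin (n + 1), ((B₁ * B₃ : ℝ≥0) : ℝ≥0∞) * (((c₁ * (C * c₂) : ℝ≥0) : ℝ≥0∞) * N) := by
          refine add_le_add ((h2 _ _).trans (by gcongr)) ?_
          refine (eLpNorm_sum_le' _ fun l => (mpd l).norm.const_mul _).trans
            (Finset.sum_le_sum fun l _ => (h2 _ _).trans ?_)
          gcongr
          exact hnpd l
      _ = (((B₂ * B₃ + B₁ * B₃ * (n + 1)) * (c₁ * (C * c₂)) : ℝ≥0) : ℝ≥0∞) * N := by
          simp only [Finset.sum_const, Finset.card_univ, Fintype.card_fin, nsmul_eq_mul]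
          push_cast
          ring
      _ ≤ _ := by gcongr; exact le_add_self
  · refine hu4.trans (hgN.trans ?_)
    gcongr
    rw [add_assoc]
    exact le_self_add

end Pipe

end

noncomputable section

namespace Pipe

open scoped NNReal

variable {n : ℕ}

/-! ### Charts -/

/-- The derivative of an affine map is constant, so the Jacobian condition is trivial. -/
theorem Solvable.image_affine {D : Set (PSpace n)} (h : Solvable D) (hDo : IsOpen D)
    (hDb : Bornology.IsBounded D) (A : PSpace n ≃L[ℝ] PSpace n) (c : PSpace n) :
    Solvable ((fun y => A y + c) '' D) := by
  refine h.image hDo hDb (Ψ := fun x => A.symm (x - c)) (A.contDiff.add contDiff_const)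
    (A.symm.contDiff.comp (contDiff_id.sub contDiff_const)) (by simp) (by simp) ?_
  intro y v
  have : fderiv ℝ (fun y => A y + c) = fun _ => (A : PSpace n →L[ℝ] PSpace n) := by
    funext y
    rw [fderiv_add_const]
    exact A.fderiv
  simp [this]

/-- The open cube with side `s` whose lower corner is `c`. -/
def cube (c : PSpace n) (s : ℝ) : Set (PSpace n) := {x | ∀ i, c i < x i ∧ x i < c i + s}

theorem isOpen_cube (c : PSpace n) (s : ℝ) : IsOpen (cube c s) := by
  have : cube c s = ⋂ i : Fin (n + 1),
      {x : PSpace n | c i < x i} ∩ {x : PSpace n | x i < c i + s} := by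
    ext x; simp [cube]
  rw [this]
  refine isOpen_iInter_of_finite fun i => ?_
  exact (isOpen_lt continuous_const (contDiff_coord (m := 0) i).continuous).inter
    (isOpen_lt (contDiff_coord (m := 0) i).continuous continuous_const)

theorem dist_le_of_coord {x y : PSpace n} {s : ℝ} (h : ∀ i, |x i - y i| ≤ s) :
    dist x y ≤ (n + 1) * s := by
  rw [dist_eq_norm]
  refine (norm_le_sum_abs _).trans ?_
  calc ∑ j, |(x - y) j| ≤ ∑ _j : Fin (n + 1), s := Finset.sum_le_sum fun j _ => h j
    _ = _ := by simp

theorem isBounded_cube (c : PSpace n) (s : ℝ) : Bornology.IsBounded (cube c s) := by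
  refine (Metric.isBounded_closedBall (x := c) (r := (n + 1) * |s|)).subset fun x hx => ?_
  refine dist_le_of_coord fun i => ?_
  have h1 := hx i
  have := le_abs_self s
  rw [abs_of_pos (by linarith)]
  linarith

theorem solvable_cube (c : PSpace n) {s : ℝ} (hs : 0 < s) : Solvable (cube c s) := by
  have h := solvable_box (n := n).image_affine (isOpen_box _) (isBounded_box _)
    -- The factor is `2 * s` because the model box has side 1/2.
    (ContinuousLinearEquiv.smulLeft (Units.mk0 (2 * s) (by positivity))) c
  convert h using 1
  ext x
  constructor
  · intro hx
    refine ⟨(2 * s)⁻¹ • (x - c), fun i => ?_, ?_⟩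
    · have := hx i
      simp only [PiLp.smul_apply, PiLp.sub_apply, smul_eq_mul, Finset.mem_univ, if_true]
      rw [inv_mul_eq_div, lt_div_iff₀ (by positivity), div_lt_iff₀ (by positivity)]
      constructor <;> linarith
    · change (2 * s) • (2 * s)⁻¹ • (x - c) + c = x
      rw [smul_inv_smul₀ (by positivity)]; simp
  · rintro ⟨y, hy, rfl⟩ i
    have := hy i
    simp only [Finset.mem_univ, if_true] at this
    change c i < 2 * s * y i + c i ∧ 2 * s * y i + c i < c i + s
    constructor
    · have := mul_pos (by positivity : 0 < 2 * s) this.1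
      linarith
    · nlinarith

theorem fderiv_apply_eq_zero {F : Type*} [NormedAddCommGroup F] [NormedSpace ℝ F]
    {f : PSpace n → F} {b y : PSpace n} (hf : DifferentiableAt ℝ f y)
    (hb : ∀ t : ℝ, f (y + t • b) = f y) : fderiv ℝ f y b = 0 := by
  have h1 : HasLineDerivAt ℝ f (fderiv ℝ f y b) y b := hf.hasFDerivAt.hasLineDerivAt b
  have h2 : HasLineDerivAt ℝ f 0 y b := by
    have : (fun t : ℝ => f (y + t • b)) = fun _ => f y := funext hb
    rw [HasLineDerivAt, this]
    exact hasDerivAt_const _ _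
  exact h1.unique h2

/-- The second derivative of the shear is D²G(w, v) times the `k`-th basis vector, so only j = k
counts in the Jacobian condition. The inverse shear fixes that vector, and DG is constant along it,
so the remaining term is zero. -/
theorem Solvable.image_shear {D : Set (PSpace n)} (h : Solvable D) (hDo : IsOpen D)
    (hDb : Bornology.IsBounded D) {G : PSpace n → ℝ} (hG : ContDiff ℝ 2 G) (k : Fin (n + 1))
    (hk : ∀ (y : PSpace n) (t : ℝ), G (y + t • bvec k) = G y) :
    Solvable ((fun y => y + G y • bvec k) '' D) := by
  have hΦ : ContDiff ℝ 2 fun y => y + G y • (bvec k : PSpace n) :=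
    contDiff_id.add (hG.smul contDiff_const)
  have hΨ : ContDiff ℝ 2 fun y => y + (-G y) • (bvec k : PSpace n) :=
    contDiff_id.add (hG.neg.smul contDiff_const)
  have hGd := hG.differentiable (by norm_num)
  have hG1 : ContDiff ℝ 1 (fderiv ℝ G) := hG.fderiv_right (by norm_num)
  refine h.image hDo hDb (Ψ := fun y => y + (-G y) • (bvec k : PSpace n)) hΦ hΨ
    (fun x => by simp [hk]) (fun x => by simp only [hk]; simp) ?_
  intro y v
  have e1 : fderiv ℝ (fun y => y + G y • (bvec k : PSpace n)) = fun y =>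
      ContinuousLinearMap.id ℝ _ + (fderiv ℝ G y).smulRight (bvec k) := by
    funext y
    exact ((hasFDerivAt_id y).add ((hGd y).hasFDerivAt.smul_const (bvec k))).fderiv
  have e2 : ∀ w v, fderiv ℝ (fun y => ContinuousLinearMap.id ℝ (PSpace n) +
      (fderiv ℝ G y).smulRight (bvec k)) y w v = (fderiv ℝ (fderiv ℝ G) y w v) • bvec k := by
    intro w v
    have h1 := (hG1.differentiable (by norm_num) y).hasFDerivAt
    have h2 := ((ContinuousLinearMap.smulRightL ℝ (PSpace n) (PSpace n)).flip
      (bvec k)).hasFDerivAt.comp y h1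
    have h3 : HasFDerivAt (fun y => ContinuousLinearMap.id ℝ (PSpace n) +
      (fderiv ℝ G y).smulRight (bvec k)) _ y := h2.const_add (ContinuousLinearMap.id ℝ (PSpace n))
    rw [h3.fderiv]
    rfl
  have e3 : ∀ x, fderiv ℝ (fun y => y + (-G y) • (bvec k : PSpace n)) x (bvec k) = bvec k := by
    intro x
    have h1 := ((hasFDerivAt_id x).add ((hGd x).hasFDerivAt.neg.smul_const (bvec k))).fderiv
    have h2 : fderiv ℝ (fun y => y + (-G y) • (bvec k : PSpace n)) x = _ := h1
    rw [h2]
    simp [fderiv_apply_eq_zero (hGd x) (hk x)]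
  have e4 : fderiv ℝ (fderiv ℝ G) y (bvec k) = 0 := by
    refine fderiv_apply_eq_zero (hG1.differentiable (by norm_num) y) fun t => ?_
    rw [← fderiv_comp_add_right]
    congr 1
    funext x
    exact hk x t
  rw [e1]
  simp only [e2, PiLp.smul_apply, bvec_apply, smul_eq_mul, mul_ite, mul_one, mul_zero,
    Finset.sum_ite_eq', Finset.mem_univ, if_true, e3, e4, zero_apply]

/-- Points of the closure of a set with `C²` boundary have neighborhoods in which the divergence
equation is solvable. -/
theorem exists_solvable_nhds {Λ : Set (PSpace n)} (hΛ : IsOpen Λ) (hb : HasC2Boundary Λ)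
    {x₀ : PSpace n} (hx₀ : x₀ ∈ closure Λ) :
    ∃ D : Set (PSpace n), Solvable D ∧ IsOpen D ∧ Bornology.IsBounded D ∧ D ⊆ Λ ∧
      ∃ U ∈ 𝓝 x₀, IsOpen U ∧ U ∩ Λ ⊆ D := by
  have hn : (0 : ℝ) < n + 1 := by positivity
  by_cases hx : x₀ ∈ Λ
  · obtain ⟨ρ, hρ, hball⟩ := Metric.isOpen_iff.1 hΛ x₀ hx
    -- Two points whose coordinates differ by at most `s` are at distance at most (n + 1) s = ρ/2.
    set s := ρ / (n + 1) / 2 with hs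
    have hs0 : 0 < s := by positivity
    set c : PSpace n := WithLp.toLp 2 fun i => x₀ i - s / 2 with hc
    have hci : ∀ i, c i = x₀ i - s / 2 := fun i => rfl
    refine ⟨cube c s, solvable_cube c hs0, isOpen_cube _ _, isBounded_cube _ _,
      fun x hx => hball ?_, cube c s, (isOpen_cube _ _).mem_nhds fun i => ?_, isOpen_cube _ _,
      Set.inter_subset_left⟩
    · refine (dist_le_of_coord (s := s) fun i => ?_).trans_lt ?_
      · have := hx i
        rw [hci] at this
        rw [abs_le]; constructor <;> linarith
      · rw [hs]; field_simp; linarith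
    · rw [hci]; constructor <;> linarith
  · have hfr : x₀ ∈ frontier Λ := by rw [hΛ.frontier_eq]; exact ⟨hx₀, hx⟩
    obtain ⟨e, γ, r, he, hγ, hr, hiff⟩ := hb x₀ hfr
    set k := Fin.last n with hk
    -- An isometry carrying the last basis vector to `e` reduces the graph to one over the last
    -- coordinate.
    obtain ⟨b, hb'⟩ := Orthonormal.exists_orthonormalBasis_extension_of_card_eq (𝕜 := ℝ)
      (E := PSpace n) (ι := Fin (n + 1)) (by simp) (v := fun _ => e) (s := {k})
      ⟨fun _ => he, fun i j hij => (hij (Subsingleton.elim i j)).elim⟩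
    have hbk : b k = e := hb' k rfl
    set O := b.repr.symm with hO
    have hOk : O (bvec k) = e := by rw [← hbk]; exact b.repr_symm_single k
    -- Removing the `k`-th coordinate is the projection used in `HasC2Boundary`, seen through the
    -- isometry; it makes `G` independent of that coordinate, as the shear requires.
    set G : PSpace n → ℝ := fun y => γ (O (y - y k • bvec k)) with hG
    have hG2 : ContDiff ℝ 2 G := hγ.comp (O.contDiff.comp
      (contDiff_id.sub ((contDiff_coord k).smul contDiff_const)))
    have hGk : ∀ (y : PSpace n) (t : ℝ), G (y + t • bvec k) = G y := by
      intro y t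
      have : y + t • bvec k - (y + t • bvec k : PSpace n) k • bvec k = y - y k • bvec k := by
        simp [add_smul]
      simp only [hG, this]
    set Θ : PSpace n → PSpace n := fun y => O (y + G y • bvec k) with hΘ
    set Ξ : PSpace n → PSpace n := fun x => O.symm x + (-G (O.symm x)) • bvec k with hΞ
    have hΘc : Continuous Θ := O.continuous.comp
      (continuous_id.add (hG2.continuous.smul continuous_const))
    have hΞc : Continuous Ξ := O.symm.continuous.add
      ((hG2.continuous.comp O.symm.continuous).neg.smul continuous_const)
    have hΞΘ : ∀ y, Ξ (Θ y) = y := fun y => by simp [hΞ, hΘ, hGk]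
    have hΘΞ : ∀ x, Θ (Ξ x) = x := fun x => by
      simp only [hΘ, hΞ, hGk]; simp
    have hkey : ∀ x ∈ Metric.ball x₀ r, (x ∈ Λ ↔ Ξ x k < 0) := by
      intro x hx
      rw [hiff x hx]
      have h1 : (inner ℝ x e : ℝ) = O.symm x k := by
        rw [← hOk, ← O.symm.inner_map_map, O.symm_apply_apply]
        simp [bvec, PiLp.inner_apply]
      have h2 : x - (inner ℝ x e : ℝ) • e = O (O.symm x - O.symm x k • bvec k) := by
        rw [h1, map_sub, map_smul, hOk, O.apply_symm_apply]
      have h3 : Ξ x k = O.symm x k - G (O.symm x) := by simp [hΞ]; ring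
      rw [h2, h1, h3, sub_neg]
    set y₀ := Ξ x₀ with hy₀
    -- It is not negative because `x₀ ∉ Λ`, and not positive because `x₀` is a limit of points of
    -- `Λ`, which are mapped to negative values.
    have hy₀k : y₀ k = 0 := by
      have h1 : ¬ y₀ k < 0 := fun h => hx ((hkey x₀ (Metric.mem_ball_self hr)).2 h)
      by_contra hne
      have h2 : 0 < y₀ k := lt_of_le_of_ne (not_lt.1 h1) (Ne.symm hne)
      have hopen : IsOpen (Metric.ball x₀ r ∩ {x | 0 < Ξ x k}) := Metric.isOpen_ball.inter
        (isOpen_lt continuous_const ((contDiff_coord (m := 0) k).continuous.comp hΞc))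
      obtain ⟨x, hx1, hx2⟩ := mem_closure_iff.1 hx₀ _ hopen ⟨Metric.mem_ball_self hr, h2⟩
      exact lt_asymm hx1.2 ((hkey x hx1.1).1 hx2)
    have hnb : Θ ⁻¹' Metric.ball x₀ r ∈ 𝓝 y₀ := hΘc.continuousAt.preimage_mem_nhds (by
      rw [hy₀, hΘΞ]; exact Metric.ball_mem_nhds _ hr)
    obtain ⟨ρ, hρ, hball⟩ := Metric.mem_nhds_iff.1 hnb
    set s := ρ / (n + 1) / 2 with hs
    have hs0 : 0 < s := by positivity
    have hclose : ∀ y : PSpace n, (∀ i, |y i - y₀ i| ≤ s) → Θ y ∈ Metric.ball x₀ r :=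
      fun y hy => hball ((dist_le_of_coord hy).trans_lt (by rw [hs]; field_simp; linarith))
    -- The cube hangs just below the flattened boundary: its `k`-th side is (-s, 0), the other sides
    -- are centred at `y₀`.
    set c : PSpace n := WithLp.toLp 2 fun i => if i = k then -s else y₀ i - s / 2 with hc
    have hci : ∀ i, c i = if i = k then -s else y₀ i - s / 2 := fun i => rfl
    have hcube : ∀ y ∈ cube c s, (∀ i, |y i - y₀ i| ≤ s) ∧ y k < 0 := by
      intro y hy
      refine ⟨fun i => ?_, ?_⟩
      · have := hy i
        rw [hci] at this
        split_ifs at this with hik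
        · rw [hik] at this ⊢
          rw [hy₀k, abs_le]; constructor <;> linarith
        · rw [abs_le]; constructor <;> linarith
      · have := (hy k).2
        rw [hci, if_pos rfl] at this
        linarith
    have hS1 := (solvable_cube c hs0).image_shear (isOpen_cube _ _) (isBounded_cube _ _) hG2 k hGk
    have hop1 : IsOpen ((fun y => y + G y • bvec k) '' cube c s) := by
      have : (fun y => y + G y • bvec k) '' cube c s =
          (fun y => y + (-G y) • bvec k) ⁻¹' cube c s := by
        ext x
        constructor
        · rintro ⟨y, hy, rfl⟩; simpa [hGk] using hy
        · intro hx; exact ⟨_, hx, by simp only [hGk]; simp⟩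
      rw [this]
      exact (isOpen_cube _ _).preimage (continuous_id.add (hG2.continuous.neg.smul continuous_const))
    have hbd1 : Bornology.IsBounded ((fun y => y + G y • bvec k) '' cube c s) :=
      (((isBounded_cube c s).isCompact_closure.image (continuous_id.add
        (hG2.continuous.smul continuous_const))).isBounded).subset (Set.image_mono subset_closure)
    have hS2 := hS1.image_affine hop1 hbd1 O.toContinuousLinearEquiv 0
    have himg : (fun y => O.toContinuousLinearEquiv y + 0) ''
        ((fun y => y + G y • bvec k) '' cube c s) = Θ '' cube c s := by
      rw [Set.image_image]; simp [hΘ]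
    rw [himg] at hS2
    have hpre : Θ '' cube c s = Ξ ⁻¹' cube c s := by
      ext x
      constructor
      · rintro ⟨y, hy, rfl⟩; simpa [hΞΘ] using hy
      · intro hx; exact ⟨_, hx, hΘΞ x⟩
    -- In the flattened coordinates `U` is the cube centred at `y₀`. Its part below the boundary has
    -- `k`-th coordinate in (-s/2, 0) and so lies in the hanging cube.
    set U : Set (PSpace n) := Ξ ⁻¹' cube (WithLp.toLp 2 fun i => y₀ i - s / 2) s with hU
    have hUo : IsOpen U := (isOpen_cube _ _).preimage hΞc
    refine ⟨Θ '' cube c s, hS2, ?_, ?_, ?_, U, hUo.mem_nhds fun i => ?_, hUo, ?_⟩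
    · rw [hpre]; exact (isOpen_cube _ _).preimage hΞc
    · exact (((isBounded_cube c s).isCompact_closure.image hΘc).isBounded).subset
        (Set.image_mono subset_closure)
    · rintro _ ⟨y, hy, rfl⟩
      obtain ⟨h1, h2⟩ := hcube y hy
      rw [hkey _ (hclose y h1), hΞΘ]
      exact h2
    · change y₀ i - s / 2 < y₀ i ∧ y₀ i < y₀ i - s / 2 + s
      constructor <;> linarith
    · rintro x ⟨hxU, hxΛ⟩
      rw [hpre]
      have hxi : ∀ i, y₀ i - s / 2 < Ξ x i ∧ Ξ x i < y₀ i - s / 2 + s := hxU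
      have h1 : x ∈ Metric.ball x₀ r := by
        rw [← hΘΞ x]
        refine hclose _ fun i => ?_
        have := hxi i
        rw [abs_le]; constructor <;> linarith
      have h2 := (hkey x h1).1 hxΛ
      intro i
      have := hxi i
      rw [hci]
      split_ifs with hik
      · rw [hik] at this ⊢
        rw [hy₀k] at this
        constructor <;> linarith
      · constructor <;> linarith

end Pipe

end

noncomputable section

namespace Pipe

open scoped NNReal Convolution

variable {n : ℕ}

/-! ### Mollification -/

/-- `C¹` fields with compact support are approximated by test fields. -/
theorem exists_isTest_near {D : Set (PSpace n)} (hD : IsOpen D) {u : PSpace n → PSpace n}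
    (hu : ContDiff ℝ 1 u) (hc : HasCompactSupport u) (hs : tsupport u ⊆ D) {ε : ℝ} (hε : 0 < ε) :
    ∃ ψ : PSpace n → PSpace n, IsTest D ψ ∧ (∀ x, ‖ψ x - u x‖ ≤ ε) ∧
      ∀ j x, ‖pd j ψ x - pd j u x‖ ≤ ε := by
  obtain ⟨δ₀, hδ₀, hsub⟩ := hc.isCompact.exists_cthickening_subset_open hD hs
  have hpc : ∀ j, Continuous (pd j u) := fun j =>
    (hu.continuous_fderiv (by norm_num)).clm_apply continuous_const
  have hpcs : ∀ j, HasCompactSupport (pd j u) := fun j => by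
    refine hc.mono' fun x hx => ?_
    by_contra h
    refine hx ?_
    have h2 : x ∉ tsupport (fderiv ℝ u) := fun h' => h (tsupport_fderiv_subset ℝ h')
    simp [pd, image_eq_zero_of_notMem_tsupport h2]
  obtain ⟨δ₁, hδ₁, hu1⟩ := Metric.uniformContinuous_iff.1
    (hc.uniformContinuous_of_continuous hu.continuous) ε hε
  choose δ₂ hδ₂ hu2 using fun j => Metric.uniformContinuous_iff.1
    ((hpcs j).uniformContinuous_of_continuous (hpc j)) ε hε
  obtain ⟨j₀, -, hj₀⟩ := Finset.exists_min_image Finset.univ δ₂ ⟨0, Finset.mem_univ _⟩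
  -- The mollification radius keeps the support inside `D` and respects the moduli of continuity of
  -- `u` and of all its partial derivatives; `j₀` is the worst of the latter.
  set δ := min δ₀ (min δ₁ (δ₂ j₀)) with hδdef
  have hδ : 0 < δ := lt_min hδ₀ (lt_min hδ₁ (hδ₂ j₀))
  set φ : ContDiffBump (0 : PSpace n) := ⟨δ / 2, δ, half_pos hδ, half_lt_self hδ⟩ with hφ
  set w : PSpace n → ℝ := φ.normed volume
  have hwc : Continuous w := φ.continuous_normed
  have hwl : LocallyIntegrable w := hwc.locallyIntegrable
  set ψ : PSpace n → PSpace n := w ⋆[ContinuousLinearMap.lsmul ℝ ℝ, volume] u with hψ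
  have hpd : ∀ j x, pd j ψ x = (w ⋆[ContinuousLinearMap.lsmul ℝ ℝ, volume] pd j u) x := by
    intro j x
    have h1 := hc.hasFDerivAt_convolution_right (ContinuousLinearMap.lsmul ℝ ℝ) hwl hu x
    rw [pd, h1.fderiv]
    exact convolution_precompR_apply _ hwl (hc.fderiv ℝ) (hu.continuous_fderiv (by norm_num)) x _
  have hsupp : tsupport ψ ⊆ Metric.cthickening δ₀ (tsupport u) := by
    refine closure_minimal (fun x hx => ?_) Metric.isClosed_cthickening
    obtain ⟨a, ha, b, hb, rfl⟩ := Set.mem_add.1 (support_convolution_subset _ hx)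
    rw [φ.support_normed_eq, mem_ball_zero_iff] at ha
    refine Metric.mem_cthickening_of_dist_le _ b _ _ (subset_tsupport _ hb) ?_
    rw [dist_eq_norm, add_sub_cancel_right]
    exact ha.le.trans (min_le_left _ _)
  refine ⟨ψ, ⟨?_, ?_, hsupp.trans hsub⟩, fun x => ?_, fun j x => ?_⟩
  · exact φ.hasCompactSupport_normed.contDiff_convolution_left _ φ.contDiff_normed
      hu.continuous.locallyIntegrable
  · exact hc.isCompact.cthickening.of_isClosed_subset (isClosed_tsupport _) hsupp
  · rw [← dist_eq_norm]
    refine φ.dist_normed_convolution_le hu.continuous.aestronglyMeasurable fun y hy => ?_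
    exact (hu1 (hy.trans_le ((min_le_right _ _).trans (min_le_left _ _)))).le
  · rw [hpd, ← dist_eq_norm]
    refine φ.dist_normed_convolution_le (hpc j).aestronglyMeasurable fun y hy => ?_
    refine (hu2 j (hy.trans_le ((min_le_right _ _).trans ((min_le_right _ _).trans ?_)))).le
    exact hj₀ j (Finset.mem_univ j)

/-- In bounded open sets the approximate solutions of the divergence equation can be chosen to be
test fields. -/
theorem Solvable.exists_isTest {D : Set (PSpace n)} (h : Solvable D) (hDo : IsOpen D)
    (hDb : Bornology.IsBounded D) :
    ∃ (C : ℝ≥0) (h : PSpace n → ℝ), Measurable h ∧ MemLp h 2 (volume.restrict D) ∧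
      ∀ g : PSpace n → ℝ, Measurable g → MemLp g 2 (volume.restrict D) → ∀ ε : ℝ≥0∞, 0 < ε →
        ∃ (u : PSpace n → PSpace n) (m : ℝ), IsTest D u ∧
          eLpNorm (fun x => div u x + m * h x - g x) 2 (volume.restrict D) ≤ ε ∧
          (∀ j, eLpNorm (pd j u) 2 (volume.restrict D) ≤ C * eLpNorm g 2 (volume.restrict D)) ∧
          ‖m‖ₑ ≤ C * eLpNorm g 2 (volume.restrict D) := by
  obtain ⟨C, h, hh, hh2, hsol⟩ := h
  refine ⟨C + 1, h, hh, hh2, fun g hg hg2 ε hε => ?_⟩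
  set N := eLpNorm g 2 (volume.restrict D) with hN
  rcases eq_or_ne N 0 with h0 | h0
  · refine ⟨0, 0, ⟨contDiff_const, HasCompactSupport.zero, by simp⟩, ?_, fun j => ?_, by simp⟩
    · have : (fun x : PSpace n => div 0 x + 0 * h x - g x) = -g := by
        funext x; simp [div, pd]
      rw [this, eLpNorm_neg, ← hN, h0]; exact zero_le
    · have : pd j (0 : PSpace n → PSpace n) = 0 := by funext x; simp [pd]
      simp [this]
  obtain ⟨u, m, hu, huc, hus, hu1, -, hu3, hu4⟩ := hsol g hg hg2 (ε / 2) (ENNReal.half_pos hε.ne')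
  set M := (volume.restrict D) Set.univ ^ ((2 : ℝ≥0∞).toReal⁻¹) with hM
  have hMt : M ≠ ⊤ := by
    refine ENNReal.rpow_ne_top_of_nonneg (by positivity) ?_
    rw [Measure.restrict_apply_univ]
    exact hDb.measure_lt_top.ne
  -- `M` is the square root of the volume of `D`, the price of passing from a uniform bound to an L²
  -- bound. The mollification is made accurate to t/(n + 1) because n + 1 derivatives add up in the
  -- divergence.
  obtain ⟨t, ht, htM⟩ := ENNReal.exists_nnreal_pos_mul_lt hMt
    (lt_min (ENNReal.half_pos hε.ne') (pos_iff_ne_zero.2 h0)).ne'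
  have ht' : (0 : ℝ) < t / (n + 1) := by positivity
  obtain ⟨ψ, hψ, -, hψ2⟩ := exists_isTest_near hDo hu huc hus ht'
  have hn : (1 : ℝ) ≤ n + 1 := by simp
  have key : ∀ {F : Type} [NormedAddCommGroup F] (f : PSpace n → F), (∀ x, ‖f x‖ ≤ t) →
      eLpNorm f 2 (volume.restrict D) ≤ min (ε / 2) N := by
    intro F _ f hf
    refine (eLpNorm_le_of_ae_bound (Eventually.of_forall hf)).trans ?_
    rw [ENNReal.ofReal_coe_nnreal, mul_comm]
    exact htM.le
  have hpψ : ∀ j, Continuous (pd j ψ) := fun j =>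
    (hψ.smooth.continuous_fderiv (by simp)).clm_apply continuous_const
  have hpu : ∀ j, Continuous (pd j u) := fun j =>
    (hu.continuous_fderiv (by norm_num)).clm_apply continuous_const
  have hdu : Continuous (div u) := continuous_finsetSum _ fun j _ =>
    (contDiff_coord (m := 0) j).continuous.comp (hpu j)
  have hdψ : Continuous (div ψ) := continuous_finsetSum _ fun j _ =>
    (contDiff_coord (m := 0) j).continuous.comp (hpψ j)
  refine ⟨ψ, m, hψ, ?_, fun j => ?_, ?_⟩
  · have e : (fun x => div ψ x + m * h x - g x) =
        (fun x => div ψ x - div u x) + fun x => div u x + m * h x - g x := by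
      funext x; simp only [Pi.add_apply]; ring
    rw [e]
    refine (eLpNorm_add_le (hdψ.sub hdu).aestronglyMeasurable
      ((hdu.aestronglyMeasurable.add (hh.const_mul m).aestronglyMeasurable).sub
        hg.aestronglyMeasurable) (by norm_num)).trans ?_
    rw [← ENNReal.add_halves ε]
    refine add_le_add ((key _ fun x => ?_).trans (min_le_left _ _)) hu1
    change ‖(∑ j, pd j ψ x j) - ∑ j, pd j u x j‖ ≤ t
    rw [← Finset.sum_sub_distrib]
    refine (norm_sum_le _ _).trans ?_
    calc ∑ j, ‖pd j ψ x j - pd j u x j‖ ≤ ∑ _j : Fin (n + 1), (t / (n + 1) : ℝ) :=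
          Finset.sum_le_sum fun j _ => (abs_coord_le (pd j ψ x - pd j u x) j).trans (hψ2 j x)
      _ = t := by simp; field_simp
  · have e : pd j ψ = (fun x => pd j ψ x - pd j u x) + pd j u := by funext x; simp
    rw [e]
    refine (eLpNorm_add_le ((hpψ j).sub (hpu j)).aestronglyMeasurable
      (hpu j).aestronglyMeasurable (by norm_num)).trans ?_
    push_cast
    rw [add_mul, one_mul, add_comm]
    refine add_le_add (hu3 j) ((key _ fun x => (hψ2 j x).trans ?_).trans (min_le_right _ _))
    exact div_le_self t.coe_nonneg hn
  · refine hu4.trans ?_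
    gcongr
    exact le_self_add

end Pipe

end

noncomputable section

namespace Pipe

open scoped NNReal

variable {n : ℕ}

/-! ### Axial translations and the decomposition of the pipe into cells -/

/-- Translation by `k` periods. -/
def shift (L : ℝ) (k : ℤ) (x : PSpace n) : PSpace n := x + ((k : ℝ) * L) • ez

@[simp] theorem zc_shift (L : ℝ) (k : ℤ) (x : PSpace n) : zc (shift L k x) = zc x + k * L := by
  simp [zc, shift, ez]

theorem shift_shift (L : ℝ) (k l : ℤ) (x : PSpace n) :
    shift L k (shift L l x) = shift L (l + k) x := by
  simp only [shift, add_assoc, ← add_smul]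
  push_cast
  ring_nf

@[simp] theorem shift_zero (L : ℝ) (x : PSpace n) : shift L 0 x = x := by simp [shift]

theorem shift_one (L : ℝ) (x : PSpace n) : shift L 1 x = x + L • ez := by simp [shift]

theorem shift_mem_iff {L : ℝ} {Λ : Set (PSpace n)} (h : ∀ x, x + L • ez ∈ Λ ↔ x ∈ Λ) (k : ℤ) :
    ∀ x, shift L k x ∈ Λ ↔ x ∈ Λ := by
  induction k using Int.induction_on with
  | zero => simp
  | succ k ih => intro x; rw [← shift_shift, shift_one, h, ih]
  | pred k ih =>
    intro x
    rw [← h (shift L (-(k : ℤ) - 1) x), ← shift_one, shift_shift, ← ih x]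
    simp

theorem apply_shift {F : Type*} {L : ℝ} {Λ : Set (PSpace n)} (h : ∀ x, x + L • ez ∈ Λ ↔ x ∈ Λ)
    {u : PSpace n → F} (hu : ∀ x ∈ Λ, u (x + L • ez) = u x) (k : ℤ) :
    ∀ x ∈ Λ, u (shift L k x) = u x := by
  induction k using Int.induction_on with
  | zero => simp
  | succ k ih =>
    intro x hx
    rw [← shift_shift, shift_one, hu _ ((shift_mem_iff h _ x).2 hx), ih x hx]
  | pred k ih =>
    intro x hx
    rw [← hu _ ((shift_mem_iff h _ x).2 hx), ← shift_one, shift_shift, ← ih x hx]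
    simp

theorem measurePreserving_shift (L : ℝ) (k : ℤ) :
    MeasurePreserving (shift L k : PSpace n → PSpace n) volume volume :=
  measurePreserving_add_right _ _

theorem measurableEmbedding_shift (L : ℝ) (k : ℤ) :
    MeasurableEmbedding (shift L k : PSpace n → PSpace n) :=
  measurableEmbedding_addRight _

theorem contDiff_shift (L : ℝ) (k : ℤ) : ContDiff ℝ ∞ (shift L k : PSpace n → PSpace n) :=
  contDiff_id.add contDiff_const

theorem continuous_zc : Continuous (zc : PSpace n → ℝ) := by unfold zc; fun_prop

/-- The translate by `k` periods of the cell. -/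
def shiftCell (L : ℝ) (Λ : Set (PSpace n)) (k : ℤ) : Set (PSpace n) :=
  {x | x ∈ Λ ∧ k * L < zc x ∧ zc x < k * L + L}

theorem isOpen_shiftCell {L : ℝ} {Λ : Set (PSpace n)} (hΛ : IsOpen Λ) (k : ℤ) :
    IsOpen (shiftCell L Λ k) :=
  hΛ.inter ((isOpen_lt continuous_const continuous_zc).inter
    (isOpen_lt continuous_zc continuous_const))

theorem shiftCell_zero {L : ℝ} {Λ : Set (PSpace n)} : shiftCell L Λ 0 = cell L Λ := by
  simp [shiftCell, cell]

theorem isOpen_cell {L : ℝ} {Λ : Set (PSpace n)} (hΛ : IsOpen Λ) : IsOpen (cell L Λ) :=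
  shiftCell_zero (L := L) (Λ := Λ) ▸ isOpen_shiftCell hΛ 0

theorem shift_preimage_shiftCell {L : ℝ} {Λ : Set (PSpace n)}
    (h : ∀ x, x + L • ez ∈ Λ ↔ x ∈ Λ) (k : ℤ) :
    shift L k ⁻¹' shiftCell L Λ k = cell L Λ := by
  ext x
  simp only [Set.mem_preimage, shiftCell, Set.mem_ofPred_eq, shift_mem_iff h, zc_shift, cell]
  refine and_congr_right fun _ => ⟨fun h => ⟨by linarith, by linarith⟩,
    fun h => ⟨by linarith, by linarith⟩⟩

theorem map_shift_cell {L : ℝ} {Λ : Set (PSpace n)} (hΛ : IsOpen Λ)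
    (h : ∀ x, x + L • ez ∈ Λ ↔ x ∈ Λ) (k : ℤ) :
    (volume.restrict (cell L Λ)).map (shift L k) = volume.restrict (shiftCell L Λ k) := by
  rw [← shift_preimage_shiftCell h k]
  exact ((measurePreserving_shift L k).restrict_preimage
    (isOpen_shiftCell hΛ k).measurableSet).map_eq

theorem volume_zc_eq (c : ℝ) : volume {x : PSpace n | zc x = c} = 0 := by
  have h := (PiLp.volume_preserving_ofLp (Fin (n + 1))).measure_preimage
    (s := {f | f (Fin.last n) = c})
    (measurableSet_eq_fun (measurable_pi_apply _) measurable_const).nullMeasurableSet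
  rw [volume_pi, Measure.pi_hyperplane] at h
  exact h

theorem exists_zc_mem {L : ℝ} (hL : 0 < L) (x : PSpace n) :
    ∃ k : ℤ, k * L ≤ zc x ∧ zc x < k * L + L := by
  refine ⟨⌊zc x / L⌋, ?_, ?_⟩
  · have := Int.floor_le (zc x / L)
    rwa [le_div_iff₀ hL] at this
  · have := Int.lt_floor_add_one (zc x / L)
    rw [div_lt_iff₀ hL] at this
    linarith

/-- The points of the pipe outside all open cells lie on the countably many hyperplanes z = kL,
which are null sets. -/
theorem ae_exists_mem_shiftCell {L : ℝ} (hL : 0 < L) (Λ : Set (PSpace n)) :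
    ∀ᵐ x : PSpace n, x ∈ Λ → ∃ k, x ∈ shiftCell L Λ k := by
  have h : ∀ᵐ x : PSpace n, ∀ k : ℤ, zc x ≠ k * L :=
    ae_all_iff.2 fun k => by simpa [ae_iff] using volume_zc_eq (n := n) (k * L)
  filter_upwards [h] with x hx hxΛ
  obtain ⟨k, h1, h2⟩ := exists_zc_mem hL x
  exact ⟨k, hxΛ, lt_of_le_of_ne h1 (hx k).symm, h2⟩

theorem shiftCell_unique {L : ℝ} (hL : 0 < L) {Λ : Set (PSpace n)} {x : PSpace n} {k l : ℤ}
    (hk : x ∈ shiftCell L Λ k) (hl : x ∈ shiftCell L Λ l) : k = l := by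
  obtain ⟨-, h1, h2⟩ := hk
  obtain ⟨-, h3, h4⟩ := hl
  have a : (k : ℝ) < l + 1 := by nlinarith
  have b : (l : ℝ) < k + 1 := by nlinarith
  have a' : k < l + 1 := by exact_mod_cast a
  have b' : l < k + 1 := by exact_mod_cast b
  omega

theorem volume_restrict_eq_sum {L : ℝ} (hL : 0 < L) {Λ : Set (PSpace n)} (hΛ : IsOpen Λ)
    (h : ∀ x, x + L • ez ∈ Λ ↔ x ∈ Λ) :
    volume.restrict Λ = Measure.sum fun k : ℤ => (volume.restrict (cell L Λ)).map (shift L k) := by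
  simp_rw [map_shift_cell hΛ h]
  rw [← Measure.restrict_iUnion _ fun k => (isOpen_shiftCell hΛ k).measurableSet]
  · refine Measure.restrict_congr_set ?_
    filter_upwards [ae_exists_mem_shiftCell hL Λ] with x hx
    refine propext ⟨fun hxΛ => Set.mem_iUnion.2 (hx hxΛ), fun hxU => ?_⟩
    obtain ⟨k, hk⟩ := Set.mem_iUnion.1 hxU
    exact hk.1
  · intro k l hkl
    exact Set.disjoint_left.2 fun x hk hl => hkl (shiftCell_unique hL hk hl)

theorem ae_restrict_of_ae_cell {L : ℝ} (hL : 0 < L) {Λ : Set (PSpace n)} (hΛ : IsOpen Λ)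
    (h : ∀ x, x + L • ez ∈ Λ ↔ x ∈ Λ) {p : PSpace n → Prop}
    (hp : ∀ᵐ x ∂volume.restrict (cell L Λ), ∀ k : ℤ, p (shift L k x)) :
    ∀ᵐ x ∂volume.restrict Λ, p x := by
  rw [volume_restrict_eq_sum hL hΛ h, Measure.ae_sum_iff]
  intro k
  rw [(measurableEmbedding_shift L k).ae_map_iff]
  exact hp.mono fun x hx => hx k

theorem cell_subset {L : ℝ} {Λ : Set (PSpace n)} : cell L Λ ⊆ Λ := fun _ h => h.1

theorem ae_eq_of_ae_eq_cell {F : Type*} {L : ℝ} (hL : 0 < L) {Λ : Set (PSpace n)}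
    (hΛ : IsOpen Λ) (h : ∀ x, x + L • ez ∈ Λ ↔ x ∈ Λ) {u v : PSpace n → F}
    (hu : ∀ x ∈ Λ, u (x + L • ez) = u x) (hv : ∀ x ∈ Λ, v (x + L • ez) = v x)
    (huv : u =ᵐ[volume.restrict (cell L Λ)] v) : u =ᵐ[volume.restrict Λ] v := by
  refine ae_restrict_of_ae_cell hL hΛ h ?_
  filter_upwards [huv, ae_restrict_mem (isOpen_cell hΛ).measurableSet] with x hx hxc k
  rw [apply_shift h hu k x hxc.1, apply_shift h hv k x hxc.1, hx]

/-! ### Periodization -/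

/-- The sum of all translates of a function by periods. -/
def per {F : Type*} [AddCommMonoid F] (L : ℝ) (ψ : PSpace n → F) (x : PSpace n) : F :=
  ∑ᶠ k : ℤ, ψ (shift L k x)

section Per

variable {F : Type*} [NormedAddCommGroup F] [NormedSpace ℝ F] {L : ℝ}

theorem per_periodic (ψ : PSpace n → F) (x : PSpace n) :
    per L ψ (x + L • ez) = per L ψ x := by
  rw [per, per, ← shift_one,
    ← finsum_comp_equiv (Equiv.addLeft (1 : ℤ)) (f := fun k => ψ (shift L k x))]
  simp only [shift_shift, Equiv.coe_addLeft]

/-- The same finite range of translates works for all x with |z| ≤ R. This uniformity lets the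
periodization be differentiated and integrated term by term. -/
theorem per_eq_sum (hL : 0 < L) {ψ : PSpace n → F} {M R : ℝ} (hψ : ∀ x, ψ x ≠ 0 → |zc x| ≤ M)
    {K : ℕ} (hK : M + R ≤ K * L) {x : PSpace n} (hx : |zc x| ≤ R) :
    per L ψ x = ∑ k ∈ Finset.Icc (-(K : ℤ)) K, ψ (shift L k x) := by
  refine finsum_eq_sum_of_support_subset _ fun k hk => ?_
  have h1 := abs_le.1 (hψ _ hk)
  have h2 := abs_le.1 hx
  rw [zc_shift] at h1
  have a : (k : ℝ) ≤ K := by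
    by_contra hc; push Not at hc; nlinarith [mul_lt_mul_of_pos_right hc hL]
  have b : -(K : ℝ) ≤ k := by
    by_contra hc; push Not at hc; nlinarith [mul_lt_mul_of_pos_right hc hL]
  simp only [Finset.coe_Icc, Set.mem_Icc]
  exact ⟨by exact_mod_cast b, by exact_mod_cast a⟩

theorem exists_natCast_mul_ge (hL : 0 < L) (r : ℝ) : ∃ K : ℕ, r ≤ K * L := by
  obtain ⟨K, hK⟩ := exists_nat_ge (r / L)
  exact ⟨K, by rwa [div_le_iff₀ hL] at hK⟩

theorem exists_zc_bound_of_isBounded {s : Set (PSpace n)} (hs : Bornology.IsBounded s) :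
    ∃ M, ∀ x ∈ s, |zc x| ≤ M := by
  obtain ⟨M, hM⟩ := hs.exists_norm_le
  exact ⟨M, fun x hx => (abs_coord_le x _).trans (hM x hx)⟩

theorem exists_zc_bound {ψ : PSpace n → F} (hψ : HasCompactSupport ψ) :
    ∃ M, ∀ x, ψ x ≠ 0 → |zc x| ≤ M := by
  obtain ⟨M, hM⟩ := exists_zc_bound_of_isBounded hψ.isCompact.isBounded
  exact ⟨M, fun x hx => hM x (subset_tsupport _ hx)⟩

theorem per_eventuallyEq (hL : 0 < L) {ψ : PSpace n → F} {M : ℝ}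
    (hψ : ∀ x, ψ x ≠ 0 → |zc x| ≤ M) (x₀ : PSpace n) :
    ∃ K : ℕ, per L ψ =ᶠ[𝓝 x₀] fun x => ∑ k ∈ Finset.Icc (-(K : ℤ)) K, ψ (shift L k x) := by
  obtain ⟨K, hK⟩ := exists_natCast_mul_ge hL (M + (|zc x₀| + 1))
  refine ⟨K, ?_⟩
  have : ∀ᶠ x in 𝓝 x₀, |zc x| < |zc x₀| + 1 :=
    (continuous_zc.abs.tendsto x₀).eventually (gt_mem_nhds (by linarith))
  exact this.mono fun x hx => per_eq_sum hL hψ hK hx.le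

theorem contDiff_per (hL : 0 < L) {ψ : PSpace n → F} (hs : ContDiff ℝ ∞ ψ) {M : ℝ}
    (hψ : ∀ x, ψ x ≠ 0 → |zc x| ≤ M) : ContDiff ℝ ∞ (per L ψ) := by
  refine contDiff_iff_contDiffAt.2 fun x => ?_
  obtain ⟨K, hK⟩ := per_eventuallyEq hL hψ x
  refine ContDiffAt.congr_of_eventuallyEq ?_ hK
  exact ContDiffAt.sum fun k _ => (hs.comp (contDiff_shift L k)).contDiffAt

theorem pd_comp_shift (ψ : PSpace n → F) (j : Fin (n + 1)) (k : ℤ) (x : PSpace n) :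
    pd j (fun y => ψ (shift L k y)) x = pd j ψ (shift L k x) := by
  simp [pd, shift, fderiv_comp_add_right]

theorem pd_ne_zero_bound {ψ : PSpace n → F} {M : ℝ} (hψ : ∀ x, ψ x ≠ 0 → |zc x| ≤ M)
    (j : Fin (n + 1)) : ∀ x, pd j ψ x ≠ 0 → |zc x| ≤ M := by
  intro x hx
  have hx' : x ∈ tsupport ψ := by
    refine tsupport_fderiv_subset ℝ (subset_tsupport _ fun h0 => hx ?_)
    simp [pd, h0]
  exact closure_minimal (fun y hy => hψ y hy)
    (isClosed_le continuous_zc.abs continuous_const) hx'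

theorem pd_per (hL : 0 < L) {ψ : PSpace n → F} (hs : Differentiable ℝ ψ) {M : ℝ}
    (hψ : ∀ x, ψ x ≠ 0 → |zc x| ≤ M) (j : Fin (n + 1)) :
    pd j (per L ψ) = per L (pd j ψ) := by
  funext x
  obtain ⟨K, hK⟩ := exists_natCast_mul_ge hL (M + (|zc x| + 1))
  have h1 : per L ψ =ᶠ[𝓝 x] fun x => ∑ k ∈ Finset.Icc (-(K : ℤ)) K, ψ (shift L k x) := by
    have : ∀ᶠ y in 𝓝 x, |zc y| < |zc x| + 1 :=
      (continuous_zc.abs.tendsto x).eventually (gt_mem_nhds (by linarith))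
    exact this.mono fun x hx => per_eq_sum hL hψ hK hx.le
  rw [per_eq_sum hL (pd_ne_zero_bound hψ j) hK (by linarith : |zc x| ≤ |zc x| + 1), pd,
    h1.fderiv_eq, fderiv_fun_sum, sum_apply]
  · exact Finset.sum_congr rfl fun k _ => pd_comp_shift ψ j k x
  · intro k _
    exact (hs _).comp x ((contDiff_shift L k).differentiable (by simp) x)

theorem isPerTest_per (hL : 0 < L) {Λ : Set (PSpace n)} (h : ∀ x, x + L • ez ∈ Λ ↔ x ∈ Λ)
    {ψ : PSpace n → F} (hψ : IsTest Λ ψ) : IsPerTest L Λ (per L ψ) := by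
  obtain ⟨M, hM⟩ := exists_zc_bound hψ.compact
  refine ⟨contDiff_per hL hψ.smooth hM, per_periodic ψ, fun x hx => ?_⟩
  by_contra hxΛ
  refine (notMem_tsupport_iff_eventuallyEq.2 ?_) hx
  obtain ⟨K, hK⟩ := per_eventuallyEq hL hM x
  have : ∀ k ∈ Finset.Icc (-(K : ℤ)) K, ∀ᶠ y in 𝓝 x, ψ (shift L k y) = 0 := by
    intro k _
    have hk : shift L k x ∉ tsupport ψ := fun hc => hxΛ ((shift_mem_iff h k x).1 (hψ.supp hc))
    exact ((contDiff_shift L k).continuous.tendsto x).eventually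
      (notMem_tsupport_iff_eventuallyEq.1 hk)
  filter_upwards [hK, (Finset.eventually_all _).2 this] with y hy hy0
  rw [hy]
  exact Finset.sum_eq_zero hy0

/-- Unfolding: an integral over the pipe of a pairing with a periodic function is an integral over
the cell. -/
theorem integral_pairing_eq_cell {G H : Type*} [NormedAddCommGroup G] [NormedSpace ℝ G]
    [NormedAddCommGroup H] [NormedSpace ℝ H] (B : G →L[ℝ] F →L[ℝ] H) (hL : 0 < L)
    {Λ : Set (PSpace n)} (hΛ : IsOpen Λ) (h : ∀ x, x + L • ez ∈ Λ ↔ x ∈ Λ) {u : PSpace n → F}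
    (hu : LocallyIntegrableOn u Λ) (hup : ∀ x ∈ Λ, u (x + L • ez) = u x) {g : PSpace n → G}
    (hg : Continuous g) (hc : HasCompactSupport g) (hs : tsupport g ⊆ Λ) :
    ∫ x in Λ, B (g x) (u x) = ∫ x in cell L Λ, B (per L g x) (u x) := by
  have hInt := integrable_pairing B hu hg hc hs
  obtain ⟨M, hM⟩ := exists_zc_bound hc
  obtain ⟨K, hK⟩ := exists_natCast_mul_ge hL (M + L)
  rw [volume_restrict_eq_sum hL hΛ h] at hInt
  have h1 := hasSum_integral_measure hInt
  rw [← volume_restrict_eq_sum hL hΛ h] at h1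
  have hz : ∀ x ∈ cell L Λ, |zc x| ≤ L := fun x hx => by
    rw [abs_of_pos hx.2.1]; exact hx.2.2.le
  have h2 : ∀ k : ℤ, ∫ x, B (g x) (u x) ∂(volume.restrict (cell L Λ)).map (shift L k) =
      ∫ x in cell L Λ, B (g (shift L k x)) (u x) := fun k => by
    rw [(measurableEmbedding_shift L k).integral_map]
    refine setIntegral_congr_fun (isOpen_cell hΛ).measurableSet fun x hx => ?_
    simp only [apply_shift h hup k x hx.1]
  have hi : ∀ k : ℤ, Integrable (fun x => B (g (shift L k x)) (u x))
      (volume.restrict (cell L Λ)) := fun k => by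
    have := (measurableEmbedding_shift L k).integrable_map_iff.1
      (hInt.mono_measure (Measure.le_sum _ k))
    refine this.congr ?_
    filter_upwards [ae_restrict_mem (isOpen_cell hΛ).measurableSet] with x hx
    simp only [Function.comp, apply_shift h hup k x hx.1]
  simp only [h2] at h1
  have h3 : ∀ k ∉ Finset.Icc (-(K : ℤ)) K,
      ∫ x in cell L Λ, B (g (shift L k x)) (u x) = 0 := fun k hk => by
    refine setIntegral_eq_zero_of_forall_eq_zero fun x hx => ?_
    suffices g (shift L k x) = 0 by simp [this]
    by_contra h0
    have a1 := abs_le.1 (hM _ h0)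
    have a2 := abs_le.1 (hz x hx)
    rw [zc_shift] at a1
    refine hk (Finset.mem_Icc.2 ⟨?_, ?_⟩)
    · by_contra hc
      push Not at hc
      have : (k : ℝ) < -(K : ℝ) := by exact_mod_cast hc
      nlinarith [mul_lt_mul_of_pos_right this hL]
    · by_contra hc
      push Not at hc
      have : (K : ℝ) < k := by exact_mod_cast hc
      nlinarith [mul_lt_mul_of_pos_right this hL]
  -- The integral over the pipe is the sum over all cells; each summand, moved back to the basic
  -- cell, involves a translate of `g` and the unchanged `u`, and only finitely many are nonzero.
  rw [h1.unique (hasSum_sum_of_ne_finset_zero h3), ← integral_finsetSum _ fun k _ => hi k]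
  refine setIntegral_congr_fun (isOpen_cell hΛ).measurableSet fun x hx => ?_
  simp only [per_eq_sum hL hM hK (hz x hx), map_sum, sum_apply]

/-- Only 2K + 1 translates reach the cell, and each has norm there at most that of `f`. -/
theorem eLpNorm_per_le (hL : 0 < L) {Λ : Set (PSpace n)} (hΛ : IsOpen Λ) {f : PSpace n → F}
    (hf : AEStronglyMeasurable f) {M : ℝ} (hM : ∀ x, f x ≠ 0 → |zc x| ≤ M) {K : ℕ}
    (hK : M + L ≤ K * L) :
    eLpNorm (per L f) 2 (volume.restrict (cell L Λ)) ≤ (2 * K + 1) * eLpNorm f 2 volume := by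
  have e : per L f =ᵐ[volume.restrict (cell L Λ)]
      ∑ k ∈ Finset.Icc (-(K : ℤ)) K, fun x => f (shift L k x) := by
    filter_upwards [ae_restrict_mem (isOpen_cell hΛ).measurableSet] with x hx
    rw [per_eq_sum hL hM hK (by rw [abs_of_pos hx.2.1]; exact hx.2.2.le), Finset.sum_apply]
  rw [eLpNorm_congr_ae e]
  have hm : ∀ k, AEStronglyMeasurable (fun x => f (shift L k x)) := fun k =>
    hf.comp_measurePreserving (measurePreserving_shift L k)
  refine (eLpNorm_sum_le (fun k _ => (hm k).restrict) (by norm_num)).trans ?_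
  have : ∀ k ∈ Finset.Icc (-(K : ℤ)) K,
      eLpNorm (fun x => f (shift L k x)) 2 (volume.restrict (cell L Λ)) ≤ eLpNorm f 2 volume := by
    intro k _
    refine (eLpNorm_mono_measure _ Measure.restrict_le_self).trans ?_
    exact (eLpNorm_comp_measurePreserving hf (measurePreserving_shift L k)).le
  refine (Finset.sum_le_card_nsmul _ _ _ this).trans ?_
  rw [nsmul_eq_mul, Int.card_Icc]
  gcongr
  have : ((K : ℤ) + 1 - -(K : ℤ)).toNat = 2 * K + 1 := by omega
  rw [this]
  push_cast
  rfl

end Per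

/-! ### Periodic extension of functions on the cell -/

/-- Translation of a point by an integer number of periods into `0 ≤ z < L`. -/
def fold (L : ℝ) (x : PSpace n) : PSpace n := shift L (-⌊zc x / L⌋) x

/-- The periodic function which agrees with `f` on the cell. -/
def perExt {F : Type*} (L : ℝ) (f : PSpace n → F) (x : PSpace n) : F := f (fold L x)

theorem fold_of_mem_cell {L : ℝ} (hL : 0 < L) {Λ : Set (PSpace n)} {x : PSpace n}
    (hx : x ∈ cell L Λ) : fold L x = x := by
  have : ⌊zc x / L⌋ = 0 := by
    rw [Int.floor_eq_zero_iff]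
    exact ⟨div_nonneg hx.2.1.le hL.le, (div_lt_one hL).2 hx.2.2⟩
  simp [fold, this]

theorem perExt_periodic {F : Type*} {L : ℝ} (hL : 0 < L) (f : PSpace n → F) (x : PSpace n) :
    perExt L f (x + L • ez) = perExt L f x := by
  have : fold L (x + L • ez) = fold L x := by
    rw [← shift_one, fold, fold, shift_shift, zc_shift, Int.cast_one, one_mul, add_div,
      div_self hL.ne', Int.floor_add_one]
    congr 1
    ring
  rw [perExt, perExt, this]

theorem perExt_ae_eq {F : Type*} {L : ℝ} (hL : 0 < L) {Λ : Set (PSpace n)} (hΛ : IsOpen Λ)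
    (f : PSpace n → F) : perExt L f =ᵐ[volume.restrict (cell L Λ)] f := by
  filter_upwards [ae_restrict_mem (isOpen_cell hΛ).measurableSet] with x hx
  rw [perExt, fold_of_mem_cell hL hx]

section L2

variable {F : Type*} [NormedAddCommGroup F] [NormedSpace ℝ F] {L : ℝ}

/-- Up to a null set, the part of the pipe in a compact set is covered by finitely many translates
of the cell, on each of which `u` is a copy of itself. -/
theorem isL2Per_of_memLp (hL : 0 < L) {Λ : Set (PSpace n)} (hΛ : IsOpen Λ)
    (h : ∀ x, x + L • ez ∈ Λ ↔ x ∈ Λ) {u : PSpace n → F}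
    (hup : ∀ x ∈ Λ, u (x + L • ez) = u x) (hu : MemLp u 2 (volume.restrict (cell L Λ))) :
    IsL2Per L Λ u := by
  refine ⟨hup, fun K hK => ?_⟩
  have hk : ∀ k : ℤ, (fun x => u (shift L k x)) =ᵐ[volume.restrict (cell L Λ)] u := fun k => by
    filter_upwards [ae_restrict_mem (isOpen_cell hΛ).measurableSet] with x hx
    exact apply_shift h hup k x hx.1
  have hm : AEStronglyMeasurable u (volume.restrict Λ) := by
    rw [volume_restrict_eq_sum hL hΛ h, aestronglyMeasurable_sum_measure_iff]
    intro k
    rw [(measurableEmbedding_shift L k).aestronglyMeasurable_map_iff]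
    exact hu.aestronglyMeasurable.congr (hk k).symm
  have hmK := hm.mono_measure (Measure.restrict_mono (Set.inter_subset_left (t := K)) le_rfl)
  rw [memLp_two_iff_integrable_sq_norm hmK]
  have hsq := (memLp_two_iff_integrable_sq_norm hu.aestronglyMeasurable).1 hu
  have hik : ∀ k : ℤ, IntegrableOn (fun x => ‖u x‖ ^ 2) (shiftCell L Λ k) := fun k => by
    rw [IntegrableOn, ← map_shift_cell hΛ h,
      (measurableEmbedding_shift L k).integrable_map_iff]
    refine hsq.congr ?_
    filter_upwards [hk k] with x hx
    simp only [Function.comp, hx]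
  obtain ⟨M, hM⟩ := exists_zc_bound_of_isBounded hK.isBounded
  obtain ⟨N, hN⟩ := exists_natCast_mul_ge hL (M + L)
  refine (integrableOn_finset_iUnion (s := Finset.Icc (-(N : ℤ)) N).2
    fun k _ => hik k).mono_set_ae ?_
  filter_upwards [ae_exists_mem_shiftCell hL Λ] with x hx hxK
  obtain ⟨k, hkx⟩ := hx hxK.1
  have a1 := abs_le.1 (hM x hxK.2)
  have b1 := hkx.2.1
  have b2 := hkx.2.2
  refine Set.mem_iUnion₂.2 ⟨k, Finset.mem_Icc.2 ⟨?_, ?_⟩, hkx⟩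
  · by_contra hc
    push Not at hc
    have : (k : ℝ) < -(N : ℝ) := by exact_mod_cast hc
    nlinarith [mul_lt_mul_of_pos_right this hL]
  · by_contra hc
    push Not at hc
    have : (N : ℝ) < k := by exact_mod_cast hc
    nlinarith [mul_lt_mul_of_pos_right this hL]

theorem isL2Per_perExt (hL : 0 < L) {Λ : Set (PSpace n)} (hΛ : IsOpen Λ)
    (h : ∀ x, x + L • ez ∈ Λ ↔ x ∈ Λ) {u : PSpace n → F}
    (hu : MemLp u 2 (volume.restrict (cell L Λ))) : IsL2Per L Λ (perExt L u) :=
  isL2Per_of_memLp hL hΛ h (fun x _ => perExt_periodic hL u x)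
    (hu.ae_eq (perExt_ae_eq hL hΛ u).symm)

theorem IsL2Per.memLp_cell {Λ : Set (PSpace n)} (hb : Bornology.IsBounded (cell L Λ))
    {u : PSpace n → F} (hu : IsL2Per L Λ u) : MemLp u 2 (volume.restrict (cell L Λ)) := by
  refine (hu.memLp _ hb.isCompact_closure).mono_measure (Measure.restrict_mono ?_ le_rfl)
  exact fun x hx => ⟨hx.1, subset_closure hx⟩

end L2

end Pipe

end

noncomputable section

namespace Pipe

open scoped NNReal

variable {n : ℕ}

/-! ### The weak gradient -/

section Weak

variable {F : Type*} [NormedAddCommGroup F] [NormedSpace ℝ F] {L : ℝ} {Λ : Set (PSpace n)}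

theorem IsTest.setIntegral_eq {ψ : PSpace n → ℝ} (hψ : IsTest Λ ψ) (u : PSpace n → F) :
    ∫ x in Λ, ψ x • u x = ∫ x, ψ x • u x := by
  refine setIntegral_eq_integral_of_forall_compl_eq_zero fun x hx => ?_
  rw [image_eq_zero_of_notMem_tsupport fun h => hx (hψ.supp h), zero_smul]

/-- The fundamental lemma of the calculus of variations. It makes the arbitrary choice in `weakGrad`
harmless. -/
theorem HasWeakGrad.ae_eq [CompleteSpace F] (hΛ : IsOpen Λ) {u : PSpace n → F}
    {G H : Fin (n + 1) → PSpace n → F} (hG : HasWeakGrad Λ u G) (hH : HasWeakGrad Λ u H)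
    (j : Fin (n + 1)) : G j =ᵐ[volume.restrict Λ] H j := by
  have h := hΛ.ae_eq_zero_of_integral_contDiff_smul_eq_zero (μ := volume)
    (f := fun x => G j x - H j x) ((hG.locInt_grad j).sub (hH.locInt_grad j))
    (fun ψ h1 h2 h3 => by
      have hψ : IsTest Λ ψ := ⟨h1, h2, h3⟩
      rw [← hψ.setIntegral_eq]
      simp only [smul_sub]
      rw [integral_sub (hψ.integrable_smul (hG.locInt_grad j))
        (hψ.integrable_smul (hH.locInt_grad j)), sub_eq_zero, ← neg_inj, ← hG.parts j ψ hψ,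
        hH.parts j ψ hψ])
  rw [EventuallyEq, ae_restrict_iff' hΛ.measurableSet]
  exact h.mono fun x hx hxΛ => sub_eq_zero.1 (hx hxΛ)

theorem HasWeakGrad.weakGrad {u : PSpace n → F} {G : Fin (n + 1) → PSpace n → F}
    (hG : HasWeakGrad Λ u G) : HasWeakGrad Λ u (weakGrad Λ u) := by
  have h : ∃ G, HasWeakGrad Λ u G := ⟨G, hG⟩
  rw [Pipe.weakGrad, dif_pos h]
  exact h.choose_spec

theorem HasWeakGrad.weakGrad_ae_eq [CompleteSpace F] (hΛ : IsOpen Λ) {u : PSpace n → F}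
    {G : Fin (n + 1) → PSpace n → F} (hG : HasWeakGrad Λ u G) (j : Fin (n + 1)) :
    Pipe.weakGrad Λ u j =ᵐ[volume.restrict Λ] G j :=
  hG.weakGrad.ae_eq hΛ hG j

theorem IsPerTest.continuous_pd {φ : PSpace n → F} (hφ : IsPerTest L Λ φ) (j : Fin (n + 1)) :
    Continuous (pd j φ) :=
  (hφ.smooth.continuous_fderiv (by simp)).clm_apply continuous_const

theorem IsPerTest.pd_periodic {φ : PSpace n → F} (hφ : IsPerTest L Λ φ) (j : Fin (n + 1))
    (x : PSpace n) : pd j φ (x + L • ez) = pd j φ x := by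
  have : (fun y => φ (y + L • ez)) = φ := funext hφ.periodic
  rw [pd, ← fderiv_comp_add_right, this, pd]

theorem IsPerTest.hasWeakGrad {φ : PSpace n → F} (hφ : IsPerTest L Λ φ) :
    HasWeakGrad Λ φ fun j => pd j φ := by
  have h1 : LocallyIntegrableOn φ Λ := hφ.smooth.continuous.locallyIntegrable.locallyIntegrableOn _
  have h2 : ∀ j, LocallyIntegrableOn (pd j φ) Λ := fun j =>
    (hφ.continuous_pd j).locallyIntegrable.locallyIntegrableOn _
  refine ⟨h1, h2, fun j ψ hψ => ?_⟩
  have hz : ∀ x ∉ Λ, ψ x = 0 := fun x hx =>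
    image_eq_zero_of_notMem_tsupport fun h => hx (hψ.supp h)
  have hcψ := hψ.smooth.continuous
  have hcd := hψ.continuous_fderiv
  have hdz : ∀ x ∉ Λ, pd j ψ x = 0 := fun x hx => by
    rw [pd, image_eq_zero_of_notMem_tsupport fun h => hx (hψ.fderiv_tsupport h)]
    simp
  rw [hψ.setIntegral_eq, setIntegral_eq_integral_of_forall_compl_eq_zero
    (fun x hx => by rw [hdz x hx, zero_smul])]
  have e := integral_smul_fderiv_eq_neg_fderiv_smul_of_integrable (μ := volume) (f := ψ)
    (g := φ) (v := bvec j) ?_ ?_ ?_ (fun x _ => hψ.smooth.differentiable (by simp) x)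
    (fun x _ => hφ.smooth.differentiable (by simp) x)
  · rw [eq_neg_iff_add_eq_zero, add_comm, ← eq_neg_iff_add_eq_zero]
    exact e
  · refine Continuous.integrable_of_hasCompactSupport ?_ ?_
    · exact (hcd.clm_apply continuous_const).smul hφ.smooth.continuous
    · refine HasCompactSupport.smul_right (f := fun x => fderiv ℝ ψ x (bvec j)) ?_
      exact hψ.compact.fderiv_apply ℝ (bvec j)
  · exact (hcψ.smul (hφ.continuous_pd j)).integrable_of_hasCompactSupport
      (hψ.compact.smul_right (f' := pd j φ))
  · exact (hcψ.smul hφ.smooth.continuous).integrable_of_hasCompactSupport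
      (hψ.compact.smul_right (f' := φ))

theorem isL2Per_of_continuous {u : PSpace n → F} (hu : Continuous u)
    (hp : ∀ x, u (x + L • ez) = u x) : IsL2Per L Λ u := by
  refine ⟨fun x _ => hp x, fun K hK => ?_⟩
  have : IsFiniteMeasure (volume.restrict (Λ ∩ K)) := ⟨by
    rw [Measure.restrict_apply_univ]
    exact (measure_mono Set.inter_subset_right).trans_lt hK.measure_lt_top⟩
  obtain ⟨C, hC⟩ := hK.exists_bound_of_continuousOn hu.continuousOn
  have hK' : MemLp u 2 (volume.restrict K) := by
    have : IsFiniteMeasure (volume.restrict K) := ⟨by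
      rw [Measure.restrict_apply_univ]; exact hK.measure_lt_top⟩
    exact MemLp.of_bound hu.aestronglyMeasurable C
      ((ae_restrict_iff' hK.measurableSet).2 (Eventually.of_forall hC))
  exact hK'.mono_measure (Measure.restrict_mono Set.inter_subset_right le_rfl)

theorem IsPerTest.isL2Per {φ : PSpace n → F} (hφ : IsPerTest L Λ φ) : IsL2Per L Λ φ :=
  isL2Per_of_continuous hφ.smooth.continuous hφ.periodic

theorem IsPerTest.isL2Per_pd {φ : PSpace n → F} (hφ : IsPerTest L Λ φ) (j : Fin (n + 1)) :
    IsL2Per L Λ (pd j φ) :=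
  isL2Per_of_continuous (hφ.continuous_pd j) (hφ.pd_periodic j)

theorem IsPerTest.mem_H10 {φ : PSpace n → PSpace n} (hφ : IsPerTest L Λ φ) : φ ∈ H10 L Λ :=
  ⟨hφ.isL2Per, fun j => pd j φ, hφ.isL2Per_pd, hφ.hasWeakGrad, fun ε _ =>
    ⟨φ, hφ, by simp, fun j => by simp⟩⟩

/-! ### The Poincaré inequality -/

theorem eLpNorm_two_sq {α : Type*} [MeasurableSpace α] {μ : Measure α} (f : α → F) :
    eLpNorm f 2 μ ^ 2 = ∫⁻ x, ‖f x‖ₑ ^ 2 ∂μ := by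
  have := eLpNorm_nnreal_pow_eq_lintegral (μ := μ) (f := f) (p := 2) (by norm_num)
  simpa using this

theorem lintegral_enorm_sq_le {α : Type*} [MeasurableSpace α] {μ : Measure α} {f : α → F}
    (hf : AEStronglyMeasurable f μ) :
    (∫⁻ x, ‖f x‖ₑ ∂μ) ^ 2 ≤ μ Set.univ * ∫⁻ x, ‖f x‖ₑ ^ 2 ∂μ := by
  have h := eLpNorm_le_eLpNorm_mul_rpow_measure_univ (p := 1) (q := 2) (by norm_num) hf
  rw [eLpNorm_one_eq_lintegral_enorm] at h
  refine (pow_le_pow_left' h 2).trans ?_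
  rw [mul_pow, eLpNorm_two_sq, mul_comm]
  gcongr
  rw [← ENNReal.rpow_natCast, ← ENNReal.rpow_mul]
  norm_num

/-- The Poincaré inequality for periodic test functions. -/
theorem exists_poincare_const [CompleteSpace F] (hΛ : IsOpen Λ)
    (hb : Bornology.IsBounded (cell L Λ)) {i : Fin (n + 1)} (hi : i ≠ Fin.last n) :
    ∃ C : ℝ≥0, ∀ φ : PSpace n → F, IsPerTest L Λ φ →
      eLpNorm φ 2 (volume.restrict (cell L Λ)) ≤
        C * eLpNorm (pd i φ) 2 (volume.restrict (cell L Λ)) := by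
  obtain ⟨R, hR⟩ := hb.exists_norm_le
  -- Moving a point of the cell by `T` along the `i`-th axis leaves the pipe: z does not change, so
  -- otherwise both points would be in the cell, of radius at most `R`.
  set T : ℝ := 2 * |R| + 1 with hT
  have hT0 : 0 < T := by positivity
  refine ⟨T.toNNReal, fun φ hφ => ?_⟩
  set I : Measure ℝ := volume.restrict (Set.Ioc (-T) 0) with hI
  have hIu : I Set.univ = ENNReal.ofReal T := by
    rw [hI, Measure.restrict_apply_univ, Real.volume_Ioc]; simp
  have hz : ∀ (x : PSpace n) (t : ℝ), zc (x + t • bvec i) = zc x := fun x t => by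
    simp [zc, hi.symm]
  have h0 : ∀ x ∉ Λ, φ x = 0 := fun x hx =>
    image_eq_zero_of_notMem_tsupport fun h => hx (hφ.supp h)
  have hd0 : ∀ x ∉ Λ, pd i φ x = 0 := fun x hx => by
    rw [pd, image_eq_zero_of_notMem_tsupport fun h =>
      hx (hφ.supp (tsupport_fderiv_subset ℝ h))]
    simp
  have hcont : ∀ x : PSpace n, Continuous fun t : ℝ => pd i φ (x + t • bvec i) := fun x =>
    (hφ.continuous_pd i).comp (by fun_prop)
  have hpt : ∀ x ∈ cell L Λ, ‖φ x‖ₑ ^ 2 ≤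
      ENNReal.ofReal T * ∫⁻ t, ‖pd i φ (x + t • bvec i)‖ₑ ^ 2 ∂I := by
    intro x hx
    have hout : φ (x + (-T) • bvec i) = 0 := by
      refine h0 _ fun hmem => ?_
      have hc : x + (-T) • bvec i ∈ cell L Λ := ⟨hmem, by rw [hz]; exact hx.2.1, by
        rw [hz]; exact hx.2.2⟩
      have a1 := (abs_le.1 ((abs_coord_le _ i).trans (hR _ hc))).1
      have a2 := (abs_le.1 ((abs_coord_le _ i).trans (hR _ hx))).2
      have a3 : (x + (-T) • bvec i : PSpace n) i = x i - T := by simp [sub_eq_add_neg]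
      rw [a3] at a1
      have := le_abs_self R
      linarith
    have hft := intervalIntegral.integral_eq_sub_of_hasDerivAt (a := -T) (b := 0)
      (f := fun t : ℝ => φ (x + t • bvec i)) (f' := fun t => pd i φ (x + t • bvec i))
      (fun t _ => by
        have h1 : HasDerivAt (fun t : ℝ => x + t • bvec i) (bvec i) t := by
          simpa using ((hasDerivAt_id t).smul_const (bvec i)).const_add x
        exact (hφ.smooth.differentiable (by simp) _).hasFDerivAt.comp_hasDerivAt t h1)
      ((hcont x).intervalIntegrable _ _)
    rw [hout, sub_zero, zero_smul, add_zero,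
      intervalIntegral.integral_of_le (by linarith)] at hft
    rw [← hft]
    refine (pow_le_pow_left' (enorm_integral_le_lintegral_enorm _) 2).trans ?_
    rw [← hIu]
    exact lintegral_enorm_sq_le (hcont x).aestronglyMeasurable
  have hmeas : Measurable fun p : PSpace n × ℝ => ‖pd i φ (p.1 + p.2 • bvec i)‖ₑ ^ 2 := by
    have : Continuous fun p : PSpace n × ℝ => pd i φ (p.1 + p.2 • bvec i) :=
      (hφ.continuous_pd i).comp (by fun_prop)
    exact (this.enorm.measurable).pow_const 2
  set S : Set (PSpace n) := {x | 0 < zc x ∧ zc x < L} with hS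
  have hSm : MeasurableSet S := ((isOpen_lt continuous_const continuous_zc).inter
    (isOpen_lt continuous_zc continuous_const)).measurableSet
  -- The translated cell may leave the pipe, but not the slab `S`; the slab is invariant, and in it
  -- the derivative vanishes outside the pipe.
  have htrans : ∀ t : ℝ, ∫⁻ x in cell L Λ, ‖pd i φ (x + t • bvec i)‖ₑ ^ 2 ≤
      ∫⁻ x in cell L Λ, ‖pd i φ x‖ₑ ^ 2 := by
    intro t
    calc ∫⁻ x in cell L Λ, ‖pd i φ (x + t • bvec i)‖ₑ ^ 2
        ≤ ∫⁻ x in S, ‖pd i φ (x + t • bvec i)‖ₑ ^ 2 :=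
          lintegral_mono_set fun x hx => hx.2
      _ = ∫⁻ x in S, ‖pd i φ x‖ₑ ^ 2 := by
          have hpre : (fun x : PSpace n => x + t • bvec i) ⁻¹' S = S := by
            ext x; simp [hS, hz]
          have := (measurePreserving_add_right (volume : Measure (PSpace n))
            (t • bvec i)).setLIntegral_comp_preimage_emb (measurableEmbedding_addRight _)
            (fun x => ‖pd i φ x‖ₑ ^ 2) S
          rwa [hpre] at this
      _ = ∫⁻ x in cell L Λ, ‖pd i φ x‖ₑ ^ 2 := by
          rw [← lintegral_indicator hSm, ← lintegral_indicator (isOpen_cell hΛ).measurableSet]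
          congr 1
          funext x
          by_cases hx : x ∈ Λ
          · by_cases hxS : x ∈ S
            · have hc : x ∈ cell L Λ := ⟨hx, hxS⟩
              rw [Set.indicator_of_mem hxS, Set.indicator_of_mem hc]
            · have hc : x ∉ cell L Λ := fun h => hxS h.2
              rw [Set.indicator_of_notMem hxS, Set.indicator_of_notMem hc]
          · simp [Set.indicator, hd0 x hx]
  have key : eLpNorm φ 2 (volume.restrict (cell L Λ)) ^ 2 ≤
      ((T.toNNReal : ℝ≥0∞) * eLpNorm (pd i φ) 2 (volume.restrict (cell L Λ))) ^ 2 := by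
    rw [mul_pow, eLpNorm_two_sq, eLpNorm_two_sq]
    -- One factor T comes from Cauchy–Schwarz on each segment, the other from integrating over the
    -- translation parameter after exchanging the integrals.
    calc ∫⁻ x in cell L Λ, ‖φ x‖ₑ ^ 2
        ≤ ∫⁻ x in cell L Λ, ENNReal.ofReal T * ∫⁻ t, ‖pd i φ (x + t • bvec i)‖ₑ ^ 2 ∂I :=
          setLIntegral_mono' (isOpen_cell hΛ).measurableSet hpt
      _ = ENNReal.ofReal T * ∫⁻ x in cell L Λ, ∫⁻ t, ‖pd i φ (x + t • bvec i)‖ₑ ^ 2 ∂I :=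
          lintegral_const_mul' _ _ ENNReal.ofReal_ne_top
      _ = ENNReal.ofReal T * ∫⁻ t, (∫⁻ x in cell L Λ, ‖pd i φ (x + t • bvec i)‖ₑ ^ 2) ∂I := by
          rw [lintegral_lintegral_swap hmeas.aemeasurable]
      _ ≤ ENNReal.ofReal T * ∫⁻ _t, (∫⁻ x in cell L Λ, ‖pd i φ x‖ₑ ^ 2) ∂I := by
          exact mul_le_mul_right (lintegral_mono htrans) _
      _ = _ := by
          rw [lintegral_const, hIu, mul_comm (∫⁻ x in cell L Λ, _), ← mul_assoc, sq]
          rfl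
  exact (ENNReal.pow_le_pow_left_iff two_ne_zero).1 key

/-! ### Limits of weak gradients -/

theorem tendsto_integral_smul {α : Type*} [MeasurableSpace α] {μ : Measure α} [IsFiniteMeasure μ]
    {a : α → ℝ} (ha : AEStronglyMeasurable a μ) {C : ℝ≥0} (hC : ∀ᵐ x ∂μ, ‖a x‖ ≤ C)
    {f : ℕ → α → F} {g : α → F} (hf : ∀ k, MemLp (f k) 2 μ) (hg : MemLp g 2 μ)
    (h : Tendsto (fun k => eLpNorm (fun x => g x - f k x) 2 μ) atTop (𝓝 0)) :
    Tendsto (fun k => ∫ x, a x • f k x ∂μ) atTop (𝓝 (∫ x, a x • g x ∂μ)) := by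
  have hInt : ∀ w : α → F, MemLp w 2 μ → Integrable (fun x => a x • w x) μ := fun w hw => by
    refine ((hw.integrable (by norm_num)).norm.const_mul (C : ℝ)).mono'
      (ha.smul hw.aestronglyMeasurable) ?_
    filter_upwards [hC] with x hx
    rw [norm_smul]
    gcongr
  refine tendsto_integral_of_L1' _ (hInt g hg).aestronglyMeasurable
    (Eventually.of_forall fun k => hInt _ (hf k)) ?_
  have hlim : Tendsto (fun k => (C : ℝ≥0∞) * (eLpNorm (fun x => g x - f k x) 2 μ *
      μ Set.univ ^ (1 / (1 : ℝ≥0∞).toReal - 1 / (2 : ℝ≥0∞).toReal))) atTop (𝓝 0) := by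
    have h1 := ENNReal.Tendsto.mul_const (b := μ Set.univ ^ (1 / (1 : ℝ≥0∞).toReal -
      1 / (2 : ℝ≥0∞).toReal)) h (Or.inr (ENNReal.rpow_ne_top_of_nonneg (by norm_num) (by simp)))
    have h2 := ENNReal.Tendsto.const_mul (a := (C : ℝ≥0∞)) h1 (Or.inr ENNReal.coe_ne_top)
    simpa using h2
  refine tendsto_of_tendsto_of_tendsto_of_le_of_le tendsto_const_nhds hlim
    (fun _ => zero_le) fun k => ?_
  refine (eLpNorm_le_nnreal_smul_eLpNorm_of_ae_le_mul
    (g := fun x => g x - f k x) (c := C) ?_ 1).trans ?_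
  · filter_upwards [hC] with x hx
    simp only [Pi.sub_apply, ← smul_sub]
    rw [← NNReal.coe_le_coe, NNReal.coe_mul, coe_nnnorm, coe_nnnorm, norm_smul, norm_sub_rev]
    gcongr
  · rw [ENNReal.smul_def, smul_eq_mul]
    gcongr
    exact eLpNorm_le_eLpNorm_mul_rpow_measure_univ (by norm_num)
      (hg.aestronglyMeasurable.sub (hf k).aestronglyMeasurable)

theorem exists_bound_per {G : Type*} [NormedAddCommGroup G] [NormedSpace ℝ G] (hL : 0 < L)
    {g : PSpace n → G} (hg : Continuous g)
    (hc : HasCompactSupport g) : ∃ C : ℝ≥0, ∀ x ∈ cell L Λ, ‖per L g x‖ ≤ C := by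
  obtain ⟨C, hC⟩ := hg.bounded_above_of_compact_support hc
  obtain ⟨M, hM⟩ := exists_zc_bound hc
  obtain ⟨K, hK⟩ := exists_natCast_mul_ge hL (M + L)
  refine ⟨((Finset.Icc (-(K : ℤ)) K).card • C).toNNReal, fun x hx => ?_⟩
  rw [per_eq_sum hL hM hK (by rw [abs_of_pos hx.2.1]; exact hx.2.2.le)]
  refine (norm_sum_le _ _).trans ((Finset.sum_le_card_nsmul _ _ C fun k _ => hC _).trans ?_)
  exact Real.le_coe_toNNReal _

theorem aestronglyMeasurable_per_cell {G : Type*} [NormedAddCommGroup G] [NormedSpace ℝ G]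
    (hL : 0 < L) (hΛ : IsOpen Λ) {g : PSpace n → G} (hg : AEStronglyMeasurable g) {M : ℝ}
    (hM : ∀ x, g x ≠ 0 → |zc x| ≤ M) :
    AEStronglyMeasurable (per L g) (volume.restrict (cell L Λ)) := by
  obtain ⟨K, hK⟩ := exists_natCast_mul_ge hL (M + L)
  refine AEStronglyMeasurable.congr (f := fun x =>
    ∑ k ∈ Finset.Icc (-(K : ℤ)) K, g (shift L k x)) ?_ ?_
  · exact Finset.aestronglyMeasurable_fun_sum _ fun k _ =>
      (hg.comp_measurePreserving (measurePreserving_shift L k)).restrict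
  · filter_upwards [ae_restrict_mem (isOpen_cell hΛ).measurableSet] with x hx
    rw [per_eq_sum hL hM hK (by rw [abs_of_pos hx.2.1]; exact hx.2.2.le)]

/-- The weak gradient is closed under `L²` limits of periodic test functions. -/
theorem hasWeakGrad_of_tendsto (hL : 0 < L) (hΛ : IsOpen Λ)
    (h : ∀ x, x + L • ez ∈ Λ ↔ x ∈ Λ) (hb : Bornology.IsBounded (cell L Λ))
    {u : PSpace n → F} {G : Fin (n + 1) → PSpace n → F} (hu : IsL2Per L Λ u)
    (hG : ∀ j, IsL2Per L Λ (G j)) {φ : ℕ → PSpace n → F} (hφ : ∀ k, IsPerTest L Λ (φ k))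
    (h1 : Tendsto (fun k => eLpNorm (fun x => u x - φ k x) 2 (volume.restrict (cell L Λ)))
      atTop (𝓝 0))
    (h2 : ∀ j, Tendsto (fun k => eLpNorm (fun x => G j x - pd j (φ k) x) 2
      (volume.restrict (cell L Λ))) atTop (𝓝 0)) : HasWeakGrad Λ u G := by
  refine ⟨hu.locInt, fun j => (hG j).locInt, fun j ψ hψ => ?_⟩
  have : IsFiniteMeasure (volume.restrict (cell L Λ)) := ⟨by
    rw [Measure.restrict_apply_univ]; exact hb.measure_lt_top⟩
  -- Convergence is given only on the cell, whereas the weak gradient is tested over the whole pipe,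
  -- so the integrals are first reduced to the cell.
  have unf : ∀ (g : PSpace n → ℝ), Continuous g → HasCompactSupport g → tsupport g ⊆ Λ →
      ∀ (w : PSpace n → F), IsL2Per L Λ w →
        ∫ x in Λ, g x • w x = ∫ x in cell L Λ, per L g x • w x := fun g g1 g2 g3 w hw =>
    integral_pairing_eq_cell (ContinuousLinearMap.lsmul ℝ ℝ) hL hΛ h hw.locInt hw.periodic
      g1 g2 g3
  have lim : ∀ (g : PSpace n → ℝ), Continuous g → HasCompactSupport g → tsupport g ⊆ Λ →
      ∀ (w : PSpace n → F) (f : ℕ → PSpace n → F), IsL2Per L Λ w → (∀ k, IsL2Per L Λ (f k)) →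
        Tendsto (fun k => eLpNorm (fun x => w x - f k x) 2 (volume.restrict (cell L Λ)))
          atTop (𝓝 0) →
        Tendsto (fun k => ∫ x in Λ, g x • f k x) atTop (𝓝 (∫ x in Λ, g x • w x)) := by
    intro g g1 g2 g3 w f hw hf hlim
    obtain ⟨M, hM⟩ := exists_zc_bound g2
    obtain ⟨C, hC⟩ := exists_bound_per (Λ := Λ) hL g1 g2
    simp only [unf g g1 g2 g3 _ (hf _), unf g g1 g2 g3 _ hw]
    refine tendsto_integral_smul
      (aestronglyMeasurable_per_cell hL hΛ g1.aestronglyMeasurable hM) (C := C) ?_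
      (fun k => (hf k).memLp_cell hb) (hw.memLp_cell hb) hlim
    filter_upwards [ae_restrict_mem (isOpen_cell hΛ).measurableSet] with x hx using hC x hx
  have hd1 : Continuous (pd j ψ) := hψ.continuous_fderiv.clm_apply continuous_const
  have hd2 : HasCompactSupport (pd j ψ) := hψ.compact.fderiv_apply ℝ (bvec j)
  have hd3 : tsupport (pd j ψ) ⊆ Λ := (tsupport_fderiv_apply_subset ℝ (bvec j)).trans hψ.supp
  have e1 := lim _ hd1 hd2 hd3 u φ hu (fun k => (hφ k).isL2Per) h1
  have e2 := lim ψ hψ.smooth.continuous hψ.compact hψ.supp (G j) (fun k => pd j (φ k)) (hG j)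
    (fun k => (hφ k).isL2Per_pd j) (h2 j)
  have e3 : (fun k => ∫ x in Λ, pd j ψ x • φ k x) =
      fun k => - ∫ x in Λ, ψ x • pd j (φ k) x := funext fun k =>
    (hφ k).hasWeakGrad.parts j ψ hψ
  rw [e3] at e1
  exact tendsto_nhds_unique e1 e2.neg

end Weak

end Pipe

end

noncomputable section

namespace Pipe

open scoped NNReal

variable {n : ℕ}

/-! ### The Hilbert space of gradients -/

section Hilbert

variable {L : ℝ} {Λ : Set (PSpace n)}

/-- Square integrable tensor fields on the cell. -/
abbrev TensorL2 (L : ℝ) (Λ : Set (PSpace n)) : Type :=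
  PiLp 2 fun _ : Fin (n + 1) => Lp (PSpace n) 2 (volume.restrict (cell L Λ))

theorem H10.isL2Per {u : PSpace n → PSpace n} (hu : u ∈ H10 L Λ) : IsL2Per L Λ u := hu.1

theorem H10.hasWeakGrad {u : PSpace n → PSpace n} (hu : u ∈ H10 L Λ) :
    HasWeakGrad Λ u (weakGrad Λ u) := by
  obtain ⟨-, G, -, hG, -⟩ := hu
  exact hG.weakGrad

theorem ae_cell_of_ae {p : PSpace n → Prop} (h : ∀ᵐ x ∂volume.restrict Λ, p x) :
    ∀ᵐ x ∂volume.restrict (cell L Λ), p x :=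
  ae_mono (Measure.restrict_mono cell_subset le_rfl) h

theorem H10.memLp_weakGrad (hΛ : IsPipe L Λ) {u : PSpace n → PSpace n} (hu : u ∈ H10 L Λ)
    (j : Fin (n + 1)) : MemLp (weakGrad Λ u j) 2 (volume.restrict (cell L Λ)) := by
  obtain ⟨-, G, hG2, hG, -⟩ := hu
  have h : weakGrad Λ u j =ᵐ[volume.restrict (cell L Λ)] G j :=
    ae_cell_of_ae (hG.weakGrad_ae_eq hΛ.isOpen j)
  exact ((hG2 j).memLp_cell hΛ.cell_bounded).ae_eq h.symm

/-- The gradient as a linear map to the space of square integrable tensor fields. -/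
def gradMap (hΛ : IsPipe L Λ) : H10 L Λ →ₗ[ℝ] TensorL2 L Λ where
  toFun u := WithLp.toLp 2 fun j => (H10.memLp_weakGrad hΛ u.2 j).toLp (weakGrad Λ u j)
  map_add' u v := by
    ext1 j
    simp only [PiLp.add_apply]
    rw [← MemLp.toLp_add, MemLp.toLp_eq_toLp_iff]
    exact ae_cell_of_ae
      (((H10.hasWeakGrad u.2).add (H10.hasWeakGrad v.2)).weakGrad_ae_eq hΛ.isOpen j)
  map_smul' c u := by
    ext1 j
    simp only [PiLp.smul_apply, RingHom.id_apply]
    rw [← MemLp.toLp_const_smul, MemLp.toLp_eq_toLp_iff]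
    exact ae_cell_of_ae (((H10.hasWeakGrad u.2).smul c).weakGrad_ae_eq hΛ.isOpen j)

/-- The inclusion of `H10` into the square integrable fields on the cell. -/
def valMap (hΛ : IsPipe L Λ) :
    H10 L Λ →ₗ[ℝ] Lp (PSpace n) 2 (volume.restrict (cell L Λ)) where
  toFun u := ((H10.isL2Per u.2).memLp_cell hΛ.cell_bounded).toLp u
  map_add' u v := by rw [← MemLp.toLp_add]; rfl
  map_smul' c u := by rw [RingHom.id_apply, ← MemLp.toLp_const_smul]; rfl

theorem gradMap_ae_eq (hΛ : IsPipe L Λ) (u : H10 L Λ) (j : Fin (n + 1)) :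
    gradMap hΛ u j =ᵐ[volume.restrict (cell L Λ)] weakGrad Λ u j :=
  (H10.memLp_weakGrad hΛ u.2 j).coeFn_toLp

theorem valMap_ae_eq (hΛ : IsPipe L Λ) (u : H10 L Λ) :
    valMap hΛ u =ᵐ[volume.restrict (cell L Λ)] u :=
  ((H10.isL2Per u.2).memLp_cell hΛ.cell_bounded).coeFn_toLp

/-- All Hilbert space arguments take place in the range of `gradMap`, which avoids passing to a
quotient of H10 by the fields vanishing almost everywhere. -/
theorem inner_gradMap (hΛ : IsPipe L Λ) (u v : H10 L Λ) :
    inner ℝ (gradMap hΛ u) (gradMap hΛ v) = gradInner L Λ u v := by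
  rw [PiLp.inner_apply]
  simp only [L2.inner_def]
  rw [← integral_finsetSum _ fun j _ => L2.integrable_inner _ _]
  refine integral_congr_ae ?_
  have h1 : ∀ᵐ x ∂volume.restrict (cell L Λ), ∀ j, gradMap hΛ u j x = weakGrad Λ u j x :=
    ae_all_iff.2 (gradMap_ae_eq hΛ u)
  have h2 : ∀ᵐ x ∂volume.restrict (cell L Λ), ∀ j, gradMap hΛ v j x = weakGrad Λ v j x :=
    ae_all_iff.2 (gradMap_ae_eq hΛ v)
  filter_upwards [h1, h2] with x hx1 hx2
  simp only [hx1, hx2]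

theorem norm_gradMap (hΛ : IsPipe L Λ) (u : H10 L Λ) : ‖gradMap hΛ u‖ = gradNorm L Λ u := by
  rw [gradNorm, ← inner_gradMap hΛ, real_inner_self_eq_norm_sq, Real.sqrt_sq (norm_nonneg _)]

theorem norm_le_sum_norm {ι : Type*} [Fintype ι] {E : ι → Type*}
    [∀ i, NormedAddCommGroup (E i)] (x : PiLp 2 E) : ‖x‖ ≤ ∑ i, ‖x i‖ := by
  rw [PiLp.norm_eq_of_L2, Real.sqrt_le_left (Finset.sum_nonneg fun i _ => norm_nonneg _)]
  exact Finset.sum_sq_le_sq_sum_of_nonneg fun i _ => norm_nonneg _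

theorem gradMap_ae_eq_of_hasWeakGrad (hΛ : IsPipe L Λ) (u : H10 L Λ)
    {G : Fin (n + 1) → PSpace n → PSpace n} (hG : HasWeakGrad Λ (u : PSpace n → PSpace n) G)
    (j : Fin (n + 1)) : gradMap hΛ u j =ᵐ[volume.restrict (cell L Λ)] G j :=
  (gradMap_ae_eq hΛ u j).trans (ae_cell_of_ae (hG.weakGrad_ae_eq hΛ.isOpen j))

/-- Periodic test functions are dense. -/
theorem exists_isPerTest_near (hΛ : IsPipe L Λ) (u : H10 L Λ) {ε : ℝ} (hε : 0 < ε) :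
    ∃ φ : H10 L Λ, IsPerTest L Λ (φ : PSpace n → PSpace n) ∧
      ‖valMap hΛ u - valMap hΛ φ‖ ≤ ε ∧ ‖gradMap hΛ u - gradMap hΛ φ‖ ≤ ε := by
  obtain ⟨-, G, -, hG, happ⟩ := u.2
  have hε' : 0 < ε / (n + 1) := by positivity
  obtain ⟨φ, hφ, h1, h2⟩ := happ (ENNReal.ofReal (ε / (n + 1))) (ENNReal.ofReal_pos.2 hε')
  refine ⟨⟨φ, hφ.mem_H10⟩, hφ, ?_, ?_⟩
  · rw [Lp.norm_def]
    refine ENNReal.toReal_le_of_le_ofReal hε.le ?_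
    refine (eLpNorm_congr_ae ?_).trans_le (h1.trans (ENNReal.ofReal_le_ofReal
      (div_le_self hε.le (by simp))))
    filter_upwards [Lp.coeFn_sub (valMap hΛ u) (valMap hΛ ⟨φ, hφ.mem_H10⟩), valMap_ae_eq hΛ u,
      valMap_ae_eq hΛ ⟨φ, hφ.mem_H10⟩] with x hx1 hx2 hx3
    rw [hx1, Pi.sub_apply, hx2, hx3]
  · refine (norm_le_sum_norm _).trans ?_
    have : ∀ j ∈ Finset.univ, ‖(gradMap hΛ u - gradMap hΛ ⟨φ, hφ.mem_H10⟩ : TensorL2 L Λ) j‖ ≤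
        ε / (n + 1) := fun j _ => by
      rw [PiLp.sub_apply, Lp.norm_def]
      refine ENNReal.toReal_le_of_le_ofReal hε'.le ?_
      refine (eLpNorm_congr_ae ?_).trans_le (h2 j)
      filter_upwards [Lp.coeFn_sub (gradMap hΛ u j) (gradMap hΛ ⟨φ, hφ.mem_H10⟩ j),
        gradMap_ae_eq_of_hasWeakGrad hΛ u hG j,
        gradMap_ae_eq_of_hasWeakGrad hΛ ⟨φ, hφ.mem_H10⟩ hφ.hasWeakGrad j] with x hx1 hx2 hx3
      rw [hx1, Pi.sub_apply, hx2, hx3]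
    refine (Finset.sum_le_card_nsmul _ _ _ this).trans ?_
    rw [Finset.card_univ, Fintype.card_fin, nsmul_eq_mul]
    push_cast
    field_simp
    rfl

/-- The Poincaré inequality. -/
theorem exists_norm_valMap_le (hn : 1 ≤ n) (hΛ : IsPipe L Λ) :
    ∃ C : ℝ≥0, ∀ u : H10 L Λ, ‖valMap hΛ u‖ ≤ C * ‖gradMap hΛ u‖ := by
  have hi : (0 : Fin (n + 1)) ≠ Fin.last n := by
    intro h
    have := congrArg Fin.val h
    simp at this
    omega
  obtain ⟨C, hC⟩ := exists_poincare_const (F := PSpace n) hΛ.isOpen hΛ.cell_bounded hi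
  have htest : ∀ φ : H10 L Λ, IsPerTest L Λ (φ : PSpace n → PSpace n) →
      ‖valMap hΛ φ‖ ≤ C * ‖gradMap hΛ φ‖ := by
    intro φ hφ
    refine le_trans ?_ (mul_le_mul_of_nonneg_left (PiLp.norm_apply_le (gradMap hΛ φ) 0) C.2)
    have h := hC φ hφ
    rw [← eLpNorm_congr_ae (valMap_ae_eq hΛ φ),
      ← eLpNorm_congr_ae (gradMap_ae_eq_of_hasWeakGrad hΛ φ hφ.hasWeakGrad 0)] at h
    have h' := ENNReal.toReal_mono (ENNReal.mul_ne_top ENNReal.coe_ne_top (Lp.eLpNorm_ne_top _)) h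
    rwa [ENNReal.toReal_mul, ENNReal.coe_toReal, ← Lp.norm_def, ← Lp.norm_def] at h'
  refine ⟨C, fun u => le_of_forall_pos_le_add fun ε hε => ?_⟩
  -- An approximation error in the value costs once and one in the gradient costs `C` times,
  -- together `ε`.
  have hε' : 0 < ε / (C + 1) := by positivity
  obtain ⟨φ, hφ, h1, h2⟩ := exists_isPerTest_near hΛ u hε'
  have a1 := norm_le_norm_add_norm_sub' (valMap hΛ u) (valMap hΛ φ)
  have a2 := norm_le_norm_add_norm_sub (gradMap hΛ u) (gradMap hΛ φ)
  have a3 := htest φ hφ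
  have a4 : (C + 1 : ℝ) * (ε / (C + 1)) = ε := by field_simp
  have a5 : (C : ℝ) * ‖gradMap hΛ φ‖ ≤ C * (‖gradMap hΛ u‖ + ε / (C + 1)) := by
    gcongr
    linarith
  nlinarith

/-- A field whose restriction to the cell is an `L²` limit of test fields, along with the
gradients, is in `H10`. -/
theorem exists_H10_of_tendsto (hL : 0 < L) (hΛ : IsPipe L Λ) {φ : ℕ → H10 L Λ}
    (hφ : ∀ k, IsPerTest L Λ (φ k : PSpace n → PSpace n))
    {u : Lp (PSpace n) 2 (volume.restrict (cell L Λ))} {U : TensorL2 L Λ}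
    (hu : Tendsto (fun k => valMap hΛ (φ k)) atTop (𝓝 u))
    (hU : Tendsto (fun k => gradMap hΛ (φ k)) atTop (𝓝 U)) : ∃ w : H10 L Λ, gradMap hΛ w = U := by
  -- The limits live on the cell only; their periodic extensions are the candidates for the field
  -- and its weak gradient.
  have hw := isL2Per_perExt hL hΛ.isOpen hΛ.periodic (Lp.memLp u)
  have hG : ∀ j, IsL2Per L Λ (perExt L (U j)) := fun j =>
    isL2Per_perExt hL hΛ.isOpen hΛ.periodic (Lp.memLp (U j))
  have t1 : Tendsto (fun k => eLpNorm (fun x => perExt L u x - (φ k : PSpace n → PSpace n) x) 2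
      (volume.restrict (cell L Λ))) atTop (𝓝 0) := by
    have := (Lp.tendsto_Lp_iff_tendsto_eLpNorm' _ _).1 hu
    refine this.congr fun k => ?_
    rw [eLpNorm_sub_comm]
    refine eLpNorm_congr_ae ?_
    filter_upwards [perExt_ae_eq hL hΛ.isOpen u, valMap_ae_eq hΛ (φ k)] with x h1 h2
    rw [Pi.sub_apply, h1, h2]
  have t2 : ∀ j, Tendsto (fun k => eLpNorm (fun x => perExt L (U j) x -
      pd j (φ k : PSpace n → PSpace n) x) 2 (volume.restrict (cell L Λ))) atTop (𝓝 0) := by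
    intro j
    have hj : Tendsto (fun k => gradMap hΛ (φ k) j) atTop (𝓝 (U j)) :=
      ((PiLp.continuous_apply 2 _ j).tendsto U).comp hU
    have := (Lp.tendsto_Lp_iff_tendsto_eLpNorm' _ _).1 hj
    refine this.congr fun k => ?_
    rw [eLpNorm_sub_comm]
    refine eLpNorm_congr_ae ?_
    filter_upwards [perExt_ae_eq hL hΛ.isOpen (U j),
      gradMap_ae_eq_of_hasWeakGrad hΛ (φ k) (hφ k).hasWeakGrad j] with x h1 h2
    rw [Pi.sub_apply, h1, h2]
  have hgrad := hasWeakGrad_of_tendsto hL hΛ.isOpen hΛ.periodic hΛ.cell_bounded hw hG hφ t1 t2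
  refine ⟨⟨perExt L u, hw, fun j => perExt L (U j), hG, hgrad, fun ε hε => ?_⟩, ?_⟩
  · have e1 := t1.eventually_le_const hε
    have e2 := eventually_all.2 fun j => (t2 j).eventually_le_const hε
    obtain ⟨k, hk1, hk2⟩ := (e1.and e2).exists
    exact ⟨φ k, hφ k, hk1, hk2⟩
  · ext1 j
    exact Lp.ext ((gradMap_ae_eq_of_hasWeakGrad hΛ _ hgrad j).trans
      (perExt_ae_eq hL hΛ.isOpen (U j)))

/-- This is completeness of H10 for ‖·‖₁: test fields whose gradients converge have, by Poincaré's
inequality, convergent values, and the limit belongs to H10. -/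
theorem isClosed_range_gradMap (hn : 1 ≤ n) (hL : 0 < L) (hΛ : IsPipe L Λ) :
    IsClosed (LinearMap.range (gradMap hΛ) : Set (TensorL2 L Λ)) := by
  refine isClosed_of_closure_subset fun U hU => ?_
  obtain ⟨C, hC⟩ := exists_norm_valMap_le hn hΛ
  have happ : ∀ k : ℕ, ∃ φ : H10 L Λ, IsPerTest L Λ (φ : PSpace n → PSpace n) ∧
      ‖gradMap hΛ φ - U‖ ≤ 2 * (1 / ((k : ℝ) + 1)) := by
    intro k
    obtain ⟨_, ⟨w, rfl⟩, hw⟩ := Metric.mem_closure_iff.1 hU _ (Nat.one_div_pos_of_nat (n := k))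
    obtain ⟨φ, hφ, -, h2⟩ := exists_isPerTest_near hΛ w (Nat.one_div_pos_of_nat (n := k))
    refine ⟨φ, hφ, ?_⟩
    rw [dist_eq_norm, norm_sub_rev] at hw
    rw [norm_sub_rev] at h2
    have := norm_add_le (gradMap hΛ φ - gradMap hΛ w) (gradMap hΛ w - U)
    rw [sub_add_sub_cancel] at this
    linarith
  choose φ hφ hlim using happ
  have hU' : Tendsto (fun k => gradMap hΛ (φ k)) atTop (𝓝 U) := by
    rw [tendsto_iff_norm_sub_tendsto_zero]
    refine squeeze_zero (fun _ => norm_nonneg _) hlim ?_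
    simpa using (tendsto_one_div_add_atTop_nhds_zero_nat (𝕜 := ℝ)).const_mul 2
  have hcau : CauchySeq fun k => valMap hΛ (φ k) := by
    rw [Metric.cauchySeq_iff']
    intro ε hε
    have hε' : 0 < ε / (C + 1) := by positivity
    obtain ⟨N, hN⟩ := Metric.cauchySeq_iff'.1 hU'.cauchySeq _ hε'
    refine ⟨N, fun k hk => ?_⟩
    have h1 := hN k hk
    rw [dist_eq_norm, ← map_sub] at h1 ⊢
    have h2 := hC (φ k - φ N)
    have h3 : (C + 1 : ℝ) * (ε / (C + 1)) = ε := by field_simp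
    have h4 : (C + 1 : ℝ) * ‖gradMap hΛ (φ k - φ N)‖ < (C + 1 : ℝ) * (ε / (C + 1)) := by gcongr
    nlinarith [norm_nonneg (gradMap hΛ (φ k - φ N))]
  obtain ⟨u, hu⟩ := cauchySeq_tendsto_of_complete hcau
  obtain ⟨w, hw⟩ := exists_H10_of_tendsto hL hΛ hφ hu hU'
  exact ⟨w, hw⟩

/-! ### The divergence -/

/-- The trace of a square integrable tensor field. -/
def divMap (L : ℝ) (Λ : Set (PSpace n)) :
    TensorL2 L Λ →L[ℝ] Lp ℝ 2 (volume.restrict (cell L Λ)) :=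
  ∑ j, ((EuclideanSpace.proj j : PSpace n →L[ℝ] ℝ).compLpL 2 (volume.restrict (cell L Λ))).comp
    (PiLp.proj 2 (fun _ : Fin (n + 1) => Lp (PSpace n) 2 (volume.restrict (cell L Λ))) j)

theorem divMap_ae_eq (U : TensorL2 L Λ) :
    divMap L Λ U =ᵐ[volume.restrict (cell L Λ)] fun x => ∑ j, (U j x) j := by
  rw [divMap, sum_apply]
  have h1 := Lp.coeFn_finsetSum Finset.univ fun j : Fin (n + 1) =>
    (((EuclideanSpace.proj j : PSpace n →L[ℝ] ℝ).compLpL 2 (volume.restrict (cell L Λ))).comp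
    (PiLp.proj 2 (fun _ : Fin (n + 1) => Lp (PSpace n) 2 (volume.restrict (cell L Λ))) j)) U
  have h2 : ∀ᵐ x ∂volume.restrict (cell L Λ), ∀ j : Fin (n + 1),
      (EuclideanSpace.proj j : PSpace n →L[ℝ] ℝ).compLpL 2 (volume.restrict (cell L Λ)) (U j) x =
        (U j x) j :=
    ae_all_iff.2 fun j => ContinuousLinearMap.coeFn_compLpL _ _
  filter_upwards [h1, h2] with x hx1 hx2
  rw [hx1, Finset.sum_apply]
  exact Finset.sum_congr rfl fun j _ => hx2 j

theorem integral_fderiv_apply {u : PSpace n → PSpace n}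
    {G : Fin (n + 1) → PSpace n → PSpace n} (hG : HasWeakGrad Λ u G)
    {ψ : PSpace n → ℝ} (hψ : IsTest Λ ψ) :
    ∫ x in Λ, fderiv ℝ ψ x (u x) = - ∫ x in Λ, ψ x • ∑ j, G j x j := by
  have e : ∀ x, fderiv ℝ ψ x (u x) = ∑ j, EuclideanSpace.proj j (pd j ψ x • u x) := fun x => by
    rw [apply_eq_sum]
    simp [pd, mul_comm]
  have e' : ∀ x, ψ x • ∑ j, G j x j = ∑ j, EuclideanSpace.proj j (ψ x • G j x) := fun x => by
    simp [Finset.mul_sum]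
  simp only [e, e']
  rw [integral_finsetSum _ fun j _ => (EuclideanSpace.proj j : PSpace n →L[ℝ] ℝ).integrable_comp
      (hψ.integrable_pd_smul hG.locInt j),
    integral_finsetSum _ fun j _ => (EuclideanSpace.proj j : PSpace n →L[ℝ] ℝ).integrable_comp
      (hψ.integrable_smul (hG.locInt_grad j)), ← Finset.sum_neg_distrib]
  refine Finset.sum_congr rfl fun j _ => ?_
  rw [ContinuousLinearMap.integral_comp_comm _ (hψ.integrable_pd_smul hG.locInt j),
    ContinuousLinearMap.integral_comp_comm _ (hψ.integrable_smul (hG.locInt_grad j)),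
    hG.parts j ψ hψ, map_neg]

/-- The distributional divergence is the trace of the weak gradient. It vanishes on the pipe exactly
when it vanishes on the cell, by periodicity; thus 𝕍 is cut out by a continuous linear condition on
gradients. -/
theorem weakDivFree_iff (hL : 0 < L) (hΛ : IsPipe L Λ) (u : H10 L Λ) :
    WeakDivFree Λ (u : PSpace n → PSpace n) ↔ divMap L Λ (gradMap hΛ u) = 0 := by
  obtain ⟨-, G, hG2, hG, -⟩ := u.2
  have hcell : divMap L Λ (gradMap hΛ u) =ᵐ[volume.restrict (cell L Λ)]
      fun x => ∑ j, (G j x) j := by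
    refine (divMap_ae_eq _).trans ?_
    have : ∀ᵐ x ∂volume.restrict (cell L Λ), ∀ j, gradMap hΛ u j x = G j x :=
      ae_all_iff.2 (gradMap_ae_eq_of_hasWeakGrad hΛ u hG)
    filter_upwards [this] with x hx
    simp only [hx]
  have hloc : LocallyIntegrableOn (fun x => ∑ j, (G j x) j) Λ := by
    have : ∀ j, LocallyIntegrableOn (fun x => (G j x) j) Λ := fun j x hx => by
      obtain ⟨s, hs, hi⟩ := hG.locInt_grad j x hx
      exact ⟨s, hs, (EuclideanSpace.proj j : PSpace n →L[ℝ] ℝ).integrable_comp hi⟩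
    intro x hx
    choose s hs hi using fun j => this j x hx
    refine ⟨⋂ j, s j, (Filter.iInter_mem).2 hs, ?_⟩
    exact integrable_finsetSum _ fun j _ => (hi j).mono_set (Set.iInter_subset s j)
  constructor
  · intro h
    have h0 := hΛ.isOpen.ae_eq_zero_of_integral_contDiff_smul_eq_zero (μ := volume) hloc
      (fun ψ h1 h2 h3 => by
        have hψ : IsTest Λ ψ := ⟨h1, h2, h3⟩
        rw [← hψ.setIntegral_eq, ← neg_eq_zero, ← integral_fderiv_apply hG hψ]
        exact h ψ hψ)
    rw [← ae_restrict_iff' hΛ.isOpen.measurableSet] at h0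
    rw [Lp.eq_zero_iff_ae_eq_zero]
    exact hcell.trans (ae_cell_of_ae h0)
  · intro h ψ hψ
    rw [Lp.eq_zero_iff_ae_eq_zero] at h
    have h0 : (fun x => ∑ j, (G j x) j) =ᵐ[volume.restrict Λ] fun _ => 0 :=
      ae_eq_of_ae_eq_cell hL hΛ.isOpen hΛ.periodic
        (fun x hx => by simp only [(hG2 _).periodic x hx]) (fun _ _ => rfl) (hcell.symm.trans h)
    rw [integral_fderiv_apply hG hψ, neg_eq_zero]
    refine integral_eq_zero_of_ae (h0.mono fun x hx => ?_)
    simp only [hx, smul_zero, Pi.zero_apply]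

theorem divMap_gradMap_of_isPerTest (hΛ : IsPipe L Λ) (φ : H10 L Λ)
    (hφ : IsPerTest L Λ (φ : PSpace n → PSpace n)) :
    divMap L Λ (gradMap hΛ φ) =ᵐ[volume.restrict (cell L Λ)] div (φ : PSpace n → PSpace n) := by
  refine (divMap_ae_eq _).trans ?_
  have : ∀ᵐ x ∂volume.restrict (cell L Λ), ∀ j, gradMap hΛ φ j x =
      pd j (φ : PSpace n → PSpace n) x :=
    ae_all_iff.2 (gradMap_ae_eq_of_hasWeakGrad hΛ φ hφ.hasWeakGrad)
  filter_upwards [this] with x hx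
  simp only [hx, div]

end Hilbert

end Pipe

end

noncomputable section

namespace Pipe

open scoped NNReal

variable {n : ℕ}

/-! ### The a priori estimate for the pressure -/

section Control

variable {L : ℝ} {Λ : Set (PSpace n)}

theorem div_ne_zero_bound {u : PSpace n → PSpace n} {M : ℝ} (hM : ∀ x, u x ≠ 0 → |zc x| ≤ M) :
    ∀ x, div u x ≠ 0 → |zc x| ≤ M := fun x hx => by
  obtain ⟨j, -, hj⟩ := Finset.exists_ne_zero_of_sum_ne_zero hx
  exact pd_ne_zero_bound hM j x fun h0 => hj (by rw [h0]; rfl)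

theorem div_per (hL : 0 < L) {u : PSpace n → PSpace n} (hs : Differentiable ℝ u) {M : ℝ}
    (hM : ∀ x, u x ≠ 0 → |zc x| ≤ M) : div (per L u) = per L (div u) := by
  funext x
  obtain ⟨K, hK⟩ := exists_natCast_mul_ge hL (M + |zc x|)
  rw [per_eq_sum hL (div_ne_zero_bound hM) hK le_rfl]
  simp only [div]
  rw [Finset.sum_comm]
  refine Finset.sum_congr rfl fun j _ => ?_
  rw [pd_per hL hs hM j, per_eq_sum hL (pd_ne_zero_bound hM j) hK le_rfl]
  simp

/-- Periodizing the local equation changes neither its form nor the datum: `g` is supported in one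
cell, so its other translates do not reach the points considered. -/
theorem per_div_eq (hL : 0 < L) {D : Set (PSpace n)} {M : ℝ} (hM : ∀ x ∈ D, |zc x| ≤ M)
    {u : PSpace n → PSpace n} (hu : IsTest D u) (h : PSpace n → ℝ) (m : ℝ)
    {g : PSpace n → ℝ} (hg : ∀ x, g x ≠ 0 → x ∈ D ∧ x ∈ cell L Λ) {x : PSpace n}
    (hx : x ∈ cell L Λ) :
    per L (D.indicator fun x => div u x + m * h x - g x) x =
      div (per L u) x + m * per L (D.indicator h) x - g x := by
  obtain ⟨K, hK⟩ := exists_natCast_mul_ge hL (M + L)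
  have hz : |zc x| ≤ L := by rw [abs_of_pos hx.2.1]; exact hx.2.2.le
  have hu0 : ∀ y, u y ≠ 0 → |zc y| ≤ M := fun y hy => hM y (hu.supp (subset_tsupport _ hy))
  have hind : ∀ f : PSpace n → ℝ, ∀ y, D.indicator f y ≠ 0 → |zc y| ≤ M := fun f y hy =>
    hM y (Set.mem_of_indicator_ne_zero hy)
  have hgx : g x = ∑ k ∈ Finset.Icc (-(K : ℤ)) K, g (shift L k x) := by
    rw [Finset.sum_eq_single 0]
    · simp
    · intro k _ hk
      by_contra h0
      have hc := (hg _ h0).2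
      obtain ⟨-, a1, a2⟩ := hc
      obtain ⟨-, b1, b2⟩ := hx
      rw [zc_shift] at a1 a2
      have c1 : (k : ℝ) < 1 := by nlinarith
      have c2 : (-1 : ℝ) < k := by nlinarith
      have c1' : k < 1 := by exact_mod_cast c1
      have c2' : -1 < k := by exact_mod_cast c2
      omega
    · intro h0
      simp at h0
  have hd : div (per L u) x = ∑ k ∈ Finset.Icc (-(K : ℤ)) K, div u (shift L k x) := by
    rw [div_per hL (hu.smooth.differentiable (by simp)) hu0,
      per_eq_sum hL (div_ne_zero_bound hu0) hK hz]
  rw [per_eq_sum hL (hind _) hK hz, per_eq_sum hL (hind h) hK hz, hd, hgx, Finset.mul_sum,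
    ← Finset.sum_add_distrib, ← Finset.sum_sub_distrib]
  refine Finset.sum_congr rfl fun k _ => ?_
  by_cases hy : shift L k x ∈ D
  · simp only [Set.indicator_of_mem hy]
  · have e1 : g (shift L k x) = 0 := by
      by_contra h0
      exact hy (hg _ h0).1
    have e2 : div u (shift L k x) = 0 := by
      have : fderiv ℝ u (shift L k x) = 0 := image_eq_zero_of_notMem_tsupport fun hc =>
        hy (hu.supp (tsupport_fderiv_subset ℝ hc))
      simp [div, pd, this]
    simp only [Set.indicator_of_notMem hy, e1, e2, mul_zero, add_zero, sub_zero]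

theorem eLpNorm_restrict_of_support_subset {F : Type*} [NormedAddCommGroup F]
    {D : Set (PSpace n)} (hD : MeasurableSet D) {f : PSpace n → F} (hf : ∀ x, f x ≠ 0 → x ∈ D) :
    eLpNorm f 2 (volume.restrict D) = eLpNorm f 2 volume := by
  rw [← eLpNorm_indicator_eq_eLpNorm_restrict hD]
  congr 1
  exact Set.indicator_eq_self.2 hf

/-- The `L²` norm on `S ∩ cell` of a function is controlled by the dual norm of its gradient and
finitely many functionals. -/
def Controlled (hΛ : IsPipe L Λ) (S : Set (PSpace n)) : Prop :=
  ∃ (C : ℝ≥0) (s : Finset (Lp ℝ 2 (volume.restrict (cell L Λ)))),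
    ∀ (g : Lp ℝ 2 (volume.restrict (cell L Λ))) (A : ℝ), 0 ≤ A →
      (∀ w : H10 L Λ, |inner ℝ g (divMap L Λ (gradMap hΛ w))| ≤ A * ‖gradMap hΛ w‖) →
      eLpNorm g 2 (volume.restrict (S ∩ cell L Λ)) ≤
        ENNReal.ofReal (C * (A + ∑ h ∈ s, |inner ℝ h g|))

theorem Controlled.mono {hΛ : IsPipe L Λ} {S T : Set (PSpace n)} (hST : S ⊆ T)
    (hT : Controlled hΛ T) : Controlled hΛ S := by
  obtain ⟨C, s, h⟩ := hT
  refine ⟨C, s, fun g A hA hg => (eLpNorm_mono_measure _ ?_).trans (h g A hA hg)⟩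
  exact Measure.restrict_mono (Set.inter_subset_inter_left _ hST) le_rfl

theorem eLpNorm_restrict_union_le {F : Type*} [NormedAddCommGroup F] [NormedSpace ℝ F]
    (f : PSpace n → F) (S T : Set (PSpace n)) :
    eLpNorm f 2 (volume.restrict (S ∪ T)) ≤
      eLpNorm f 2 (volume.restrict S) + eLpNorm f 2 (volume.restrict T) := by
  refine (ENNReal.pow_le_pow_left_iff two_ne_zero).1 ?_
  calc eLpNorm f 2 (volume.restrict (S ∪ T)) ^ 2
      ≤ eLpNorm f 2 (volume.restrict S) ^ 2 + eLpNorm f 2 (volume.restrict T) ^ 2 := by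
        simp only [eLpNorm_two_sq]
        exact lintegral_union_le _ _ _
    _ ≤ _ := by
        rw [add_sq]
        exact add_le_add_left le_self_add _

theorem Controlled.union {hΛ : IsPipe L Λ} {S T : Set (PSpace n)}
    (hS : Controlled hΛ S) (hT : Controlled hΛ T) : Controlled hΛ (S ∪ T) := by
  classical
  obtain ⟨C, s, h⟩ := hS
  obtain ⟨C', t, h'⟩ := hT
  refine ⟨C + C', s ∪ t, fun g A hA hg => ?_⟩
  rw [Set.union_inter_distrib_right]
  refine (eLpNorm_restrict_union_le _ _ _).trans ((add_le_add (h g A hA hg)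
    (h' g A hA hg)).trans ?_)
  rw [← ENNReal.ofReal_add (by positivity) (by positivity)]
  refine ENNReal.ofReal_le_ofReal ?_
  have e1 : ∑ h ∈ s, |inner ℝ h g| ≤ ∑ h ∈ s ∪ t, |inner ℝ h g| :=
    Finset.sum_le_sum_of_subset_of_nonneg Finset.subset_union_left fun _ _ _ => abs_nonneg _
  have e2 : ∑ h ∈ t, |inner ℝ h g| ≤ ∑ h ∈ s ∪ t, |inner ℝ h g| :=
    Finset.sum_le_sum_of_subset_of_nonneg Finset.subset_union_right fun _ _ _ => abs_nonneg _
  rw [NNReal.coe_add, add_mul]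
  gcongr

/-- The approximate local solver leaves an error proportional to ε, removed here before dividing by
`a`. -/
theorem sq_le_of_forall_le {a b c : ℝ} (ha : 0 ≤ a) (hb : 0 ≤ b)
    (h : ∀ ε > 0, a ^ 2 ≤ a * b + c * ε) : a ≤ b := by
  have h1 : a ^ 2 ≤ a * b := by
    refine le_of_forall_pos_le_add fun ε hε => ?_
    have h2 := h (ε / (|c| + 1)) (by positivity)
    have h3 : c * (ε / (|c| + 1)) ≤ ε := by
      rw [mul_div_assoc', div_le_iff₀ (by positivity)]
      nlinarith [le_abs_self c, abs_nonneg c]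
    linarith
  rcases ha.eq_or_lt with h0 | h0
  · linarith
  · nlinarith

/-- Duality with the local solver. Let g₀ be g cut off to U ∩ cell and a its norm, so a² = (g, g₀).
Up to a small error, g₀ = div w + m H with w the periodized local solution; hence a² is at most A
‖∇w‖ + |m| |(H, g)| plus the error. Both ‖∇w‖ and |m| are bounded by a multiple of a, and dividing
by a gives the claim. The cutoff may be rough, since the solver accepts any L² datum. -/
theorem exists_controlled_nhds (hL : 0 < L) (hΛ : IsPipe L Λ) {x₀ : PSpace n}
    (hx₀ : x₀ ∈ closure (cell L Λ)) : ∃ U ∈ 𝓝 x₀, Controlled hΛ U := by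
  obtain ⟨D, hD, hDo, hDb, hDΛ, U, hU, hUo, hUD⟩ :=
    exists_solvable_nhds hΛ.isOpen hΛ.boundary (closure_mono cell_subset hx₀)
  obtain ⟨C, h, hhm, hh, hsol⟩ := hD.exists_isTest hDo hDb
  obtain ⟨M, hM⟩ := exists_zc_bound_of_isBounded hDb
  obtain ⟨K, hK⟩ := exists_natCast_mul_ge hL (M + L)
  have hind : ∀ f : PSpace n → ℝ, ∀ y, D.indicator f y ≠ 0 → |zc y| ≤ M := fun f y hy =>
    hM y (Set.mem_of_indicator_ne_zero hy)
  have hHm : MemLp (per L (D.indicator h)) 2 (volume.restrict (cell L Λ)) := by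
    refine ⟨aestronglyMeasurable_per_cell hL hΛ.isOpen
      (hhm.indicator hDo.measurableSet).aestronglyMeasurable (hind h), ?_⟩
    refine (eLpNorm_per_le hL hΛ.isOpen (hhm.indicator hDo.measurableSet).aestronglyMeasurable
      (hind h) hK).trans_lt ?_
    rw [eLpNorm_indicator_eq_eLpNorm_restrict hDo.measurableSet]
    exact ENNReal.mul_lt_top (by finiteness) hh.2
  set H := hHm.toLp
  -- The factor n + 1 counts partial derivatives and 2K + 1 counts translates of `D` that may reach
  -- the cell; the last `C` bounds m.
  refine ⟨U, hU, ((n + 1) * (2 * K + 1) + 1) * C, {H}, fun g A hA hg => ?_⟩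
  set N : ℝ≥0∞ := 2 * K + 1 with hN
  have hNr : N.toReal = 2 * K + 1 := by
    rw [hN, ENNReal.toReal_add (by finiteness) (by finiteness)]
    simp
  have hNtop : N ≠ ⊤ := by rw [hN]; finiteness
  have hUc : MeasurableSet (U ∩ cell L Λ) := (hUo.inter (isOpen_cell hΛ.isOpen)).measurableSet
  set g₀ : PSpace n → ℝ := (U ∩ cell L Λ).indicator g with hg₀
  have hg₀m : Measurable g₀ := (Lp.stronglyMeasurable g).measurable.indicator hUc
  have hg₀s : ∀ x, g₀ x ≠ 0 → x ∈ D ∧ x ∈ cell L Λ := fun x hx => by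
    have := Set.mem_of_indicator_ne_zero hx
    exact ⟨hUD ⟨this.1, this.2.1⟩, this.2⟩
  set a : ℝ≥0∞ := eLpNorm g 2 (volume.restrict (U ∩ cell L Λ)) with ha
  have hav : eLpNorm g₀ 2 volume = a := eLpNorm_indicator_eq_eLpNorm_restrict hUc
  have haD : eLpNorm g₀ 2 (volume.restrict D) = a := by
    rw [eLpNorm_restrict_of_support_subset hDo.measurableSet fun x hx => (hg₀s x hx).1, hav]
  have hac : eLpNorm g₀ 2 (volume.restrict (cell L Λ)) = a := by
    rw [eLpNorm_restrict_of_support_subset (isOpen_cell hΛ.isOpen).measurableSet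
      fun x hx => (hg₀s x hx).2, hav]
  have hatop : a ≠ ⊤ := by
    refine ne_top_of_le_ne_top (Lp.eLpNorm_ne_top g) (eLpNorm_mono_measure _ ?_)
    exact Measure.restrict_mono Set.inter_subset_right le_rfl
  have hG₀ : MemLp g₀ 2 (volume.restrict (cell L Λ)) :=
    ⟨hg₀m.aestronglyMeasurable, by rw [hac]; exact hatop.lt_top⟩
  have hD₀ : MemLp g₀ 2 (volume.restrict D) :=
    ⟨hg₀m.aestronglyMeasurable, by rw [haD]; exact hatop.lt_top⟩
  have hsq : inner ℝ g hG₀.toLp = a.toReal ^ 2 := by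
    have e1 : ‖hG₀.toLp‖ = a.toReal := by rw [Lp.norm_toLp, hac]
    rw [← e1, ← real_inner_self_eq_norm_sq, L2.inner_def, L2.inner_def]
    refine integral_congr_ae ?_
    filter_upwards [hG₀.coeFn_toLp] with x hx
    rw [hx]
    by_cases hxU : x ∈ U ∩ cell L Λ
    · rw [hg₀, Set.indicator_of_mem hxU]
    · rw [hg₀, Set.indicator_of_notMem hxU, inner_zero_right, inner_zero_right]
  have hle : a.toReal ≤ ((n + 1) * (2 * K + 1) + 1) * C * (A + |inner ℝ H g|) := by
    refine sq_le_of_forall_le ENNReal.toReal_nonneg (by positivity)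
      (c := ‖g‖ * N.toReal) fun ε hε => ?_
    obtain ⟨u, m, hu, herr, hpd, hm⟩ := hsol g₀ hg₀m hD₀ (ENNReal.ofReal ε)
      (ENNReal.ofReal_pos.2 hε)
    rw [haD] at hm
    have huΛ : IsTest Λ u := ⟨hu.smooth, hu.compact, hu.supp.trans hDΛ⟩
    have hφ := isPerTest_per hL hΛ.periodic huΛ
    have hu0 : ∀ y, u y ≠ 0 → |zc y| ≤ M := fun y hy => hM y (hu.supp (subset_tsupport _ hy))
    set w : H10 L Λ := ⟨per L u, hφ.mem_H10⟩ with hw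
    have hpm : ∀ j, Continuous (pd j u) := fun j =>
      (hu.smooth.continuous_fderiv (by simp)).clm_apply continuous_const
    have hwn : ‖gradMap hΛ w‖ ≤ (n + 1) * (N.toReal * (C * a.toReal)) := by
      refine (norm_le_sum_norm _).trans ?_
      refine (Finset.sum_le_card_nsmul _ _ (N.toReal * (C * a.toReal)) fun j _ => ?_).trans ?_
      · rw [Lp.norm_def,
          eLpNorm_congr_ae (gradMap_ae_eq_of_hasWeakGrad hΛ w hφ.hasWeakGrad j)]
        have e : eLpNorm (pd j (per L u)) 2 (volume.restrict (cell L Λ)) ≤ N * (C * a) := by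
          rw [pd_per hL (hu.smooth.differentiable (by simp)) hu0 j]
          refine (eLpNorm_per_le hL hΛ.isOpen (hpm j).aestronglyMeasurable
            (pd_ne_zero_bound hu0 j) hK).trans ?_
          gcongr
          rw [← eLpNorm_restrict_of_support_subset hDo.measurableSet (D := D)]
          · exact (hpd j).trans_eq (by rw [haD])
          · intro x hx
            refine hu.supp (tsupport_fderiv_subset ℝ (subset_tsupport _ fun h0 => hx ?_))
            simp [pd, h0]
        have := ENNReal.toReal_mono (by finiteness) e
        simpa [ENNReal.toReal_mul] using this
      · rw [Finset.card_univ, Fintype.card_fin, nsmul_eq_mul]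
        push_cast
        rfl
    have hmr : |m| ≤ C * a.toReal := by
      have := ENNReal.toReal_mono (by finiteness) hm
      simpa [ENNReal.toReal_mul] using this
    have hE : ‖divMap L Λ (gradMap hΛ w) + m • H - hG₀.toLp‖ ≤ N.toReal * ε := by
      rw [Lp.norm_def]
      have e : eLpNorm (divMap L Λ (gradMap hΛ w) + m • H - hG₀.toLp :
          Lp ℝ 2 (volume.restrict (cell L Λ))) 2 (volume.restrict (cell L Λ)) ≤
          N * ENNReal.ofReal ε := by
        have hem : Measurable fun x => div u x + m * h x - g₀ x := by
          have : Measurable (div u) := by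
            unfold div
            exact Finset.measurable_fun_sum _ fun j _ =>
              ((EuclideanSpace.proj j : PSpace n →L[ℝ] ℝ).continuous.comp (hpm j)).measurable
          exact (this.add (hhm.const_mul m)).sub hg₀m
        have h1 : ((divMap L Λ (gradMap hΛ w) + m • H - hG₀.toLp :
            Lp ℝ 2 (volume.restrict (cell L Λ))) : PSpace n → ℝ) =ᵐ[volume.restrict (cell L Λ)]
            per L (D.indicator fun x => div u x + m * h x - g₀ x) := by
          filter_upwards [Lp.coeFn_sub (divMap L Λ (gradMap hΛ w) + m • H) hG₀.toLp,
            Lp.coeFn_add (divMap L Λ (gradMap hΛ w)) (m • H), Lp.coeFn_smul m H,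
            hG₀.coeFn_toLp, hHm.coeFn_toLp, divMap_gradMap_of_isPerTest hΛ w hφ,
            ae_restrict_mem (isOpen_cell hΛ.isOpen).measurableSet] with x x1 x2 x3 x4 x5 x6 x7
          rw [x1, Pi.sub_apply, x2, Pi.add_apply, x3, Pi.smul_apply, x4, x5, x6,
            per_div_eq hL hM hu h m hg₀s x7, smul_eq_mul]
        rw [eLpNorm_congr_ae h1]
        refine (eLpNorm_per_le hL hΛ.isOpen
          (hem.indicator hDo.measurableSet).aestronglyMeasurable (hind _) hK).trans ?_
        rw [eLpNorm_indicator_eq_eLpNorm_restrict hDo.measurableSet]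
        gcongr
      have := ENNReal.toReal_mono (by finiteness) e
      simpa [ENNReal.toReal_mul, ENNReal.toReal_ofReal hε.le] using this
    have hdec : a.toReal ^ 2 = inner ℝ g (divMap L Λ (gradMap hΛ w)) + m * inner ℝ g H -
        inner ℝ g (divMap L Λ (gradMap hΛ w) + m • H - hG₀.toLp) := by
      rw [inner_sub_right, inner_add_right, inner_smul_right, hsq]
      ring
    have i1 := (le_abs_self _).trans (hg w)
    have i2 : m * inner ℝ g H ≤ C * a.toReal * |inner ℝ H g| := by
      rw [real_inner_comm]
      refine (le_abs_self _).trans ?_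
      rw [abs_mul]
      gcongr
    have i3 := (neg_le_abs _).trans (abs_real_inner_le_norm g
      (divMap L Λ (gradMap hΛ w) + m • H - hG₀.toLp))
    have i4 : ‖g‖ * ‖divMap L Λ (gradMap hΛ w) + m • H - hG₀.toLp‖ ≤ ‖g‖ * (N.toReal * ε) := by
      gcongr
    have i5 : A * ‖gradMap hΛ w‖ ≤ A * ((n + 1) * (N.toReal * (C * a.toReal))) := by gcongr
    rw [hNr] at i5
    have p1 : 0 ≤ (C : ℝ) * a.toReal * A := by positivity
    have p2 : 0 ≤ ((n : ℝ) + 1) * (2 * K + 1) * (C * a.toReal * |inner ℝ H g|) := by positivity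
    linarith
  rw [← ENNReal.ofReal_toReal hatop]
  refine ENNReal.ofReal_le_ofReal ?_
  rw [Finset.sum_singleton]
  push_cast
  exact hle

/-- The a priori estimate for the pressure, up to finitely many functionals. -/
theorem exists_norm_le_of_dual_bound (hL : 0 < L) (hΛ : IsPipe L Λ) :
    ∃ (C : ℝ≥0) (s : Finset (Lp ℝ 2 (volume.restrict (cell L Λ)))),
      ∀ (g : Lp ℝ 2 (volume.restrict (cell L Λ))) (A : ℝ), 0 ≤ A →
        (∀ w : H10 L Λ, |inner ℝ g (divMap L Λ (gradMap hΛ w))| ≤ A * ‖gradMap hΛ w‖) →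
        ‖g‖ ≤ C * (A + ∑ h ∈ s, |inner ℝ h g|) := by
  have key : Controlled hΛ (closure (cell L Λ)) := by
    -- Being controlled passes to subsets and finite unions, so on a compact set it need only be
    -- checked locally.
    refine hΛ.cell_bounded.isCompact_closure.induction_on ?_ (fun S T => Controlled.mono)
      (fun S T => Controlled.union) fun x hx => ?_
    · exact ⟨0, ∅, fun g A hA hg => by simp⟩
    · obtain ⟨U, hU, h⟩ := exists_controlled_nhds hL hΛ hx
      exact ⟨U, mem_nhdsWithin_of_mem_nhds hU, h⟩
  obtain ⟨C, s, h⟩ := key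
  refine ⟨C, s, fun g A hA hg => ?_⟩
  have := h g A hA hg
  rw [Set.inter_eq_right.2 subset_closure] at this
  rw [Lp.norm_def]
  exact ENNReal.toReal_le_of_le_ofReal (by positivity) this

end Control

end Pipe

end

noncomputable section

namespace Pipe

open scoped NNReal

variable {n : ℕ}

/-! ### Existence of the pressure -/

/-- If `g` is controlled by `T† g` and finitely many functionals, then a functional which vanishes
on the kernel of `T` factors through `T`. -/
theorem exists_inner_eq_of_ker {X Y : Type*} [NormedAddCommGroup X] [InnerProductSpace ℝ X]
    [CompleteSpace X] [NormedAddCommGroup Y] [InnerProductSpace ℝ Y] [CompleteSpace Y]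
    (T : X →L[ℝ] Y) {C : ℝ≥0} {s : Finset Y}
    (h : ∀ g : Y, ‖g‖ ≤ C * (‖T.adjoint g‖ + ∑ h ∈ s, |inner ℝ h g|)) {q : X}
    (hq : ∀ w, T w = 0 → inner ℝ q w = 0) : ∃ p : Y, ∀ w, inner ℝ q w = inner ℝ p (T w) := by
  let J : Y →L[ℝ] (s → ℝ) := ContinuousLinearMap.pi fun i => innerSL ℝ (i : Y)
  let S : Y →L[ℝ] X × (s → ℝ) := T.adjoint.prod J
  -- Together with the finitely many functionals the adjoint is bounded below, so the joint map has
  -- closed range.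
  have hS : AntilipschitzWith (C * (s.card + 1)) S := by
    refine AddMonoidHomClass.antilipschitz_of_bound S fun g => (h g).trans ?_
    have e1 : ‖T.adjoint g‖ ≤ ‖S g‖ := norm_fst_le (S g)
    have e2 : ∑ h ∈ s, |inner ℝ h g| ≤ s.card * ‖S g‖ := by
      rw [← nsmul_eq_mul]
      refine Finset.sum_le_card_nsmul _ _ _ fun i hi => ?_
      exact (norm_le_pi_norm (J g) ⟨i, hi⟩).trans (norm_snd_le (S g))
    push_cast
    rw [mul_assoc]
    gcongr
    linarith
  have hcl : IsClosed (LinearMap.range (S : Y →ₗ[ℝ] X × (s → ℝ)) : Set (X × (s → ℝ))) := by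
    rw [LinearMap.coe_range]
    exact hS.isClosed_range S.uniformContinuous
  -- Adding the finite-dimensional factor keeps the range closed and frees the second component: the
  -- slice of the sum at (x, 0) is then exactly the range of the adjoint.
  have hcl2 := Submodule.isClosed_sup_finiteDimensional _
    (LinearMap.range (LinearMap.inr ℝ X (s → ℝ))) hcl
  have hrange : IsClosed (LinearMap.range (T.adjoint : Y →ₗ[ℝ] X) : Set X) := by
    have hpre := hcl2.preimage
      (by fun_prop : Continuous fun x : X => ((x, 0) : X × (s → ℝ)))
    convert hpre using 1
    ext x
    simp only [Set.mem_preimage, SetLike.mem_coe, Submodule.mem_sup]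
    constructor
    · rintro ⟨g, rfl⟩
      refine ⟨S g, ⟨g, rfl⟩, (0, -J g), ⟨-J g, rfl⟩, ?_⟩
      simp [S]
    · rintro ⟨_, ⟨g, rfl⟩, _, ⟨r, rfl⟩, hg⟩
      refine ⟨g, ?_⟩
      have := congrArg Prod.fst hg
      simpa [S] using this
  have hmem : q ∈ (LinearMap.ker (T : X →ₗ[ℝ] Y))ᗮ := by
    rw [Submodule.mem_orthogonal']
    exact fun w hw => hq w hw
  -- The orthogonal complement of the kernel is the closure of the range of the adjoint, hence that
  -- range itself.
  rw [ContinuousLinearMap.orthogonal_ker, hrange.submodule_topologicalClosure_eq] at hmem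
  obtain ⟨p, rfl⟩ := hmem
  exact ⟨p, fun w => ContinuousLinearMap.adjoint_inner_left T w p⟩

/-- The Riesz representation of a functional which is bounded in terms of a linear map with closed
range. -/
theorem exists_inner_map_eq {W X : Type*} [AddCommGroup W] [Module ℝ W] [NormedAddCommGroup X]
    [InnerProductSpace ℝ X] [CompleteSpace X] (P : W →ₗ[ℝ] X)
    (hP : IsClosed (LinearMap.range P : Set X)) (l : W →ₗ[ℝ] ℝ) {B : ℝ}
    (hB : ∀ w, |l w| ≤ B * ‖P w‖) : ∃ v, ∀ w, inner ℝ (P v) (P w) = l w := by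
  have : CompleteSpace (LinearMap.range P) := hP.completeSpace_coe
  have hker : ∀ w, P w = 0 → l w = 0 := fun w hw => by
    have := hB w
    rwa [hw, norm_zero, mul_zero, abs_nonpos_iff] at this
  -- The functional `l` vanishes on the kernel of `P`, so it descends to the range, a Hilbert space;
  -- a linear section expresses this without a quotient.
  obtain ⟨σ, hσ⟩ := P.rangeRestrict.exists_rightInverse_of_surjective
    (LinearMap.range_rangeRestrict P)
  have hPσ : ∀ r : LinearMap.range P, P (σ r) = r := fun r =>
    congrArg Subtype.val (LinearMap.congr_fun hσ r)
  let lc : LinearMap.range P →L[ℝ] ℝ := (l.comp σ).mkContinuous B fun r => by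
    have := hB (σ r)
    rwa [hPσ] at this
  refine ⟨σ ((InnerProductSpace.toDual ℝ _).symm lc), fun w => ?_⟩
  have h1 := InnerProductSpace.toDual_symm_apply (𝕜 := ℝ) (y := lc) (x := P.rangeRestrict w)
  rw [hPσ]
  refine Eq.trans h1 ?_
  change l (σ (P.rangeRestrict w)) = l w
  rw [← sub_eq_zero, ← map_sub]
  refine hker _ ?_
  rw [map_sub, hPσ, sub_eq_zero]
  rfl

/-- A functional which vanishes where `D ∘ P` does factors through `D ∘ P`. -/
theorem exists_inner_comp_eq {W X Y : Type*} [AddCommGroup W] [Module ℝ W]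
    [NormedAddCommGroup X] [InnerProductSpace ℝ X] [CompleteSpace X] [NormedAddCommGroup Y]
    [InnerProductSpace ℝ Y] [CompleteSpace Y] (P : W →ₗ[ℝ] X)
    (hP : IsClosed (LinearMap.range P : Set X)) (D : X →L[ℝ] Y) {C : ℝ≥0} {s : Finset Y}
    (h : ∀ (g : Y) (A : ℝ), 0 ≤ A → (∀ w, |inner ℝ g (D (P w))| ≤ A * ‖P w‖) →
      ‖g‖ ≤ C * (A + ∑ h ∈ s, |inner ℝ h g|)) (l : W →ₗ[ℝ] ℝ) {B : ℝ}
    (hB : ∀ w, |l w| ≤ B * ‖P w‖) (hl : ∀ w, D (P w) = 0 → l w = 0) :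
    ∃ p : Y, ∀ w, l w = inner ℝ p (D (P w)) := by
  have : CompleteSpace (LinearMap.range P) := hP.completeSpace_coe
  obtain ⟨v, hv⟩ := exists_inner_map_eq P hP l hB
  let T : LinearMap.range P →L[ℝ] Y := D.comp (LinearMap.range P).subtypeL
  obtain ⟨p, hp⟩ := exists_inner_eq_of_ker T (C := C) (s := s) (q := P.rangeRestrict v)
    (fun g => by
      refine h g _ (norm_nonneg _) fun w => ?_
      have e : inner ℝ g (D (P w)) = inner ℝ (T.adjoint g) (P.rangeRestrict w) := by
        rw [ContinuousLinearMap.adjoint_inner_left]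
        rfl
      rw [e]
      exact abs_real_inner_le_norm _ _)
    (fun r hr => by
      obtain ⟨w, rfl⟩ := LinearMap.surjective_rangeRestrict P r
      exact (hv w).trans (hl w hr))
  exact ⟨p, fun w => (hv w).symm.trans (hp (P.rangeRestrict w))⟩

section Pressure

variable {L : ℝ} {Λ : Set (PSpace n)}

/-- Every bounded functional on `H10` which vanishes on the solenoidal fields is the pairing of
the divergence with a square integrable function. -/
theorem exists_pressure (hn : 1 ≤ n) (hL : 0 < L) (hΛ : IsPipe L Λ) (l : H10 L Λ →ₗ[ℝ] ℝ)
    {B : ℝ} (hB : ∀ w, |l w| ≤ B * ‖gradMap hΛ w‖)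
    (h0 : ∀ w : H10 L Λ, (w : PSpace n → PSpace n) ∈ V L Λ → l w = 0) :
    ∃ p : Lp ℝ 2 (volume.restrict (cell L Λ)),
      ∀ w : H10 L Λ, l w = inner ℝ p (divMap L Λ (gradMap hΛ w)) := by
  obtain ⟨C, s, hC⟩ := exists_norm_le_of_dual_bound hL hΛ
  exact exists_inner_comp_eq (gradMap hΛ) (isClosed_range_gradMap hn hL hΛ) (divMap L Λ) hC l hB
    fun w hw => h0 w ⟨w.2, (weakDivFree_iff hL hΛ w).2 hw⟩

/-! ### The variational problem -/

/-- The gradients of solenoidal fields are the closed range of `gradMap` intersected with the kernel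
of the continuous map `divMap`. -/
theorem isClosed_range_gradMap_V (hn : 1 ≤ n) (hL : 0 < L) (hΛ : IsPipe L Λ) :
    IsClosed (LinearMap.range ((gradMap hΛ).comp (Submodule.inclusion (V_le_H10 L Λ))) :
      Set (TensorL2 L Λ)) := by
  have h := (isClosed_range_gradMap hn hL hΛ).inter
    (isClosed_singleton.preimage (divMap L Λ).continuous : IsClosed (divMap L Λ ⁻¹' {0}))
  convert h using 1
  ext U
  constructor
  · rintro ⟨v, rfl⟩
    exact ⟨⟨_, rfl⟩, (weakDivFree_iff hL hΛ _).1 v.2.2⟩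
  · rintro ⟨⟨w, rfl⟩, hw⟩
    exact ⟨⟨w, w.2, (weakDivFree_iff hL hΛ w).2 hw⟩, rfl⟩

theorem ae_eq_zero_of_gradMap_eq_zero (hn : 1 ≤ n) (hL : 0 < L) (hΛ : IsPipe L Λ) (u : H10 L Λ)
    (h : gradMap hΛ u = 0) : (u : PSpace n → PSpace n) =ᵐ[volume.restrict Λ] 0 := by
  obtain ⟨C, hC⟩ := exists_norm_valMap_le hn hΛ
  have h1 := hC u
  rw [h, norm_zero, mul_zero, norm_le_zero_iff, Lp.eq_zero_iff_ae_eq_zero] at h1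
  exact ae_eq_of_ae_eq_cell hL hΛ.isOpen hΛ.periodic (H10.isL2Per u.2).periodic
    (fun _ _ => rfl) ((valMap_ae_eq hΛ u).symm.trans h1)

/-- The variational problem has a unique solution. -/
theorem exists_variational_solution (hn : 1 ≤ n) (hL : 0 < L) (hΛ : IsPipe L Λ)
    (f : V L Λ →ₗ[ℝ] ℝ) (hf : IsBoundedFunctional L Λ f) :
    ∃ v, IsUniqueVariationalSolution L Λ f v := by
  set ι := Submodule.inclusion (V_le_H10 L Λ) with hι
  obtain ⟨B, hB⟩ := hf
  have hin : ∀ u v : V L Λ, inner ℝ (gradMap hΛ (ι u)) (gradMap hΛ (ι v)) =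
      gradInner L Λ (u : PSpace n → PSpace n) v := fun u v => inner_gradMap hΛ (ι u) (ι v)
  obtain ⟨v, hv⟩ := exists_inner_map_eq ((gradMap hΛ).comp ι) (isClosed_range_gradMap_V hn hL hΛ)
    f (B := B) fun w => by
      rw [LinearMap.comp_apply, norm_gradMap]
      exact hB w
  refine ⟨v, ⟨v.2, fun φ => (hin v φ).symm.trans (hv φ)⟩, fun w hw hwf => ?_⟩
  -- The difference of two solutions is an admissible test field, so its gradient is orthogonal to
  -- itself.
  have hd : gradMap hΛ (ι (⟨w, hw⟩ - v)) = 0 := by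
    rw [← inner_self_eq_zero (𝕜 := ℝ)]
    rw [map_sub, map_sub, inner_sub_left, sub_eq_zero, ← map_sub, ← map_sub, hin, hin]
    rw [hwf (⟨w, hw⟩ - v)]
    exact ((hin v _).symm.trans (hv _)).symm
  have h0 := ae_eq_zero_of_gradMap_eq_zero hn hL hΛ _ hd
  filter_upwards [h0] with x hx
  exact sub_eq_zero.1 hx

/-- Every field in `H10` has zero trace. -/
theorem hasTrace_zero (hΛ : IsPipe L Λ) (u : H10 L Λ) :
    HasTrace L Λ (u : PSpace n → PSpace n) 0 := by
  obtain ⟨-, G, -, hG, happ⟩ := u.2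
  choose φ hφ h1 h2 using fun k : ℕ => happ ((k : ℝ≥0∞) + 1)⁻¹ (by simp)
  have hlim : Tendsto (fun k : ℕ => ((k : ℝ≥0∞) + 1)⁻¹) atTop (𝓝 0) := by
    have := (tendsto_add_atTop_iff_nat 1).2 ENNReal.tendsto_inv_nat_nhds_zero
    simpa using this
  refine ⟨φ, fun k => ⟨(hφ k).smooth, (hφ k).periodic⟩, ?_, fun j => ?_, ?_⟩
  · exact tendsto_of_tendsto_of_tendsto_of_le_of_le tendsto_const_nhds hlim
      (fun _ => zero_le) h1
  · refine tendsto_of_tendsto_of_tendsto_of_le_of_le tendsto_const_nhds hlim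
      (fun _ => zero_le) fun k => (eLpNorm_congr_ae ?_).trans_le (h2 k j)
    have h : weakGrad Λ (u : PSpace n → PSpace n) j =ᵐ[volume.restrict (cell L Λ)] G j :=
      ae_cell_of_ae (hG.weakGrad_ae_eq hΛ.isOpen j)
    filter_upwards [h] with x hx
    rw [hx]
  -- The approximating test fields vanish outside the open set `Λ`, in particular on its frontier,
  -- so their boundary norms are exactly zero.
  · have hm : MeasurableSet (lateral L Λ) := by
      refine isClosed_frontier.measurableSet.inter ?_
      exact (measurableSet_le measurable_const continuous_zc.measurable).inter
        (measurableSet_lt continuous_zc.measurable measurable_const)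
    have : ∀ k, eLpNorm (fun x => φ k x - (0 : PSpace n → PSpace n) x) 2
        ((Measure.hausdorffMeasure (n : ℝ)).restrict (lateral L Λ)) = 0 := fun k => by
      rw [eLpNorm_congr_ae (g := 0), eLpNorm_zero]
      filter_upwards [ae_restrict_mem hm] with x hx
      have hxΛ : x ∉ Λ := fun hxΛ =>
        (hΛ.isOpen.frontier_eq ▸ hx.1 : x ∈ closure Λ \ Λ).2 hxΛ
      simp [image_eq_zero_of_notMem_tsupport fun h => hxΛ ((hφ k).supp h)]
    simp only [this]
    exact tendsto_const_nhds

theorem isPeriodicNoSlip (hL : 0 < L) (hΛ : IsPipe L Λ) {v : PSpace n → PSpace n}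
    (hv : v ∈ V L Λ) (p : Lp ℝ 2 (volume.restrict (cell L Λ))) :
    IsPeriodicNoSlip L Λ v (perExt L p) where
  velocity := by
    obtain ⟨h1, G, h2, h3, -⟩ := hv.1
    exact ⟨h1, G, h2, h3⟩
  pressure := isL2Per_perExt hL hΛ.isOpen hΛ.periodic (Lp.memLp p)
  divFree := hv.2
  noSlip := hasTrace_zero hΛ ⟨v, hv.1⟩

theorem gradInner_of_isPerTest (hΛ : IsPipe L Λ) (v φ : H10 L Λ)
    (hφ : IsPerTest L Λ (φ : PSpace n → PSpace n)) :
    inner ℝ (gradMap hΛ v) (gradMap hΛ φ) = ∫ x in cell L Λ,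
      ∑ j, inner ℝ (weakGrad Λ (v : PSpace n → PSpace n) j x)
        (pd j (φ : PSpace n → PSpace n) x) := by
  rw [inner_gradMap]
  refine integral_congr_ae ?_
  have h : ∀ᵐ x ∂volume.restrict (cell L Λ), ∀ j,
      weakGrad Λ (φ : PSpace n → PSpace n) j x = pd j (φ : PSpace n → PSpace n) x :=
    ae_all_iff.2 fun j => ae_cell_of_ae (hφ.hasWeakGrad.weakGrad_ae_eq hΛ.isOpen j)
  filter_upwards [h] with x hx
  simp only [hx]

theorem inner_divMap_of_isPerTest (hL : 0 < L) (hΛ : IsPipe L Λ)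
    (p : Lp ℝ 2 (volume.restrict (cell L Λ))) (φ : H10 L Λ)
    (hφ : IsPerTest L Λ (φ : PSpace n → PSpace n)) :
    inner ℝ p (divMap L Λ (gradMap hΛ φ)) =
      ∫ x in cell L Λ, perExt L p x * div (φ : PSpace n → PSpace n) x := by
  rw [L2.inner_def]
  refine integral_congr_ae ?_
  filter_upwards [divMap_gradMap_of_isPerTest hΛ φ hφ, perExt_ae_eq hL hΛ.isOpen p] with x h1 h2
  rw [h1, h2]
  exact mul_comm _ _

/-- The functional ((v, ·)) - F is bounded and, by the variational equation, vanishes on 𝕍; its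
density with respect to the divergence is the pressure. -/
theorem exists_pressure_momentum (hn : 1 ≤ n) (hL : 0 < L) (hΛ : IsPipe L Λ)
    {v : PSpace n → PSpace n} (hv : v ∈ V L Λ) (F : H10 L Λ →ₗ[ℝ] ℝ)
    {B : ℝ} (hB : ∀ w, |F w| ≤ B * ‖gradMap hΛ w‖)
    (hF : ∀ φ : V L Λ, gradInner L Λ v φ = F (Submodule.inclusion (V_le_H10 L Λ) φ)) :
    ∃ p : Lp ℝ 2 (volume.restrict (cell L Λ)),
      ∀ φ : H10 L Λ, IsPerTest L Λ (φ : PSpace n → PSpace n) →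
        (∫ x in cell L Λ, ∑ j, inner ℝ (weakGrad Λ v j x) (pd j (φ : PSpace n → PSpace n) x)) -
          ∫ x in cell L Λ, perExt L p x * div φ x = F φ := by
  set v' : H10 L Λ := ⟨v, hv.1⟩ with hv'
  obtain ⟨p, hp⟩ := exists_pressure hn hL hΛ
    ((innerₗ (TensorL2 L Λ) (gradMap hΛ v')).comp (gradMap hΛ) - F)
    (B := ‖gradMap hΛ v'‖ + B) (fun w => by
      have h1 : |(innerₗ (TensorL2 L Λ) (gradMap hΛ v')).comp (gradMap hΛ) w| ≤
          ‖gradMap hΛ v'‖ * ‖gradMap hΛ w‖ :=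
        abs_real_inner_le_norm (gradMap hΛ v') (gradMap hΛ w)
      rw [LinearMap.sub_apply, add_mul]
      exact (abs_sub _ _).trans (add_le_add h1 (hB w))) (fun w hw => by
      rw [LinearMap.sub_apply, sub_eq_zero]
      exact (inner_gradMap hΛ v' w).trans (hF ⟨w, hw⟩))
  refine ⟨p, fun φ hφ => ?_⟩
  rw [← inner_divMap_of_isPerTest hL hΛ p φ hφ, ← hp φ, ← gradInner_of_isPerTest hΛ v' φ hφ,
    LinearMap.sub_apply]
  exact sub_sub_cancel _ _

end Pressure

end Pipe

end

noncomputable section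

namespace Pipe

open scoped NNReal

variable {n : ℕ}

/-! ### Square integrable forces -/

section Force

variable {L : ℝ} {Λ : Set (PSpace n)}

/-- The functional `(f, ·)` on `H10`. -/
def forceMap (hΛ : IsPipe L Λ) {f : PSpace n → PSpace n} (hf : IsL2Per L Λ f) :
    H10 L Λ →ₗ[ℝ] ℝ :=
  (innerₗ _ (hf.memLp_cell hΛ.cell_bounded).toLp).comp (valMap hΛ)

theorem forceMap_apply (hΛ : IsPipe L Λ) {f : PSpace n → PSpace n} (hf : IsL2Per L Λ f)
    (u : H10 L Λ) : forceMap hΛ hf u = l2Inner L Λ f u := by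
  change inner ℝ (hf.memLp_cell hΛ.cell_bounded).toLp (valMap hΛ u) = _
  rw [L2.inner_def]
  refine integral_congr_ae ?_
  filter_upwards [(hf.memLp_cell hΛ.cell_bounded).coeFn_toLp, valMap_ae_eq hΛ u] with x h1 h2
  rw [h1, h2]

theorem exists_abs_forceMap_le (hn : 1 ≤ n) (hΛ : IsPipe L Λ) {f : PSpace n → PSpace n}
    (hf : IsL2Per L Λ f) : ∃ B : ℝ, ∀ w, |forceMap hΛ hf w| ≤ B * ‖gradMap hΛ w‖ := by
  obtain ⟨C, hC⟩ := exists_norm_valMap_le hn hΛ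
  refine ⟨‖(hf.memLp_cell hΛ.cell_bounded).toLp‖ * C, fun w => ?_⟩
  refine (abs_real_inner_le_norm (hf.memLp_cell hΛ.cell_bounded).toLp (valMap hΛ w)).trans ?_
  rw [mul_assoc]
  gcongr
  exact hC w

theorem integral_inner_eq_cell (hL : 0 < L) (hΛ : IsPipe L Λ) {u : PSpace n → PSpace n}
    (hu : IsL2Per L Λ u) {g : PSpace n → PSpace n} (hg : Continuous g)
    (hc : HasCompactSupport g) (hs : tsupport g ⊆ Λ) :
    ∫ x in Λ, inner ℝ (u x) (g x) = ∫ x in cell L Λ, inner ℝ (u x) (per L g x) := by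
  have : ∫ x in Λ, inner ℝ (g x) (u x) = ∫ x in cell L Λ, inner ℝ (per L g x) (u x) :=
    integral_pairing_eq_cell (innerSL ℝ : PSpace n →L[ℝ] PSpace n →L[ℝ] ℝ) hL hΛ.isOpen
      hΛ.periodic hu.locInt hu.periodic hg hc hs
  simpa only [real_inner_comm] using this

theorem continuous_pd_of_contDiff {F : Type*} [NormedAddCommGroup F] [NormedSpace ℝ F]
    {ψ : PSpace n → F} (hψ : ContDiff ℝ ∞ ψ) (j : Fin (n + 1)) : Continuous (pd j ψ) :=
  (hψ.continuous_fderiv (by simp)).clm_apply continuous_const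

/-- Pairing with a compactly supported test field over the pipe equals pairing with its
periodization over the cell. This is how the equation for periodic test fields yields the equation
in the sense of distributions. -/
theorem integral_grad_eq_cell (hL : 0 < L) (hΛ : IsPipe L Λ) {v : PSpace n → PSpace n}
    (hv : v ∈ H10 L Λ) {ψ : PSpace n → PSpace n} (hψ : IsTest Λ ψ) :
    ∫ x in Λ, ∑ j, inner ℝ (weakGrad Λ v j x) (pd j ψ x) =
      ∫ x in cell L Λ, ∑ j, inner ℝ (weakGrad Λ v j x) (pd j (per L ψ) x) := by
  obtain ⟨-, G, hG2, hG, -⟩ := hv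
  have hφ := isPerTest_per hL hΛ.periodic hψ
  obtain ⟨M, hM⟩ := exists_zc_bound hψ.compact
  have hae : ∀ᵐ x ∂volume.restrict Λ, ∀ j, weakGrad Λ v j x = G j x :=
    ae_all_iff.2 (hG.weakGrad_ae_eq hΛ.isOpen)
  have e1 : ∫ x in Λ, ∑ j, inner ℝ (weakGrad Λ v j x) (pd j ψ x) =
      ∫ x in Λ, ∑ j, inner ℝ (G j x) (pd j ψ x) :=
    integral_congr_ae (hae.mono fun x hx => by simp only [hx])
  have e2 : ∫ x in cell L Λ, ∑ j, inner ℝ (weakGrad Λ v j x) (pd j (per L ψ) x) =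
      ∫ x in cell L Λ, ∑ j, inner ℝ (G j x) (pd j (per L ψ) x) :=
    integral_congr_ae ((ae_cell_of_ae hae).mono fun x hx => by simp only [hx])
  have hc : ∀ j, HasCompactSupport (pd j ψ) := fun j => hψ.compact.fderiv_apply ℝ (bvec j)
  have hs : ∀ j, tsupport (pd j ψ) ⊆ Λ := fun j =>
    (tsupport_fderiv_apply_subset ℝ (bvec j)).trans hψ.supp
  have hi : ∀ j, Integrable (fun x => inner ℝ (G j x) (pd j ψ x)) (volume.restrict Λ) :=
    fun j => by
      have : Integrable (fun x => inner ℝ (pd j ψ x) (G j x)) (volume.restrict Λ) :=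
        integrable_pairing (innerSL ℝ : PSpace n →L[ℝ] PSpace n →L[ℝ] ℝ)
          (hG.locInt_grad j) (continuous_pd_of_contDiff hψ.smooth j) (hc j) (hs j)
      simpa only [real_inner_comm] using this
  have hi' : ∀ j, Integrable (fun x => inner ℝ (G j x) (pd j (per L ψ) x))
      (volume.restrict (cell L Λ)) := fun j =>
    (L2.integrable_inner (𝕜 := ℝ) ((hG2 j).memLp_cell hΛ.cell_bounded).toLp
      ((hφ.isL2Per_pd j).memLp_cell hΛ.cell_bounded).toLp).congr (by
        filter_upwards [((hG2 j).memLp_cell hΛ.cell_bounded).coeFn_toLp,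
          ((hφ.isL2Per_pd j).memLp_cell hΛ.cell_bounded).coeFn_toLp] with x h1 h2
        rw [h1, h2])
  rw [e1, e2, integral_finsetSum _ fun j _ => hi j, integral_finsetSum _ fun j _ => hi' j]
  refine Finset.sum_congr rfl fun j _ => ?_
  rw [integral_inner_eq_cell hL hΛ (hG2 j) (continuous_pd_of_contDiff hψ.smooth j) (hc j) (hs j),
    pd_per hL (hψ.smooth.differentiable (by simp)) hM j]

theorem integral_mul_div_eq_cell (hL : 0 < L) (hΛ : IsPipe L Λ) {p : PSpace n → ℝ}
    (hp : IsL2Per L Λ p) {ψ : PSpace n → PSpace n} (hψ : IsTest Λ ψ) :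
    ∫ x in Λ, p x * div ψ x = ∫ x in cell L Λ, p x * div (per L ψ) x := by
  obtain ⟨M, hM⟩ := exists_zc_bound hψ.compact
  have hsub : Function.support (div ψ) ⊆ Function.support (fderiv ℝ ψ) := fun x hx h0 =>
    hx (by simp [div, pd, h0])
  have hcont : Continuous (div ψ) := by
    unfold div
    exact continuous_finsetSum _ fun j _ =>
      (EuclideanSpace.proj j : PSpace n →L[ℝ] ℝ).continuous.comp
        (continuous_pd_of_contDiff hψ.smooth j)
  have := integral_pairing_eq_cell (ContinuousLinearMap.mul ℝ ℝ) hL hΛ.isOpen hΛ.periodic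
    hp.locInt hp.periodic hcont ((hψ.compact.fderiv ℝ).mono hsub)
    ((closure_mono hsub).trans ((tsupport_fderiv_subset ℝ).trans hψ.supp))
  simp only [ContinuousLinearMap.mul_apply'] at this
  rw [div_per hL (hψ.smooth.differentiable (by simp)) hM]
  simpa only [mul_comm] using this

end Force

end Pipe

end

/-! ### The theorem: square integrable forces and forces in the dual space. -/

theorem theorem2p1 {n : ℕ} (hn : 1 ≤ n) {L : ℝ} (hL : 0 < L) {Λ : Set (PSpace n)}
    (hΛ : Pipe.IsPipe L Λ) :
    (∀ f : PSpace n → PSpace n, Pipe.IsL2Per L Λ f →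
      ∃ v, Pipe.IsUniqueVariationalSolution L Λ (fun φ => Pipe.l2Inner L Λ f φ) v ∧
        ∃ p, Pipe.SolvesStokes L Λ f v p) ∧
    (∀ f : Pipe.V L Λ →ₗ[ℝ] ℝ, Pipe.IsBoundedFunctional L Λ f →
      ∃ v, Pipe.IsUniqueVariationalSolution L Λ f v ∧
        (∃ F : Pipe.H10 L Λ →ₗ[ℝ] ℝ, Pipe.IsBoundedFunctional L Λ F ∧
          F.comp (Submodule.inclusion (Pipe.V_le_H10 L Λ)) = f) ∧
        ∀ F : Pipe.H10 L Λ →ₗ[ℝ] ℝ, Pipe.IsBoundedFunctional L Λ F →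
          F.comp (Submodule.inclusion (Pipe.V_le_H10 L Λ)) = f →
            ∃ p, Pipe.SolvesStokesDual L Λ F v p) := by
  refine ⟨fun f hf => ?_, fun f hf => ?_⟩
  · obtain ⟨B, hB⟩ := Pipe.exists_abs_forceMap_le hn hΛ hf
    set F := Pipe.forceMap hΛ hf with hF
    have hfV : (fun φ : Pipe.V L Λ => Pipe.l2Inner L Λ f φ) =
        F.comp (Submodule.inclusion (Pipe.V_le_H10 L Λ)) :=
      funext fun φ => (Pipe.forceMap_apply hΛ hf (Submodule.inclusion _ φ)).symm
    obtain ⟨v, hv⟩ := Pipe.exists_variational_solution hn hL hΛ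
      (F.comp (Submodule.inclusion (Pipe.V_le_H10 L Λ)))
      ⟨B, fun φ => by
        have := hB (Submodule.inclusion (Pipe.V_le_H10 L Λ) φ)
        rwa [Pipe.norm_gradMap] at this⟩
    refine ⟨v, hfV ▸ hv, ?_⟩
    obtain ⟨p, hp⟩ := Pipe.exists_pressure_momentum hn hL hΛ hv.1.1 F hB hv.1.2
    have hns := Pipe.isPeriodicNoSlip hL hΛ hv.1.1 p
    refine ⟨Pipe.perExt L p, hns, fun ψ hψ => ?_⟩
    -- The periodization of the compactly supported test field is an admissible periodic test field
    -- in the momentum equation on the cell.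
    have hφ := Pipe.isPerTest_per hL hΛ.periodic hψ
    rw [Pipe.integral_grad_eq_cell hL hΛ hv.1.1.1 hψ,
      Pipe.integral_mul_div_eq_cell hL hΛ hns.pressure hψ,
      Pipe.integral_inner_eq_cell hL hΛ hf hψ.smooth.continuous hψ.compact hψ.supp]
    exact (hp ⟨_, hφ.mem_H10⟩ hφ).trans (Pipe.forceMap_apply hΛ hf _)
  · obtain ⟨v, hv⟩ := Pipe.exists_variational_solution hn hL hΛ f hf
    refine ⟨v, hv, ?_, fun F hF hFf => ?_⟩
    -- The solution itself supplies the extension: ((v, ·)) is defined and bounded on all of H10 and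
    -- agrees with `f` on 𝕍, so no Hahn–Banach argument is needed.
    · refine ⟨(innerₗ (Pipe.TensorL2 L Λ) (Pipe.gradMap hΛ ⟨v, hv.1.1.1⟩)).comp
        (Pipe.gradMap hΛ), ⟨‖Pipe.gradMap hΛ ⟨v, hv.1.1.1⟩‖, fun φ => ?_⟩, ?_⟩
      · rw [← Pipe.norm_gradMap hΛ]
        exact abs_real_inner_le_norm (Pipe.gradMap hΛ ⟨v, hv.1.1.1⟩) (Pipe.gradMap hΛ φ)
      · ext φ
        exact (Pipe.inner_gradMap hΛ _ _).trans (hv.1.2 φ)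
    · obtain ⟨B, hB⟩ := hF
      obtain ⟨p, hp⟩ := Pipe.exists_pressure_momentum hn hL hΛ hv.1.1 F (B := B)
        (fun w => by rw [Pipe.norm_gradMap]; exact hB w)
        (fun φ => by rw [hv.1.2 φ, ← hFf]; rfl)
      exact ⟨Pipe.perExt L p, Pipe.isPeriodicNoSlip hL hΛ hv.1.1 p, hp⟩
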